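/- **Model.** Fix $n\ge 1$ buyers and a probability distribution $\mathcal P$ of $(\mathbf b,s)\in[0,1]^{n}\times[0,1]$ (buyers' valuations, seller's valuation). Let $\overline b$ and $\underline b$ be the highest and second-highest entries of $\mathbf b$ (counted with multiplicity; $\underline b=0$ if $n=1$). For a seller price $p$ and a reserve price $q$ put $$\mathsf{GFT}_{\mathbf b,s}(p,q)=(\overline b-s)\,\mathbb I(s\le p)\,\mathbb I(\overline b\ge q),\qquad \mathsf{Rev}_{\mathbf b,s}(p,q)=(\max\{q,\underline b\}-p)\,\mathbb I(s\le p)\,\mathbb I(\overline b\ge q),$$ let $\mathsf{GFT}(p,q),\mathsf{Rev}(p,q)$ be their expectations under $\mathcal P$, and let $\mathsf{Opt}=\sup\{\mathsf{GFT}(p,q): p,q\in[0,1],\ \mathsf{Rev}(p,q)\ge 0\}$. In rounds $t=1,\dots,T$ the valuations $(\mathbf b_t,s_t)\sim\mathcal P$ are i.i.d., independent of the learner's i.i.d. uniform numbers $U_t\in[0,1]$; the learner posts $(p_t,q_t)$, and $\mathsf{GFT}_t,\mathsf{Rev}_t$ denote the values at $(\mathbf b_t,s_t)$. **Algorithm**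 with inputs $K,T_0,\delta,\beta,\bar\zeta$ (ties in every $\arg\max$ are broken arbitrarily by a fixed rule; upper, resp. lower, confidence bounds without observations are $+\infty$, resp. $-\infty$). 1. *Grid estimation* (rounds $1,\dots,T_0$): post $q_t=0$, $p_t=\underline b_t$. Put $x_0=0$ and, for $k<K$, let $x_{k+1}$ be the largest observed $q\in\{\overline b_1,\dots,\overline b_{T_0}\}$ with $|\{t\le T_0: x_k<\overline b_t<q\}|\le T_0/K$ (and $1$ if there is none). Let $\mathcal B^S=\{i/K\}_{0\le i\le K}$, let $\mathcal B^B$ be the family (a multiset of size $2K+2$) consisting of $x_0,\dots,x_K$ and of the points $i/K$, and $\mathcal B=\mathcal B^S\times\mathcal B^B$. 2. *Revenue accumulation*: let $F_K$ consist of the mechanisms $(p,p+2^{-j})$, $p\in\mathcal B^S$, and $(\max\{q,\underline b_t\}-2^{-j},q)$, $q\in\mathcal B^B$, with $1\le j\le\lceil\log_2 T\rceil$ (prices outside $[0,1]$ simply lead to no trade). From round $T_0+1$ on, play the UCB rule on $F_K$: post the mechanism maximizing (average observed revenue) $+\,2\sqrt{\ln(2|F_K|T/\delta)/(2m)}$,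 $m$ its number of plays. Let $\tau$ be the first round by the end of which the revenue accumulated in this phase is at least $\beta$. If there is no such $\tau<T-T_0$, this phase goes on until round $T$. 3. *Exploration* (rounds $\tau+1,\dots,\tau+T_0$): post $(U_t,0)$. For $(p,q)\in\mathcal B$ set $\overline{\mathsf{GFT}}_1(p,q)=\frac1{T_0}\sum_{t=\tau+1}^{\tau+T_0}\mathbb I(s_t\le U_t\le p)\,\mathbb I(\overline b_t\ge q)+2\sqrt{\ln(|\mathcal B|/\delta)/(2T_0)}$. 4. *Successive arm elimination with precedences* (rounds $\tau+T_0+1,\dots,T$) on the arms $\mathcal B$; the arms with the same $p$ form a line. The set $\mathcal S$ of surviving arms starts as $\mathcal B$. Rewards and costs are $$r_t(p,q)=\tfrac12\big(\overline{\mathsf{GFT}}_1(p,q)+(\overline b_t-p)\mathbb I(\overline b_t\ge q)\mathbb I(s_t\le p)\big),\qquad c_t(p,q)=\tfrac1{1+\bar\zeta}\big(-\mathsf{Rev}_t(p,q)-\bar\zeta\big),$$ and $\overline r,\underline r,\underline c$ are the observed averages $\pm\,2\sqrt{\ln(2|\mathcal B|T/\delta)/(2m)}$, $m$ the number of observations of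 the arm in this phase. In each round take the line of an arm of $\mathcal S$ with the largest $\overline r$; on this line play the surviving arm with the smallest $q$ whose $\overline r$ is at least $\underline r$ of every surviving arm of the line; observe $r_t,c_t$ of all arms of the line with reserve price at least the one played; then remove from $\mathcal S$ the arms of the line that have a smaller reserve price than the one played or satisfy $\underline c>0$. (If $\mathcal S$ is empty, post $(0,1)$.) **Theorem.** For every $M$ there are constants $C,c$ and inputs $\beta=\beta(T,\delta)$, $\bar\zeta=\bar\zeta(T,\delta)$ with $$0<\beta\le C\,T^{2/3}\,(1+\ln\tfrac T\delta)^c,\qquad 0<\bar\zeta\le C\,T^{-1/3}\,(1+\ln\tfrac T\delta)^c,$$ such that the following holds for all $n\ge1$ and all $\mathcal P$ as above for which either $\mathcal P=\mathcal P^B\times\mathcal P^S$ (buyers' and seller's valuations are independent) or $\mathcal P$ has a Lebesgue density bounded by $M$, all $T\ge1$ and all $\delta\in(0,1)$: the algorithm with $K=\lceil T^{1/3}\rceil$, $T_0=\lceil T^{2/3}\rceil$, $\beta$ and $\bar\zeta$ satisfies $$R_T:=T\cdot\mathsf{Opt}-\mathbb E\Big[\sum_{t=1}^T\mathsf{GFT}_t(p_t,q_t)\Big]\le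 C\,T^{2/3}\,(1+\ln\tfrac T\delta)^c,$$ and, with probability at least $1-6\delta$, both $$T\cdot\mathsf{Opt}-\sum_{t=1}^T\mathsf{GFT}_t(p_t,q_t)\le C\,T^{2/3}\,(1+\ln\tfrac T\delta)^c\qquad\text{and}\qquad\sum_{t=1}^T\mathsf{Rev}_t(p_t,q_t)\ge0 .$$ -/

import Mathlib

open MeasureTheory

namespace TwoSidedMarket

noncomputable section

/-! ### The market -/

/-- A profile of valuations: the `n` buyers' valuations and the seller's valuation. -/
abbrev Val (n : ℕ) : Type := (Fin n → ℝ) × ℝ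

/-- The highest buyer valuation. -/
def topBid {n : ℕ} (v : Val n) : ℝ := ⨆ i, v.1 i

/-- The second-highest buyer valuation, counted with multiplicity (so it equals `topBid` if two
buyers tie for the highest valuation): the largest value of `min (b i) (b j)` over pairs of
distinct buyers. With one buyer the supremum is over the empty type and equals `0`. -/
def secondBid {n : ℕ} (v : Val n) : ℝ :=
  ⨆ ij : {ij : Fin n × Fin n // ij.1 ≠ ij.2}, min (v.1 ij.1.1) (v.1 ij.1.2)

/-- Gain from trade of the seller price `p` and the reserve price `q` on the valuations `v`. -/
def gft {n : ℕ} (p q : ℝ) (v : Val n) : ℝ :=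
  if v.2 ≤ p ∧ q ≤ topBid v then topBid v - v.2 else 0

/-- Revenue of the seller price `p` and the reserve price `q` on the valuations `v`. -/
def rev {n : ℕ} (p q : ℝ) (v : Val n) : ℝ :=
  if v.2 ≤ p ∧ q ≤ topBid v then max q (secondBid v) - p else 0

/-- Expected gain from trade of fixed prices. -/
def expGFT {n : ℕ} (P : Measure (Val n)) (p q : ℝ) : ℝ := ∫ v, gft p q v ∂P

/-- Expected revenue of fixed prices. -/
def expRev {n : ℕ} (P : Measure (Val n)) (p q : ℝ) : ℝ := ∫ v, rev p q v ∂P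

/-- The baseline: the supremum of the expected gain from trade over the fixed prices in `[0,1]²`
whose expected revenue is nonnegative. -/
def opt {n : ℕ} (P : Measure (Val n)) : ℝ :=
  sSup {g | ∃ p ∈ Set.Icc (0 : ℝ) 1, ∃ q ∈ Set.Icc (0 : ℝ) 1,
    0 ≤ expRev P p q ∧ g = expGFT P p q}

/-- All valuations lie in `[0,1]`. -/
def UnitSupported {n : ℕ} (P : Measure (Val n)) : Prop :=
  ∀ᵐ v ∂P, (∀ i, v.1 i ∈ Set.Icc (0 : ℝ) 1) ∧ v.2 ∈ Set.Icc (0 : ℝ) 1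

/-- The buyers' valuations are (jointly) independent of the seller's valuation. -/
def IndependentSides {n : ℕ} (P : Measure (Val n)) : Prop :=
  ∃ (PB : Measure (Fin n → ℝ)) (PS : Measure ℝ),
    IsProbabilityMeasure PB ∧ IsProbabilityMeasure PS ∧ P = PB.prod PS

/-- The joint distribution has a density, with respect to Lebesgue measure, bounded by `M`. -/
def BoundedDensity {n : ℕ} (M : ℝ) (P : Measure (Val n)) : Prop :=
  ∃ f : Val n → ENNReal, Measurable f ∧ (∀ v, f v ≤ ENNReal.ofReal M) ∧
    P = (volume : Measure (Val n)).withDensity f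

/-! ### Randomness

Round `t` (rounds are numbered `0, …, T - 1`) carries the valuations drawn from `P` and an
independent uniform number of the learner; the rounds are independent. -/

/-- Valuations of a round together with the learner's uniform number. -/
abbrev Round (n : ℕ) : Type := Val n × ℝ

/-- The uniform distribution on `[0,1]`. -/
def unif : Measure ℝ := volume.restrict (Set.Icc (0 : ℝ) 1)

instance : IsProbabilityMeasure unif :=
  ⟨by simp [unif]⟩

/-- The law of the sequence of rounds. -/
def seqLaw {n : ℕ} (P : Measure (Val n)) [IsProbabilityMeasure P] : Measure (ℕ → Round n) :=
  Measure.infinitePi fun _ : ℕ => P.prod unif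

/-! ### Confidence bounds and maximisers -/

/-- Upper confidence bound from `m` observations with the given sum; `+∞` without observations.
The number `ℓ` is the logarithmic factor. -/
def upper (ℓ : ℝ) (m : ℕ) (sum : ℝ) : EReal :=
  if m = 0 then ⊤ else ((sum / m + 2 * √(ℓ / (2 * m)) : ℝ) : EReal)

/-- Lower confidence bound from `m` observations with the given sum; `-∞` without observations. -/
def lower (ℓ : ℝ) (m : ℕ) (sum : ℝ) : EReal :=
  if m = 0 then ⊥ else ((sum / m - 2 * √(ℓ / (2 * m)) : ℝ) : EReal)

/-- A maximiser of `f` over `s` (ties are broken arbitrarily). -/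
def argmaxOn {ι : Type} [Nonempty ι] (s : Finset ι) (f : ι → EReal) : ι :=
  Classical.epsilon fun a => a ∈ s ∧ ∀ b ∈ s, f b ≤ f a

/-! ### The algorithm -/

/-- Inputs of the algorithm: grid size `K`, length `T0` of the grid estimation phase and of the
exploration phase, horizon `T`, confidence `δ`, budget threshold `β`, and the shift `ζ` of the
revenue constraint. -/
structure Params where
  K : ℕ
  T0 : ℕ
  T : ℕ
  δ : ℝ
  β : ℝ
  ζ : ℝ

variable {n : ℕ}

/-! #### Grid estimation (rounds `0, …, T0 - 1`) -/

/-- The step of the adaptive grid: the largest `q` among the observed values `x 0, …, x (T0 - 1)`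
such that at most `T0 / K` observations lie strictly between `a` and `q` (and `1` if there is no
such `q`). -/
def nextCut (A : Params) (x : ℕ → ℝ) (a : ℝ) : ℝ :=
  let c := ((Finset.range A.T0).image x).filter fun q =>
    (((Finset.range A.T0).filter fun t => a < x t ∧ x t < q).card : ℝ) ≤ (A.T0 : ℝ) / A.K
  if h : c.Nonempty then c.max' h else 1

/-- The adaptive grid points `0 = p_0, p_1, …, p_K`. -/
def cut (A : Params) (x : ℕ → ℝ) : ℕ → ℝ
  | 0 => 0
  | k + 1 => nextCut A x (cut A x k)

/-- The sellers' grid `i / K`, `i = 0, …, K`. -/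
def sellerPrice (A : Params) (i : ℕ) : ℝ := (i : ℝ) / A.K

/-- The buyers' grid, as a family indexed by `j = 0, …, 2 K + 1`: the adaptive grid points
(`j ≤ K`) followed by the uniform grid points `0, 1 / K, …, 1`. -/
def buyerPrice (A : Params) (ω : ℕ → Round n) (j : ℕ) : ℝ :=
  if j ≤ A.K then cut A (fun t => topBid (ω t).1) j
  else ((j : ℝ) - (A.K + 1)) / A.K

/-- Index set of the grid of price pairs (seller index, buyer index). -/
def grid (A : Params) : Finset (ℕ × ℕ) :=
  Finset.range (A.K + 1) ×ˢ Finset.range (2 * A.K + 2)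

/-! #### Revenue accumulation (from round `T0` on): UCB over the mechanisms `F_K` -/

/-- Labels of the revenue mechanisms: `inl (i, j)` is in `F_K⁺`, `inr (i, j)` is in `F_K⁻`. -/
abbrev FArm : Type := (ℕ × ℕ) ⊕ (ℕ × ℕ)

/-- The set `F_K`. -/
def fSet (A : Params) : Finset FArm :=
  (Finset.range (A.K + 1) ×ˢ Finset.Icc 1 ⌈Real.logb 2 A.T⌉₊).disjSum
    (Finset.range (2 * A.K + 2) ×ˢ Finset.Icc 1 ⌈Real.logb 2 A.T⌉₊)

/-- The pair (seller price, reserve price) posted by a mechanism of `F_K` on the valuations `v`.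
In `F_K⁻` the seller price depends on the outcome of the auction. -/
def fPrices (A : Params) (ω : ℕ → Round n) (v : Val n) : FArm → ℝ × ℝ
  | .inl (i, j) => (sellerPrice A i, sellerPrice A i + 2⁻¹ ^ j)
  | .inr (i, j) =>
      (max (buyerPrice A ω i) (secondBid v) - 2⁻¹ ^ j, buyerPrice A ω i)

/-- Statistics of UCB: how often each mechanism was played, and its total revenue. -/
structure UCBState where
  count : FArm → ℕ
  total : FArm → ℝ

/-- The mechanism played by UCB in a given state. -/
def UCBState.arm (A : Params) (σ : UCBState) : FArm :=
  argmaxOn (fSet A) fun a =>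
    upper (Real.log (2 * (fSet A).card * A.T / A.δ)) (σ.count a) (σ.total a)

/-- The state of UCB after `k` of its rounds; its `k`-th round is round `T0 + k`. -/
def ucbState (A : Params) (ω : ℕ → Round n) : ℕ → UCBState
  | 0 => ⟨0, 0⟩
  | k + 1 =>
      let σ := ucbState A ω k
      let a := σ.arm A
      let v := (ω (A.T0 + k)).1
      let x := fPrices A ω v a
      ⟨Function.update σ.count a (σ.count a + 1),
        Function.update σ.total a (σ.total a + rev x.1 x.2 v)⟩

/-- The prices posted in the `k`-th round of UCB. -/
def ucbPrices (A : Params) (ω : ℕ → Round n) (k : ℕ) : ℝ × ℝ :=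
  fPrices A ω (ω (A.T0 + k)).1 ((ucbState A ω k).arm A)

/-- The revenue accumulated in the first `k` rounds of UCB. -/
def cumRev (A : Params) (ω : ℕ → Round n) (k : ℕ) : ℝ :=
  ∑ i ∈ Finset.range k,
    rev (ucbPrices A ω i).1 (ucbPrices A ω i).2 (ω (A.T0 + i)).1

/-- The number `τ` of rounds completed when the accumulated revenue first reaches `β`
(meaningful if it ever does). -/
def stopTime (A : Params) (ω : ℕ → Round n) : ℕ :=
  A.T0 + sInf {k | A.β ≤ cumRev A ω k}

/-- The revenue phase terminates at a time `τ < T - T0`. -/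
def Terminates (A : Params) (ω : ℕ → Round n) : Prop :=
  ∃ k, A.β ≤ cumRev A ω k ∧ A.T0 + k + A.T0 < A.T

/-! #### Exploration (rounds `τ, …, τ + T0 - 1`): estimation of `GFT_1` -/

/-- The empirical estimate of `GFT_1` at the grid point `a`, plus its confidence width. -/
def gft1Bar (A : Params) (ω : ℕ → Round n) (a : ℕ × ℕ) : ℝ :=
  (1 / (A.T0 : ℝ)) * ∑ t ∈ Finset.Ico (stopTime A ω) (stopTime A ω + A.T0),
      (if ((ω t).1.2 ≤ (ω t).2 ∧ (ω t).2 ≤ sellerPrice A a.1) ∧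
          buyerPrice A ω a.2 ≤ topBid (ω t).1 then (1 : ℝ) else 0)
    + 2 * √(Real.log ((grid A).card / A.δ) / (2 * A.T0))

/-! #### Successive arm elimination with precedences (from round `τ + T0` on)

The arm `(i, j)` is the price pair with seller index `i` and buyer index `j`; the arms with the
same `i` form a line, ordered by their reserve price. -/

/-- The reward of arm `a` on the valuations `v`. -/
def reward (A : Params) (ω : ℕ → Round n) (v : Val n) (a : ℕ × ℕ) : ℝ :=
  (1 / 2) * (gft1Bar A ω a +
    if buyerPrice A ω a.2 ≤ topBid v ∧ v.2 ≤ sellerPrice A a.1 then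
      topBid v - sellerPrice A a.1 else 0)

/-- The cost of arm `a` on the valuations `v`. -/
def cost (A : Params) (ω : ℕ → Round n) (v : Val n) (a : ℕ × ℕ) : ℝ :=
  (1 / (1 + A.ζ)) * (-rev (sellerPrice A a.1) (buyerPrice A ω a.2) v - A.ζ)

/-- The state of the elimination procedure: the surviving arms, and, for each arm, the number of
observations and the observed totals of its reward and of its cost. -/
structure SAEState where
  alive : Finset (ℕ × ℕ)
  count : ℕ × ℕ → ℕ
  rewardSum : ℕ × ℕ → ℝ
  costSum : ℕ × ℕ → ℝ

/-- The logarithmic factor of the confidence bounds. -/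
def saeLog (A : Params) : ℝ := Real.log (2 * (grid A).card * A.T / A.δ)

/-- Upper confidence bound on the reward. -/
def SAEState.rUp (A : Params) (σ : SAEState) (a : ℕ × ℕ) : EReal :=
  upper (saeLog A) (σ.count a) (σ.rewardSum a)

/-- Lower confidence bound on the reward. -/
def SAEState.rLow (A : Params) (σ : SAEState) (a : ℕ × ℕ) : EReal :=
  lower (saeLog A) (σ.count a) (σ.rewardSum a)

/-- Lower confidence bound on the cost. -/
def SAEState.cLow (A : Params) (σ : SAEState) (a : ℕ × ℕ) : EReal :=
  lower (saeLog A) (σ.count a) (σ.costSum a)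

/-- The chosen line: that of a surviving arm with the largest upper bound on the reward. -/
def SAEState.line (A : Params) (σ : SAEState) : ℕ :=
  (argmaxOn σ.alive (σ.rUp A)).1

/-- `j` is the buyer index of a surviving arm of line `i` whose upper bound on the reward is at
least the lower bound of every surviving arm of the line. -/
def SAEState.Candidate (A : Params) (σ : SAEState) (i j : ℕ) : Prop :=
  (i, j) ∈ σ.alive ∧ ∀ a ∈ σ.alive, a.1 = i → σ.rLow A a ≤ σ.rUp A (i, j)

open scoped Classical in
/-- The arm played: in the chosen line, the candidate with the smallest reserve price. If no arm
survives, the price pair `(0, 1)`. -/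
def SAEState.arm (A : Params) (ω : ℕ → Round n) (σ : SAEState) : ℕ × ℕ :=
  if σ.alive.Nonempty then
    (σ.line A, Classical.epsilon fun j => σ.Candidate A (σ.line A) j ∧
      ∀ j', σ.Candidate A (σ.line A) j' → buyerPrice A ω j ≤ buyerPrice A ω j')
  else (0, 2 * A.K + 1)

open scoped Classical in
/-- One round: play an arm, observe rewards and costs of all arms of its line with at least its
reserve price, and remove from the line the arms with a smaller reserve price and those whose
lower bound on the cost is positive. -/
def SAEState.step (A : Params) (ω : ℕ → Round n) (v : Val n) (σ : SAEState) : SAEState :=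
  let a := σ.arm A ω
  let obs : ℕ × ℕ → Prop := fun b =>
    b ∈ grid A ∧ b.1 = a.1 ∧ buyerPrice A ω a.2 ≤ buyerPrice A ω b.2
  let count' : ℕ × ℕ → ℕ := fun b => if obs b then σ.count b + 1 else σ.count b
  let rewardSum' : ℕ × ℕ → ℝ := fun b =>
    if obs b then σ.rewardSum b + reward A ω v b else σ.rewardSum b
  let costSum' : ℕ × ℕ → ℝ := fun b =>
    if obs b then σ.costSum b + cost A ω v b else σ.costSum b
  { alive := σ.alive.filter fun b =>
      b.1 = a.1 → (buyerPrice A ω a.2 ≤ buyerPrice A ω b.2 ∧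
        lower (saeLog A) (count' b) (costSum' b) ≤ 0)
    count := count'
    rewardSum := rewardSum'
    costSum := costSum' }

/-- The state after `k` rounds of the procedure; its `k`-th round is round `τ + T0 + k`. -/
def saeState (A : Params) (ω : ℕ → Round n) : ℕ → SAEState
  | 0 => ⟨grid A, 0, 0, 0⟩
  | k + 1 => (saeState A ω k).step A ω (ω (stopTime A ω + A.T0 + k)).1

/-- The prices posted in the `k`-th round of the procedure. -/
def saePrices (A : Params) (ω : ℕ → Round n) (k : ℕ) : ℝ × ℝ :=
  let a := (saeState A ω k).arm A ω
  (sellerPrice A a.1, buyerPrice A ω a.2)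

/-! #### The whole algorithm -/

open scoped Classical in
/-- The pair (seller price, reserve price) posted in round `t`. If the revenue phase does not
terminate before `T - T0`, it goes on until the horizon. -/
def prices (A : Params) (ω : ℕ → Round n) (t : ℕ) : ℝ × ℝ :=
  if t < A.T0 then (secondBid (ω t).1, 0)
  else if Terminates A ω ∧ stopTime A ω ≤ t then
    if t < stopTime A ω + A.T0 then ((ω t).2, 0)
    else saePrices A ω (t - (stopTime A ω + A.T0))
  else ucbPrices A ω (t - A.T0)

/-- The gain from trade collected over the horizon. -/
def totalGFT (A : Params) (ω : ℕ → Round n) : ℝ :=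
  ∑ t ∈ Finset.range A.T, gft (prices A ω t).1 (prices A ω t).2 (ω t).1

/-- The revenue collected over the horizon. -/
def totalRev (A : Params) (ω : ℕ → Round n) : ℝ :=
  ∑ t ∈ Finset.range A.T, rev (prices A ω t).1 (prices A ω t).2 (ω t).1

end

end TwoSidedMarket

/-!
The regret bound rests on three observations.

*Concentration without stopping times.* All randomness is a product measure on sequences of rounds,
and every quantity the algorithm averages is a sum, over rounds selected by a rule that looks only at
the past, of functions of the current round which are themselves determined by the past (`Sampling`).
Replacing one coordinate by an independent copy leaves the product measure invariant, so the
exponential of such a centred sum satisfies a supermartingale bound by induction on the number of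
rounds; this gives Hoeffding's inequality (`Sampling.hoeffding`) and a version uniform over the number
of selected rounds (`Sampling.uniform_deviation`). In particular the confidence bounds of the last
phase need no conditioning on the random time at which that phase starts.

*The revenue phase is cheap.* On a trade, gain plus revenue is `(b - p) + (max q b' - s)`, with `b` and
`b'` the two highest bids; after rounding to the grid each part is bounded by a dyadic sum of revenues
of the mechanisms in `F_K`. For prices of nonnegative expected revenue this bounds the gain; hence the
baseline is at most a logarithmic multiple of the largest mean revenue `ρ` in `F_K` plus a
discretisation error (`UnitSupported.opt_le_of_rev_le`). UCB
earns almost `ρ` per round (`le_cumRev`), so while less than `β` has been earned, the baseline times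
the number of rounds is of order `β` up to logarithms (`opt_mul_le`).

*The elimination phase is safe.* Rounding the optimal seller price up to the grid costs `O(1 / K)` by
independence or by the bounded density (`UnitSupported.exists_seller_price`), and rounding the reserve
price up to the data-driven grid skips bids of small probability only (`exists_cut_mem`,
`prob_not_hasGridNeighbour`). This yields a comparator arm whose shifted cost is nonpositive in the
mean. Along a line of fixed seller price, raising the reserve price can increase the reward only if it
also increases the revenue (`UnitSupported.integral_cost_le_of_reward_lt`). Therefore, whenever the
elimination rule removes a good arm, a better one with no larger cost survives (`exists_good_alive`).
All surviving arms of a line are observed at each play of the line, so the losses sum like those of a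
bandit with `K + 1` arms (`sum_le_of_line_bound`), and the revenue lost is covered by `β`.

For the bound on the expected regret, the probability that the regret is large must be `O(T^(-1/3))`
even for constant `δ`. This holds because the upper deviations of the costs matter only on the line of
the comparator, a `1 / (K + 1)` fraction of all arms (`UnitSupported.prob_not_costNotHigh`).
-/

namespace TwoSidedMarket

/-! ### Concentration along a sequence of independent rounds -/

section Concentration

set_option linter.unusedSectionVars false

variable {α : Type*}

/-- Two sequences agree before time `t`. -/
def AgreeBefore (t : ℕ) (ω ω' : ℕ → α) : Prop := ∀ s < t, ω s = ω' s

lemma AgreeBefore.symm {t : ℕ} {ω ω' : ℕ → α} (h : AgreeBefore t ω ω') : AgreeBefore t ω' ω :=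
  fun s hs => (h s hs).symm

lemma AgreeBefore.mono {s t : ℕ} {ω ω' : ℕ → α} (h : AgreeBefore t ω ω') (hst : s ≤ t) :
    AgreeBefore s ω ω' :=
  fun r hr => h r (hr.trans_le hst)

lemma agreeBefore_update {s t : ℕ} (hst : s ≤ t) (ω : ℕ → α) (x : α) :
    AgreeBefore s ω (Function.update ω t x) := fun r hr => by
  rw [Function.update_of_ne (by omega)]

open scoped Classical in
/-- The number of sampled rounds before `t`. -/
noncomputable def sampleCount (I : ℕ → (ℕ → α) → Prop) (t : ℕ) (ω : ℕ → α) : ℕ :=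
  ((Finset.range t).filter fun s => I s ω).card

lemma sampleCount_succ_of_mem {I : ℕ → (ℕ → α) → Prop} {t : ℕ} {ω : ℕ → α} (h : I t ω) :
    sampleCount I (t + 1) ω = sampleCount I t ω + 1 := by
  classical
  simp [sampleCount, Finset.range_add_one, Finset.filter_insert, h]

lemma sampleCount_succ_of_notMem {I : ℕ → (ℕ → α) → Prop} {t : ℕ} {ω : ℕ → α} (h : ¬ I t ω) :
    sampleCount I (t + 1) ω = sampleCount I t ω := by
  classical
  simp [sampleCount, Finset.range_add_one, Finset.filter_insert, h]

lemma sampleCount_mono {I : ℕ → (ℕ → α) → Prop} (ω : ℕ → α) :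
    Monotone fun t => sampleCount I t ω := by
  classical
  intro s t hst
  exact Finset.card_le_card (Finset.filter_subset_filter _ (Finset.range_mono hst))

variable [MeasurableSpace α] (ν : Measure α) [IsProbabilityMeasure ν]

lemma measurable_update_pair (t : ℕ) :
    Measurable (fun z : (ℕ → α) × α => Function.update z.1 t z.2) := by
  refine measurable_pi_lambda _ fun s => ?_
  by_cases h : s = t
  · subst h; simpa using measurable_snd
  · simp only [Function.update_of_ne h]
    exact (measurable_pi_apply s).comp measurable_fst

/-- Resampling one coordinate does not change the law of an i.i.d. sequence. -/
lemma map_update_infinitePi (t : ℕ) :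
    Measure.map (fun z : (ℕ → α) × α => Function.update z.1 t z.2)
      ((Measure.infinitePi fun _ : ℕ => ν).prod ν) = Measure.infinitePi fun _ : ℕ => ν := by
  refine Measure.eq_infinitePi _ fun s B hB => ?_
  rw [Measure.map_apply (measurable_update_pair t)
    (MeasurableSet.pi s.countable_toSet fun i _ => hB i)]
  have hset : (fun z : (ℕ → α) × α => Function.update z.1 t z.2) ⁻¹' (Set.pi s B)
      = (Set.pi (s.erase t : Finset ℕ) B) ×ˢ (if t ∈ s then B t else Set.univ) := by
    ext ⟨ω, x⟩
    simp only [Set.mem_preimage, Set.mem_pi, Finset.mem_coe, Set.mem_prod, Finset.mem_erase]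
    constructor
    · intro h
      refine ⟨fun i hi => by simpa [Function.update_of_ne hi.1] using h i hi.2, ?_⟩
      split_ifs with ht
      · simpa using h t ht
      · trivial
    · rintro ⟨h1, h2⟩ i hi
      by_cases hit : i = t
      · subst hit; simpa [hi] using h2
      · simpa [Function.update_of_ne hit] using h1 i ⟨hit, hi⟩
  rw [hset, Measure.prod_prod, Measure.infinitePi_pi _ (fun i _ => hB i)]
  by_cases ht : t ∈ s
  · simp only [ht, if_true]
    exact Finset.prod_erase_mul s (fun i => ν (B i)) ht
  · simp [ht]

/-- Conditioning on all coordinates but the `t`-th, without conditional expectations. -/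
lemma lintegral_infinitePi_eq_lintegral_update {G : (ℕ → α) → ENNReal} (hG : Measurable G)
    (t : ℕ) :
    ∫⁻ ω, G ω ∂(Measure.infinitePi fun _ : ℕ => ν)
      = ∫⁻ ω, ∫⁻ x, G (Function.update ω t x) ∂ν ∂(Measure.infinitePi fun _ : ℕ => ν) := by
  conv_lhs => rw [← map_update_infinitePi ν t]
  rw [lintegral_map hG (measurable_update_pair t),
    lintegral_prod (fun z : (ℕ → α) × α => G (Function.update z.1 t z.2))
      (hG.comp (measurable_update_pair t)).aemeasurable]

/-- The supermartingale bound: if the conditional exponential moment of every increment, given the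
earlier rounds, is at most one, then so is that of the sum. -/
lemma lintegral_exp_sum_le_one {E : ℕ → (ℕ → α) → ℝ} (hm : ∀ t, Measurable (E t))
    (hpred : ∀ s t, s < t → ∀ ω x, E s (Function.update ω t x) = E s ω)
    (hE : ∀ t ω, ∫⁻ x, ENNReal.ofReal (Real.exp (E t (Function.update ω t x))) ∂ν ≤ 1) (N : ℕ) :
    ∫⁻ ω, ENNReal.ofReal (Real.exp (∑ t ∈ Finset.range N, E t ω))
      ∂(Measure.infinitePi fun _ : ℕ => ν) ≤ 1 := by
  induction N with
  | zero => simp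
  | succ N ih =>
    refine le_trans ?_ ih
    have hmeas : ∀ M, Measurable fun ω : ℕ → α =>
        ENNReal.ofReal (Real.exp (∑ t ∈ Finset.range M, E t ω)) := fun M =>
      (Real.measurable_exp.comp (Finset.measurable_sum _ fun t _ => hm t)).ennreal_ofReal
    rw [lintegral_infinitePi_eq_lintegral_update ν (hmeas (N + 1)) N]
    refine lintegral_mono fun ω => ?_
    have hs : ∀ x, ENNReal.ofReal (Real.exp (∑ t ∈ Finset.range (N + 1),
        E t (Function.update ω N x)))
        = ENNReal.ofReal (Real.exp (∑ t ∈ Finset.range N, E t ω))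
          * ENNReal.ofReal (Real.exp (E N (Function.update ω N x))) := by
      intro x
      rw [Finset.sum_range_succ, Real.exp_add, ENNReal.ofReal_mul (Real.exp_pos _).le]
      congr 3
      exact Finset.sum_congr rfl fun t ht => hpred t N (Finset.mem_range.1 ht) ω x
    simp only [hs]
    rw [lintegral_const_mul]
    · calc _ ≤ ENNReal.ofReal (Real.exp (∑ t ∈ Finset.range N, E t ω)) * 1 := by
            gcongr; exact hE N ω
        _ = _ := mul_one _
    · have h1 : Measurable fun x : α => Function.update ω N x :=
        (measurable_update_pair N).comp (measurable_const.prodMk measurable_id)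
      exact (Real.measurable_exp.comp ((hm N).comp h1)).ennreal_ofReal

open scoped Classical in
/-- A predictable sampling scheme: whether round `t` is sampled (`I t`) and which function of the
round is recorded (`X t ω`) are determined by the rounds before `t`, and a recorded function takes
values in an interval of length `R`. -/
structure Sampling (I : ℕ → (ℕ → α) → Prop) (X : ℕ → (ℕ → α) → α → ℝ) (R : ℝ) : Prop where
  measurableSet : ∀ t, MeasurableSet {ω | I t ω}
  measurable : ∀ t, Measurable fun z : (ℕ → α) × α => X t z.1 z.2
  predictable : ∀ t ω ω', AgreeBefore t ω ω' → I t ω → I t ω' ∧ X t ω' = X t ω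
  range : ∀ t ω, I t ω → ∃ lo, ∀ᵐ x ∂ν, X t ω x ∈ Set.Icc lo (lo + R)

open scoped Classical in
/-- The centred record of round `t` (zero if the round is not sampled). -/
noncomputable def centred (I : ℕ → (ℕ → α) → Prop) (X : ℕ → (ℕ → α) → α → ℝ) (t : ℕ)
    (ω : ℕ → α) : ℝ :=
  if I t ω then X t ω (ω t) - ∫ x, X t ω x ∂ν else 0

variable {ν} {I : ℕ → (ℕ → α) → Prop} {X : ℕ → (ℕ → α) → α → ℝ} {R : ℝ}

lemma Sampling.measurable_centred (h : Sampling ν I X R) (t : ℕ) :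
    Measurable (centred ν I X t) := by
  unfold centred
  refine Measurable.ite (h.measurableSet t) (Measurable.sub ?_ ?_) measurable_const
  · exact (h.measurable t).comp (measurable_id.prodMk (measurable_pi_apply t))
  · exact (StronglyMeasurable.integral_prod_right (ν := ν)
      (f := fun ω x => X t ω x) (h.measurable t).stronglyMeasurable).measurable

lemma Sampling.predictable_iff (h : Sampling ν I X R) {t : ℕ} {ω ω' : ℕ → α}
    (ha : AgreeBefore t ω ω') : I t ω ↔ I t ω' :=
  ⟨fun hi => (h.predictable t ω ω' ha hi).1, fun hi => (h.predictable t ω' ω ha.symm hi).1⟩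

lemma Sampling.centred_congr (h : Sampling ν I X R) {t : ℕ} {ω ω' : ℕ → α}
    (ha : AgreeBefore (t + 1) ω ω') : centred ν I X t ω' = centred ν I X t ω := by
  have ha' : AgreeBefore t ω ω' := ha.mono (Nat.le_succ t)
  unfold centred
  by_cases hi : I t ω
  · have h2 := h.predictable t ω ω' ha' hi
    rw [if_pos hi, if_pos h2.1, h2.2, ha t (Nat.lt_succ_self t)]
  · rw [if_neg hi, if_neg (fun hi' => hi ((h.predictable_iff ha').2 hi'))]

lemma Sampling.neg (h : Sampling ν I X R) : Sampling ν I (fun t ω x => -X t ω x) R where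
  measurableSet := h.measurableSet
  measurable t := (h.measurable t).neg
  predictable t ω ω' ha hi := by
    obtain ⟨h1, h2⟩ := h.predictable t ω ω' ha hi
    exact ⟨h1, by simp [h2]⟩
  range t ω hi := by
    obtain ⟨lo, hlo⟩ := h.range t ω hi
    refine ⟨-(lo + R), ?_⟩
    filter_upwards [hlo] with x hx
    constructor <;> linarith [hx.1, hx.2]

lemma centred_neg (t : ℕ) (ω : ℕ → α) :
    centred ν I (fun t ω x => -X t ω x) t ω = -centred ν I X t ω := by
  unfold centred
  split_ifs
  · rw [integral_neg]; ring
  · simp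

open scoped Classical in
/-- Hoeffding's inequality for predictably sampled rounds, of which there are at most `m`. -/
lemma Sampling.hoeffding (h : Sampling ν I X R) (hR : 0 < R) {N m : ℕ} (hm : 0 < m)
    (hcard : ∀ ω, ((Finset.range N).filter fun t => I t ω).card ≤ m) {ε : ℝ} (hε : 0 ≤ ε) :
    (Measure.infinitePi fun _ : ℕ => ν).real
      {ω | ε ≤ ∑ t ∈ Finset.range N, centred ν I X t ω} ≤ Real.exp (-2 * ε ^ 2 / (m * R ^ 2)) := by
  have hm' : (0 : ℝ) < m := by exact_mod_cast hm
  -- `l` maximises the Chernoff exponent `l * ε - m * l ^ 2 * R ^ 2 / 8`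
  set l : ℝ := 4 * ε / (m * R ^ 2) with hl
  set E : ℕ → (ℕ → α) → ℝ := fun t ω =>
    l * centred ν I X t ω - (if I t ω then l ^ 2 * R ^ 2 / 8 else 0) with hEdef
  have hEm : ∀ t, Measurable (E t) := fun t =>
    ((h.measurable_centred t).const_mul l).sub
      (Measurable.ite (h.measurableSet t) measurable_const measurable_const)
  have hpred : ∀ s t, s < t → ∀ ω x, E s (Function.update ω t x) = E s ω := by
    intro s t hst ω x
    have ha := agreeBefore_update (Nat.succ_le_of_lt hst) ω x
    have h1 := h.predictable_iff (ha.mono (Nat.le_succ s))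
    simp only [hEdef, h.centred_congr ha]
    by_cases hi : I s ω
    · rw [if_pos hi, if_pos (h1.1 hi)]
    · rw [if_neg hi, if_neg (fun h' => hi (h1.2 h'))]
  have hE : ∀ t ω, ∫⁻ x, ENNReal.ofReal (Real.exp (E t (Function.update ω t x))) ∂ν ≤ 1 := by
    intro t ω
    have ha : ∀ x, AgreeBefore t ω (Function.update ω t x) := agreeBefore_update le_rfl ω
    by_cases hi : I t ω
    · obtain ⟨lo, hlo⟩ := h.range t ω hi
      have hXm : Measurable (X t ω) := (h.measurable t).comp (measurable_const.prodMk measurable_id)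
      -- given the past, the record has a fixed range, so Hoeffding's lemma applies to `ν`
      have hsub := ProbabilityTheory.hasSubgaussianMGF_of_mem_Icc hXm.aemeasurable hlo
      have hmgf := hsub.mgf_le l
      have hint := hsub.integrable_exp_mul l
      have hrw : ∀ x, Real.exp (E t (Function.update ω t x))
          = Real.exp (l * (X t ω x - ∫ y, X t ω y ∂ν)) * Real.exp (-(l ^ 2 * R ^ 2 / 8)) := by
        intro x
        obtain ⟨h1, h2⟩ := h.predictable t ω _ (ha x) hi
        simp only [hEdef, centred, if_pos h1, h2, Function.update_self]
        rw [← Real.exp_add, sub_eq_add_neg]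
      simp only [hrw]
      rw [← ofReal_integral_eq_lintegral_ofReal (hint.mul_const _)
        (Filter.Eventually.of_forall fun x => by positivity), integral_mul_const]
      rw [ENNReal.ofReal_le_one]
      unfold ProbabilityTheory.mgf at hmgf
      calc _ ≤ Real.exp (l ^ 2 * R ^ 2 / 8) * Real.exp (-(l ^ 2 * R ^ 2 / 8)) := by
            gcongr
            refine hmgf.trans (le_of_eq ?_)
            congr 1
            simp only [add_sub_cancel_left, NNReal.coe_pow, NNReal.coe_div, coe_nnnorm,
              Real.norm_eq_abs, abs_of_pos hR, NNReal.coe_ofNat]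
            ring
        _ = 1 := by rw [← Real.exp_add]; simp
    · have hrw : ∀ x, E t (Function.update ω t x) = 0 := by
        intro x
        have h1 : ¬ I t (Function.update ω t x) := fun h' => hi ((h.predictable_iff (ha x)).2 h')
        simp [hEdef, centred, if_neg h1]
      simp [hrw]
  have hmain := lintegral_exp_sum_le_one ν hEm hpred hE N
  set μ := Measure.infinitePi fun _ : ℕ => ν
  have hsub : {ω | ε ≤ ∑ t ∈ Finset.range N, centred ν I X t ω} ⊆
      {ω | ENNReal.ofReal (Real.exp (2 * ε ^ 2 / (m * R ^ 2)))
        ≤ ENNReal.ofReal (Real.exp (∑ t ∈ Finset.range N, E t ω))} := by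
    intro ω hω
    simp only [Set.mem_ofPred_eq] at hω ⊢
    refine ENNReal.ofReal_le_ofReal (Real.exp_le_exp.2 ?_)
    have hsum : ∑ t ∈ Finset.range N, E t ω
        = l * ∑ t ∈ Finset.range N, centred ν I X t ω
          - ((Finset.range N).filter fun t => I t ω).card * (l ^ 2 * R ^ 2 / 8) := by
      simp only [hEdef, Finset.sum_sub_distrib, Finset.mul_sum]
      rw [← Finset.sum_filter, Finset.sum_const, nsmul_eq_mul]
    rw [hsum]
    have hl0 : 0 ≤ l := by positivity
    have hc : (((Finset.range N).filter fun t => I t ω).card : ℝ) ≤ m := by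
      exact_mod_cast hcard ω
    calc 2 * ε ^ 2 / (m * R ^ 2) = l * ε - m * (l ^ 2 * R ^ 2 / 8) := by
          rw [hl]; field_simp; ring
      _ ≤ _ := by gcongr
  have hmark := meas_ge_le_lintegral_div (μ := μ)
    (f := fun ω => ENNReal.ofReal (Real.exp (∑ t ∈ Finset.range N, E t ω)))
    ((Real.measurable_exp.comp
      (Finset.measurable_sum _ fun t _ => hEm t)).ennreal_ofReal.aemeasurable)
    (ε := ENNReal.ofReal (Real.exp (2 * ε ^ 2 / (m * R ^ 2))))
    (by simp [Real.exp_pos]) ENNReal.ofReal_ne_top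
  have hle : μ {ω | ε ≤ ∑ t ∈ Finset.range N, centred ν I X t ω}
      ≤ ENNReal.ofReal (Real.exp (-2 * ε ^ 2 / (m * R ^ 2))) := by
    refine (measure_mono hsub).trans (hmark.trans ?_)
    calc _ ≤ 1 / ENNReal.ofReal (Real.exp (2 * ε ^ 2 / (m * R ^ 2))) := by gcongr
      _ = _ := by
        rw [one_div, ← ENNReal.ofReal_inv_of_pos (Real.exp_pos _), ← Real.exp_neg]
        congr 2; ring
  exact ENNReal.toReal_le_of_le_ofReal (Real.exp_pos _).le hle

/-- Restricting a sampling scheme to its first `m` samples. -/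
lemma Sampling.firstSamples (h : Sampling ν I X R) (m : ℕ) :
    Sampling ν (fun t ω => I t ω ∧ sampleCount I t ω < m) X R where
  measurableSet t := by
    classical
    have : Measurable fun ω : ℕ → α => sampleCount I t ω := by
      have : (fun ω : ℕ → α => sampleCount I t ω)
          = fun ω => ∑ s ∈ Finset.range t, if I s ω then 1 else 0 := by
        funext ω; exact Finset.card_filter _ _
      rw [this]
      exact Finset.measurable_sum _ fun s _ =>
        Measurable.ite (h.measurableSet s) measurable_const measurable_const
    exact (h.measurableSet t).inter (measurableSet_lt this measurable_const)
  measurable := h.measurable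
  predictable t ω ω' ha hi := by
    classical
    obtain ⟨h1, h2⟩ := h.predictable t ω ω' ha hi.1
    refine ⟨⟨h1, ?_⟩, h2⟩
    have : sampleCount I t ω' = sampleCount I t ω := by
      unfold sampleCount
      congr 1
      refine Finset.filter_congr fun s hs => ?_
      exact (h.predictable_iff (ha.mono (Finset.mem_range.1 hs).le)).symm
    rw [this]; exact hi.2
  range t ω hi := h.range t ω hi.1

/-- Confidence bounds valid at all times: with `v = R² ln(1/η) / 2` the failure probability is
`N η`, by a union bound over the possible numbers of samples. -/
lemma Sampling.uniform_deviation (h : Sampling ν I X R) (hR : 0 < R) (N : ℕ) {v : ℝ}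
    (hv : 0 ≤ v) :
    (Measure.infinitePi fun _ : ℕ => ν).real
      {ω | ∃ t ≤ N, 0 < sampleCount I t ω ∧
        √(sampleCount I t ω * v) ≤ ∑ s ∈ Finset.range t, centred ν I X s ω}
      ≤ N * Real.exp (-2 * v / R ^ 2) := by
  classical
  set μ := Measure.infinitePi fun _ : ℕ => ν
  -- at a time with `m` samples, the sum is that of the scheme stopped after `m` samples
  let J : ℕ → ℕ → (ℕ → α) → Prop := fun m t ω => I t ω ∧ sampleCount I t ω < m
  have hcard : ∀ m N ω, ((Finset.range N).filter fun t => J m t ω).card ≤ m := by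
    intro m N ω
    induction N with
    | zero => simp
    | succ N ih =>
      by_cases hJ : J m N ω
      · have hle : ((Finset.range N).filter fun t => J m t ω).card ≤ sampleCount I N ω :=
          Finset.card_le_card (fun t ht => by
            simp only [Finset.mem_filter] at ht ⊢
            exact ⟨ht.1, ht.2.1⟩)
        have := hJ.2
        simp only [Finset.range_add_one, Finset.filter_insert, hJ, if_true]
        rw [Finset.card_insert_of_notMem (by simp)]
        omega
      · simpa [Finset.range_add_one, Finset.filter_insert, hJ] using ih
  have hsub : {ω | ∃ t ≤ N, 0 < sampleCount I t ω ∧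
        √(sampleCount I t ω * v) ≤ ∑ s ∈ Finset.range t, centred ν I X s ω}
      ⊆ ⋃ m ∈ Finset.Icc 1 N,
        {ω | √(m * v) ≤ ∑ s ∈ Finset.range N, centred ν (J m) X s ω} := by
    rintro ω ⟨t, htN, hpos, hdev⟩
    have hcN : sampleCount I t ω ≤ N := by
      refine le_trans ?_ htN
      unfold sampleCount
      exact (Finset.card_filter_le _ _).trans (by simp)
    simp only [Set.mem_iUnion]
    refine ⟨sampleCount I t ω, Finset.mem_Icc.2 ⟨hpos, hcN⟩, ?_⟩
    simp only [Set.mem_ofPred_eq]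
    refine hdev.trans (le_of_eq ?_)
    set m := sampleCount I t ω with hmdef
    rw [← Finset.sum_subset (Finset.range_mono htN)]
    · refine Finset.sum_congr rfl fun s hs => ?_
      unfold centred
      by_cases hI : I s ω
      · have : J m s ω := ⟨hI, by
          have h1 := sampleCount_succ_of_mem hI
          have h2 : sampleCount I (s + 1) ω ≤ sampleCount I t ω :=
            sampleCount_mono ω (Finset.mem_range.1 hs)
          omega⟩
        rw [if_pos hI, if_pos this]
      · rw [if_neg hI, if_neg (fun h' => hI h'.1)]
    · intro s _ hs
      have hts : t ≤ s := by simpa using hs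
      unfold centred
      rw [if_neg]
      rintro ⟨_, hlt⟩
      have h2 : sampleCount I t ω ≤ sampleCount I s ω := sampleCount_mono ω hts
      omega
  calc μ.real _ ≤ μ.real (⋃ m ∈ Finset.Icc 1 N,
        {ω | √(m * v) ≤ ∑ s ∈ Finset.range N, centred ν (J m) X s ω}) :=
        measureReal_mono hsub (measure_ne_top _ _)
    _ ≤ ∑ m ∈ Finset.Icc 1 N,
        μ.real {ω | √(m * v) ≤ ∑ s ∈ Finset.range N, centred ν (J m) X s ω} :=
        measureReal_biUnion_finset_le _ _
    _ ≤ ∑ m ∈ Finset.Icc 1 N, Real.exp (-2 * v / R ^ 2) := by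
        refine Finset.sum_le_sum fun m hm => ?_
        have hm1 : 0 < m := (Finset.mem_Icc.1 hm).1
        have hm' : (0 : ℝ) < m := by exact_mod_cast hm1
        refine ((h.firstSamples m).hoeffding hR hm1
          (fun ω => by convert hcard m N ω) (Real.sqrt_nonneg _)).trans
          (le_of_eq ?_)
        congr 1
        rw [Real.sq_sqrt (by positivity)]
        field_simp
    _ = N * Real.exp (-2 * v / R ^ 2) := by simp

end Concentration

/-! ### The market: pointwise and expected gain from trade and revenue -/

section Market

set_option linter.unusedSectionVars false

variable {n : ℕ}

/-- All valuations of the profile lie in `[0,1]`. -/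
def Valid (v : Val n) : Prop :=
  (∀ i, v.1 i ∈ Set.Icc (0 : ℝ) 1) ∧ v.2 ∈ Set.Icc (0 : ℝ) 1

lemma Valid.topBid_le {v : Val n} (h : Valid v) : topBid v ≤ 1 :=
  Real.iSup_le (fun i => (h.1 i).2) zero_le_one

lemma Valid.secondBid_nonneg {v : Val n} (h : Valid v) : 0 ≤ secondBid v :=
  Real.iSup_nonneg fun _ => le_min (h.1 _).1 (h.1 _).1

lemma Valid.topBid_nonneg {v : Val n} (h : Valid v) : 0 ≤ topBid v :=
  Real.iSup_nonneg fun i => (h.1 i).1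

lemma Valid.secondBid_le {v : Val n} (h : Valid v) : secondBid v ≤ topBid v :=
  Real.iSup_le (fun ij => (min_le_left _ _).trans
    (le_ciSup (f := v.1) (Set.finite_range _).bddAbove ij.1.1)) h.topBid_nonneg

lemma measurable_topBid : Measurable (topBid : Val n → ℝ) :=
  Measurable.iSup fun i => (measurable_pi_apply i).comp measurable_fst

lemma measurable_secondBid : Measurable (secondBid : Val n → ℝ) :=
  Measurable.iSup fun ij => ((measurable_pi_apply ij.1.1).comp measurable_fst).min
    ((measurable_pi_apply ij.1.2).comp measurable_fst)

section
variable {Ω : Type*} [MeasurableSpace Ω] {p q : Ω → ℝ} {v : Ω → Val n}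

lemma measurableSet_trade (hp : Measurable p) (hq : Measurable q) (hv : Measurable v) :
    MeasurableSet {ω | (v ω).2 ≤ p ω ∧ q ω ≤ topBid (v ω)} :=
  (measurableSet_le (measurable_snd.comp hv) hp).inter
    (measurableSet_le hq (measurable_topBid.comp hv))

lemma measurable_gft (hp : Measurable p) (hq : Measurable q) (hv : Measurable v) :
    Measurable fun ω => gft (p ω) (q ω) (v ω) :=
  Measurable.ite (measurableSet_trade hp hq hv)
    ((measurable_topBid.comp hv).sub (measurable_snd.comp hv)) measurable_const

lemma measurable_rev (hp : Measurable p) (hq : Measurable q) (hv : Measurable v) :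
    Measurable fun ω => rev (p ω) (q ω) (v ω) :=
  Measurable.ite (measurableSet_trade hp hq hv)
    ((hq.max (measurable_secondBid.comp hv)).sub hp) measurable_const

/-- The part `(b̄ - p) 𝟙(b̄ ≥ q) 𝟙(s ≤ p)` of the gain from trade that every round of the
elimination phase reveals. -/
noncomputable def gft2 (p q : ℝ) (v : Val n) : ℝ :=
  if q ≤ topBid v ∧ v.2 ≤ p then topBid v - p else 0

lemma measurable_gft2 (hp : Measurable p) (hq : Measurable q) (hv : Measurable v) :
    Measurable fun ω => gft2 (p ω) (q ω) (v ω) :=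
  Measurable.ite ((measurableSet_le hq (measurable_topBid.comp hv)).inter
    (measurableSet_le (measurable_snd.comp hv) hp)) ((measurable_topBid.comp hv).sub hp)
    measurable_const

end

lemma Valid.gft_mem {v : Val n} (h : Valid v) (p q : ℝ) : gft p q v ∈ Set.Icc (-1 : ℝ) 1 := by
  have h1 := h.topBid_le; have h2 := h.topBid_nonneg; have h3 := h.2.1; have h4 := h.2.2
  unfold gft
  split_ifs <;> constructor <;> linarith

lemma Valid.rev_mem {v : Val n} (h : Valid v) {p : ℝ} (hp : p ∈ Set.Icc (0 : ℝ) 1) (q : ℝ) :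
    rev p q v ∈ Set.Icc (-1 : ℝ) 1 := by
  have h1 := h.topBid_le; have h2 := h.secondBid_nonneg; have h3 := h.secondBid_le
  unfold rev
  split_ifs with hc
  · have h5 : secondBid v ≤ max q (secondBid v) := le_max_right _ _
    have h6 : max q (secondBid v) ≤ 1 := max_le (hc.2.trans h1) (h3.trans h1)
    constructor <;> linarith [hp.1, hp.2]
  · constructor <;> norm_num

lemma Valid.gft2_mem {v : Val n} (h : Valid v) {p : ℝ} (hp : p ∈ Set.Icc (0 : ℝ) 1) (q : ℝ) :
    gft2 p q v ∈ Set.Icc (-p) (1 - p) := by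
  have h1 := h.topBid_le; have h2 := h.topBid_nonneg
  unfold gft2
  split_ifs <;> constructor <;> linarith [hp.1, hp.2]

variable {P : Measure (Val n)} [IsProbabilityMeasure P]

lemma UnitSupported.valid (hP : UnitSupported P) : ∀ᵐ v ∂P, Valid v := hP

lemma UnitSupported.integrable_gft (hP : UnitSupported P) (p q : ℝ) : Integrable (gft p q) P := by
  refine Integrable.of_mem_Icc (-1) 1
    (measurable_gft measurable_const measurable_const measurable_id).aemeasurable ?_
  filter_upwards [hP.valid] with v hv using hv.gft_mem p q

lemma UnitSupported.integrable_rev (hP : UnitSupported P) {p : ℝ} (hp : p ∈ Set.Icc (0 : ℝ) 1)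
    (q : ℝ) : Integrable (rev p q) P := by
  refine Integrable.of_mem_Icc (-1) 1
    (measurable_rev measurable_const measurable_const measurable_id).aemeasurable ?_
  filter_upwards [hP.valid] with v hv using hv.rev_mem hp q

lemma UnitSupported.integrable_gft2 (hP : UnitSupported P) {p : ℝ} (hp : p ∈ Set.Icc (0 : ℝ) 1)
    (q : ℝ) : Integrable (gft2 p q) P := by
  refine Integrable.of_mem_Icc (-p) (1 - p)
    (measurable_gft2 measurable_const measurable_const measurable_id).aemeasurable ?_
  filter_upwards [hP.valid] with v hv using hv.gft2_mem hp q

lemma UnitSupported.expGFT_mem (hP : UnitSupported P) (p q : ℝ) :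
    expGFT P p q ∈ Set.Icc (-1 : ℝ) 1 := by
  constructor
  · have := integral_mono_ae (integrable_const (-1 : ℝ)) (hP.integrable_gft p q)
      (by filter_upwards [hP.valid] with v hv using (hv.gft_mem p q).1)
    simpa [expGFT] using this
  · have := integral_mono_ae (hP.integrable_gft p q) (integrable_const (1 : ℝ))
      (by filter_upwards [hP.valid] with v hv using (hv.gft_mem p q).2)
    simpa [expGFT] using this

lemma UnitSupported.expRev_mem (hP : UnitSupported P) {p : ℝ} (hp : p ∈ Set.Icc (0 : ℝ) 1)
    (q : ℝ) : expRev P p q ∈ Set.Icc (-1 : ℝ) 1 := by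
  constructor
  · have := integral_mono_ae (integrable_const (-1 : ℝ)) (hP.integrable_rev hp q)
      (by filter_upwards [hP.valid] with v hv using (hv.rev_mem hp q).1)
    simpa [expRev] using this
  · have := integral_mono_ae (hP.integrable_rev hp q) (integrable_const (1 : ℝ))
      (by filter_upwards [hP.valid] with v hv using (hv.rev_mem hp q).2)
    simpa [expRev] using this

/-! ### The baseline -/

lemma UnitSupported.bddAbove_feasible (hP : UnitSupported P) :
    BddAbove {g | ∃ p ∈ Set.Icc (0 : ℝ) 1, ∃ q ∈ Set.Icc (0 : ℝ) 1,
      0 ≤ expRev P p q ∧ g = expGFT P p q} :=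
  ⟨1, by rintro g ⟨p, _, q, _, _, rfl⟩; exact (hP.expGFT_mem p q).2⟩

lemma UnitSupported.expRev_zero_nonneg (hP : UnitSupported P) (q : ℝ) : 0 ≤ expRev P 0 q := by
  refine integral_nonneg_of_ae ?_
  filter_upwards [hP.valid] with v hv
  have := hv.secondBid_nonneg
  simp only [Pi.zero_apply, rev]
  split_ifs
  · linarith [le_max_right q (secondBid v)]
  · exact le_rfl

lemma UnitSupported.expGFT_zero_nonneg (hP : UnitSupported P) (q : ℝ) : 0 ≤ expGFT P 0 q := by
  refine integral_nonneg_of_ae ?_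
  filter_upwards [hP.valid] with v hv
  have := hv.topBid_nonneg
  simp only [Pi.zero_apply, gft]
  split_ifs with h
  · linarith [h.1]
  · exact le_rfl

lemma UnitSupported.feasible_nonempty (hP : UnitSupported P) :
    {g | ∃ p ∈ Set.Icc (0 : ℝ) 1, ∃ q ∈ Set.Icc (0 : ℝ) 1,
      0 ≤ expRev P p q ∧ g = expGFT P p q}.Nonempty :=
  ⟨_, 0, by simp, 0, by simp, hP.expRev_zero_nonneg 0, rfl⟩

lemma UnitSupported.opt_le_one (hP : UnitSupported P) : opt P ≤ 1 :=
  csSup_le hP.feasible_nonempty (by rintro g ⟨p, _, q, _, _, rfl⟩; exact (hP.expGFT_mem p q).2)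

lemma UnitSupported.opt_nonneg (hP : UnitSupported P) : 0 ≤ opt P :=
  (hP.expGFT_zero_nonneg 0).trans (le_csSup hP.bddAbove_feasible
    ⟨0, by simp, 0, by simp, hP.expRev_zero_nonneg 0, rfl⟩)

/-! ### Revenue of the mechanisms `F_K` against the baseline -/

/-- A number of `[0,1]` is at most the sum of the dyadic thresholds below it, plus the
resolution. -/
lemma le_sum_dyadic {x : ℝ} (hx : x ≤ 1) (J : ℕ) :
    x ≤ ∑ j ∈ Finset.Icc 1 J, (if (2⁻¹ : ℝ) ^ j ≤ x then (2⁻¹ : ℝ) ^ j else 0) + 2⁻¹ ^ J := by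
  induction J with
  | zero => simpa using hx
  | succ J ih =>
    rw [Finset.sum_Icc_succ_top (by omega)]
    have h2 : (2⁻¹ : ℝ) ^ J = 2⁻¹ ^ (J + 1) + 2⁻¹ ^ (J + 1) := by rw [pow_succ]; ring
    have hnn : 0 ≤ ∑ j ∈ Finset.Icc 1 J, (if (2⁻¹ : ℝ) ^ j ≤ x then (2⁻¹ : ℝ) ^ j else 0) :=
      Finset.sum_nonneg fun j _ => by split_ifs <;> positivity
    split_ifs with h
    · linarith
    · linarith

lemma rev_add_nonneg {v : Val n} {p d : ℝ} (hd : 0 ≤ d) : 0 ≤ rev p (p + d) v := by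
  unfold rev
  split_ifs
  · linarith [le_max_left (p + d) (secondBid v)]
  · exact le_rfl

/-- A mechanism of `F_K⁻` earns exactly its margin `d` on every trade. -/
lemma rev_max_sub (v : Val n) (q d : ℝ) :
    rev (max q (secondBid v) - d) q v
      = if v.2 ≤ max q (secondBid v) - d ∧ q ≤ topBid v then d else 0 := by
  unfold rev
  split_ifs <;> ring

/-- Pointwise form of the comparison between the gain from trade and the revenue of the
mechanisms `F_K`: `gft + rev = (b̄ - p) + (max q b̲ - s)` on a trade, and both summands are
extracted by dyadic mechanisms at neighbouring grid prices. -/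
lemma Valid.gft_add_rev_le {v : Val n} (hv : Valid v) {p q p' q' κ : ℝ} (hp0 : 0 ≤ p')
    (hq1 : q' ≤ q) (hp : p ≤ p') (hp' : p' ≤ p + κ) (hq' : q ≤ q' + κ) (J : ℕ) :
    gft p q v + rev p q v ≤ ∑ j ∈ Finset.Icc 1 J,
      (rev p' (p' + 2⁻¹ ^ j) v + rev (max q' (secondBid v) - 2⁻¹ ^ j) q' v)
        + 2 * (2⁻¹ ^ J + κ) := by
  have hκ : 0 ≤ κ := by linarith
  have hJ : (0 : ℝ) < 2⁻¹ ^ J := by positivity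
  have hnn : ∀ j : ℕ, 0 ≤ rev p' (p' + 2⁻¹ ^ j) v := fun j => rev_add_nonneg (by positivity)
  have hnn' : ∀ j : ℕ, 0 ≤ rev (max q' (secondBid v) - 2⁻¹ ^ j) q' v := fun j => by
    rw [rev_max_sub]; split_ifs <;> positivity
  by_cases hc : v.2 ≤ p ∧ q ≤ topBid v
  · have h1 := hv.topBid_le
    have h2 := hv.secondBid_le
    have hA : topBid v - p' ≤ ∑ j ∈ Finset.Icc 1 J, rev p' (p' + 2⁻¹ ^ j) v + 2⁻¹ ^ J := by
      refine (le_sum_dyadic (by linarith) J).trans ?_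
      gcongr with j hj
      split_ifs with hx
      · unfold rev
        rw [if_pos ⟨hc.1.trans hp, by linarith⟩]
        linarith [le_max_left (p' + 2⁻¹ ^ j) (secondBid v)]
      · exact hnn j
    have hB : max q' (secondBid v) - v.2 ≤
        ∑ j ∈ Finset.Icc 1 J, rev (max q' (secondBid v) - 2⁻¹ ^ j) q' v + 2⁻¹ ^ J := by
      have : max q' (secondBid v) ≤ 1 :=
        max_le (hq1.trans (hc.2.trans h1)) (h2.trans h1)
      refine (le_sum_dyadic (by linarith [hv.2.1]) J).trans ?_
      gcongr with j hj
      split_ifs with hx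
      · rw [rev_max_sub, if_pos ⟨by linarith, hq1.trans hc.2⟩]
      · exact hnn' j
    have hm : max q (secondBid v) ≤ max q' (secondBid v) + κ :=
      max_le (hq'.trans (by gcongr; exact le_max_left _ _))
        ((le_max_right q' _).trans (by linarith))
    have e1 : gft p q v = topBid v - v.2 := if_pos hc
    have e2 : rev p q v = max q (secondBid v) - p := if_pos hc
    rw [e1, e2, Finset.sum_add_distrib]
    linarith
  · have e1 : gft p q v = 0 := if_neg hc
    have e2 : rev p q v = 0 := if_neg hc
    rw [e1, e2]
    have := Finset.sum_nonneg fun j (_ : j ∈ Finset.Icc 1 J) => add_nonneg (hnn j) (hnn' j)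
    linarith

lemma Valid.rev_add_mem {v : Val n} (hv : Valid v) {p d : ℝ} (hp : 0 ≤ p) (hd : 0 ≤ d) :
    rev p (p + d) v ∈ Set.Icc (0 : ℝ) 1 := by
  refine ⟨rev_add_nonneg hd, ?_⟩
  unfold rev
  split_ifs with h
  · have := max_le (h.2.trans hv.topBid_le) (hv.secondBid_le.trans hv.topBid_le)
    linarith
  · exact zero_le_one

lemma rev_max_sub_mem {v : Val n} (q : ℝ) {d : ℝ} (hd : 0 ≤ d) (hd1 : d ≤ 1) :
    rev (max q (secondBid v) - d) q v ∈ Set.Icc (0 : ℝ) 1 := by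
  rw [rev_max_sub]; split_ifs
  · exact ⟨hd, hd1⟩
  · simp

lemma inv_two_pow_mem (j : ℕ) : (2⁻¹ : ℝ) ^ j ∈ Set.Icc (0 : ℝ) 1 :=
  ⟨by positivity, pow_le_one₀ (by norm_num) (by norm_num)⟩

lemma exists_grid_ge {p : ℝ} (hp : p ∈ Set.Icc (0 : ℝ) 1) {K : ℕ} (hK : 0 < K) :
    ∃ i ≤ K, p ≤ (i : ℝ) / K ∧ (i : ℝ) / K ≤ p + 1 / K := by
  have hK' : (0 : ℝ) < K := by exact_mod_cast hK
  have hpK : 0 ≤ p * K := mul_nonneg hp.1 hK'.le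
  refine ⟨⌈p * K⌉₊, ?_, ?_, ?_⟩
  · exact Nat.ceil_le.2 (by nlinarith [hp.2])
  · rw [le_div_iff₀ hK']; exact Nat.le_ceil _
  · rw [div_le_iff₀ hK', add_mul, one_div_mul_cancel hK'.ne']
    exact (Nat.ceil_lt_add_one hpK).le

lemma exists_grid_le {q : ℝ} (hq : q ∈ Set.Icc (0 : ℝ) 1) {K : ℕ} (hK : 0 < K) :
    ∃ i ≤ K, (i : ℝ) / K ≤ q ∧ q ≤ (i : ℝ) / K + 1 / K := by
  have hK' : (0 : ℝ) < K := by exact_mod_cast hK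
  have hpK : 0 ≤ q * K := mul_nonneg hq.1 hK'.le
  refine ⟨⌊q * K⌋₊, ?_, ?_, ?_⟩
  · exact Nat.floor_le_of_le (by nlinarith [hq.2])
  · rw [div_le_iff₀ hK']; exact Nat.floor_le hpK
  · rw [← add_div, le_div_iff₀ hK']
    exact (Nat.lt_floor_add_one _).le

lemma UnitSupported.integrable_rev_add (hP : UnitSupported P) {p d : ℝ} (hp : 0 ≤ p)
    (hd : 0 ≤ d) : Integrable (fun v => rev p (p + d) v) P := by
  refine Integrable.of_mem_Icc 0 1
    (measurable_rev measurable_const measurable_const measurable_id).aemeasurable ?_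
  filter_upwards [hP.valid] with v hv using hv.rev_add_mem hp hd

lemma integrable_rev_max_sub (P : Measure (Val n)) [IsProbabilityMeasure P] (q : ℝ) {d : ℝ}
    (hd : 0 ≤ d) (hd1 : d ≤ 1) :
    Integrable (fun v => rev (max q (secondBid v) - d) q v) P := by
  refine Integrable.of_mem_Icc 0 1
    (measurable_rev ((measurable_const.max measurable_secondBid).sub_const _) measurable_const
      measurable_id).aemeasurable (Filter.Eventually.of_forall fun v => rev_max_sub_mem q hd hd1)

/-- Up to a logarithmic factor and the grid resolution, the baseline is at most the largest
expected revenue of the mechanisms `F_K` over the uniform grid. -/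
lemma UnitSupported.opt_le_of_rev_le (hP : UnitSupported P) {K J : ℕ} (hK : 0 < K) {ρ : ℝ}
    (h1 : ∀ i ≤ K, ∀ j ∈ Finset.Icc 1 J,
      ∫ v, rev ((i : ℝ) / K) ((i : ℝ) / K + 2⁻¹ ^ j) v ∂P ≤ ρ)
    (h2 : ∀ i ≤ K, ∀ j ∈ Finset.Icc 1 J,
      ∫ v, rev (max ((i : ℝ) / K) (secondBid v) - 2⁻¹ ^ j) ((i : ℝ) / K) v ∂P ≤ ρ) :
    opt P ≤ 2 * J * ρ + 2 * (2⁻¹ ^ J + 1 / K) := by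
  refine csSup_le hP.feasible_nonempty ?_
  rintro g ⟨p, hp, q, hq, hrev, rfl⟩
  obtain ⟨i, hi, hi1, hi2⟩ := exists_grid_ge hp hK
  obtain ⟨k, hk, hk1, hk2⟩ := exists_grid_le hq hK
  have hi0 : (0 : ℝ) ≤ (i : ℝ) / K := by positivity
  have hterm : ∀ j ∈ Finset.Icc 1 J, Integrable (fun v =>
      rev ((i : ℝ) / K) ((i : ℝ) / K + 2⁻¹ ^ j) v
        + rev (max ((k : ℝ) / K) (secondBid v) - 2⁻¹ ^ j) ((k : ℝ) / K) v) P := fun j _ =>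
    (hP.integrable_rev_add hi0 (inv_two_pow_mem j).1).add
      (integrable_rev_max_sub P _ (inv_two_pow_mem j).1 (inv_two_pow_mem j).2)
  have hint : Integrable (fun v => ∑ j ∈ Finset.Icc 1 J,
      (rev ((i : ℝ) / K) ((i : ℝ) / K + 2⁻¹ ^ j) v
        + rev (max ((k : ℝ) / K) (secondBid v) - 2⁻¹ ^ j) ((k : ℝ) / K) v)) P :=
    integrable_finsetSum _ hterm
  have hmono := integral_mono_ae ((hP.integrable_gft p q).add (hP.integrable_rev hp q))
    (hint.add (integrable_const (2 * ((2⁻¹ : ℝ) ^ J + 1 / K)))) (by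
      filter_upwards [hP.valid] with v hv using hv.gft_add_rev_le hi0 hk1 hi1 hi2 hk2 J)
  -- `expRev P p q ≥ 0` lets the integral of `gft + rev` bound that of `gft`
  have e1 : ∫ v, (gft p q + rev p q : Val n → ℝ) v ∂P = expGFT P p q + expRev P p q :=
    integral_add (hP.integrable_gft p q) (hP.integrable_rev hp q)
  rw [e1, integral_add' hint (integrable_const _), integral_finsetSum _ hterm] at hmono
  have hsum : ∑ j ∈ Finset.Icc 1 J, ∫ v, (rev ((i : ℝ) / K) ((i : ℝ) / K + 2⁻¹ ^ j) v
        + rev (max ((k : ℝ) / K) (secondBid v) - 2⁻¹ ^ j) ((k : ℝ) / K) v) ∂P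
      ≤ ∑ j ∈ Finset.Icc 1 J, (ρ + ρ) := by
    refine Finset.sum_le_sum fun j hj => ?_
    rw [integral_add (hP.integrable_rev_add hi0 (inv_two_pow_mem j).1)
      (integrable_rev_max_sub P _ (inv_two_pow_mem j).1 (inv_two_pow_mem j).2)]
    exact add_le_add (h1 i hi j hj) (h2 k hk j hj)
  simp only [Finset.sum_const, Nat.card_Icc, add_tsub_cancel_right, nsmul_eq_mul] at hsum
  simp only [integral_const, probReal_univ, smul_eq_mul, one_mul] at hmono
  linarith

/-! ### Discretization of the prices -/

/-- Raising the reserve price loses at most the probability of the skipped bids. -/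
lemma UnitSupported.expGFT_reserve (hP : UnitSupported P) {p q q' γ : ℝ} (hqq : q ≤ q')
    (hγ : P.real {v | q ≤ topBid v ∧ topBid v < q'} ≤ γ) :
    expGFT P p q - γ ≤ expGFT P p q' := by
  have hS : MeasurableSet {v : Val n | q ≤ topBid v ∧ topBid v < q'} :=
    (measurableSet_le measurable_const measurable_topBid).inter
      (measurableSet_lt measurable_topBid measurable_const)
  have hi := (integrable_indicator_iff hS).2 (integrable_const (μ := P) (1 : ℝ)).integrableOn
  have hmono := integral_mono_ae ((hP.integrable_gft p q).sub hi) (hP.integrable_gft p q') (by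
    filter_upwards [hP.valid] with v hv
    have h1 := hv.topBid_le; have h2 := hv.2.1
    simp only [Pi.sub_apply, Set.indicator, Set.mem_ofPred_eq, gft]
    split_ifs <;> first | linarith | (exfalso; grind))
  rw [integral_sub' (hP.integrable_gft p q) hi, integral_indicator_const _ hS] at hmono
  simp only [smul_eq_mul, mul_one] at hmono
  unfold expGFT
  linarith

lemma UnitSupported.expRev_reserve (hP : UnitSupported P) {p q q' γ : ℝ}
    (hp : p ∈ Set.Icc (0 : ℝ) 1) (hqq : q ≤ q')
    (hγ : P.real {v | q ≤ topBid v ∧ topBid v < q'} ≤ γ) :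
    expRev P p q - γ ≤ expRev P p q' := by
  have hS : MeasurableSet {v : Val n | q ≤ topBid v ∧ topBid v < q'} :=
    (measurableSet_le measurable_const measurable_topBid).inter
      (measurableSet_lt measurable_topBid measurable_const)
  have hi := (integrable_indicator_iff hS).2 (integrable_const (μ := P) (1 : ℝ)).integrableOn
  have hmono := integral_mono_ae ((hP.integrable_rev hp q).sub hi) (hP.integrable_rev hp q') (by
    filter_upwards [hP.valid] with v hv
    have h3 := hp.1; have h4 := (hv.rev_mem hp q).2
    have h5 : max q (secondBid v) ≤ max q' (secondBid v) := max_le_max hqq le_rfl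
    simp only [Pi.sub_apply, Set.indicator, Set.mem_ofPred_eq]
    unfold rev at h4 ⊢
    split_ifs at h4 ⊢ <;> first | linarith | (exfalso; grind))
  rw [integral_sub' (hP.integrable_rev hp q) hi, integral_indicator_const _ hS] at hmono
  simp only [smul_eq_mul, mul_one] at hmono
  unfold expRev
  linarith

/-- The precedence property: passing to a larger reserve price changes the revenue by at least as
much as the revealed part of the gain from trade. So an arm with a larger reserve price and a
larger reward cannot have a larger cost. -/
lemma UnitSupported.expRev_sub_ge (hP : UnitSupported P) {p q q' : ℝ}
    (hp : p ∈ Set.Icc (0 : ℝ) 1) (hqq : q ≤ q') :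
    ∫ v, gft2 p q' v ∂P - ∫ v, gft2 p q v ∂P ≤ expRev P p q' - expRev P p q := by
  unfold expRev
  have hmono := integral_mono_ae ((hP.integrable_gft2 hp q').sub (hP.integrable_gft2 hp q))
    ((hP.integrable_rev hp q').sub (hP.integrable_rev hp q)) (by
    filter_upwards [hP.valid] with v hv
    have h1 := hv.secondBid_le
    have h5 : max q (secondBid v) ≤ max q' (secondBid v) := max_le_max hqq le_rfl
    have h6 : q ≤ topBid v → max q (secondBid v) ≤ topBid v := fun h => max_le h h1
    simp only [Pi.sub_apply, rev, gft2]
    split_ifs <;> first | linarith | (exfalso; grind) | (have := h6 (by grind); linarith))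
  rwa [integral_sub' (hP.integrable_gft2 hp q') (hP.integrable_gft2 hp q),
    integral_sub' (hP.integrable_rev hp q') (hP.integrable_rev hp q)] at hmono

/-- Exploration with a uniform seller price estimates the remaining part of the gain from trade,
`E[(p - s) 𝟙(s ≤ p) 𝟙(b̄ ≥ q)]`. -/
lemma UnitSupported.integral_explore (hP : UnitSupported P) {p : ℝ} (hp : p ∈ Set.Icc (0 : ℝ) 1)
    (q : ℝ) :
    ∫ x : Round n, (if (x.1.2 ≤ x.2 ∧ x.2 ≤ p) ∧ q ≤ topBid x.1 then (1 : ℝ) else 0)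
      ∂(P.prod unif) + ∫ v, gft2 p q v ∂P = expGFT P p q := by
  have hmeas : MeasurableSet {x : Round n | (x.1.2 ≤ x.2 ∧ x.2 ≤ p) ∧ q ≤ topBid x.1} :=
    ((measurableSet_le (measurable_snd.comp measurable_fst) measurable_snd).inter
      (measurableSet_le measurable_snd measurable_const)).inter
      (measurableSet_le measurable_const (measurable_topBid.comp measurable_fst))
  have hint : Integrable (fun x : Round n =>
      if (x.1.2 ≤ x.2 ∧ x.2 ≤ p) ∧ q ≤ topBid x.1 then (1 : ℝ) else 0) (P.prod unif) := by
    refine Integrable.of_mem_Icc 0 1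
      (Measurable.ite hmeas measurable_const measurable_const).aemeasurable
      (Filter.Eventually.of_forall fun x => ?_)
    split_ifs <;> simp
  rw [integral_prod _ hint, ← integral_add hint.integral_prod_left (hP.integrable_gft2 hp q)]
  refine integral_congr_ae ?_
  filter_upwards [hP.valid] with v hv
  have hs : ∀ u : ℝ, (if (v.2 ≤ u ∧ u ≤ p) ∧ q ≤ topBid v then (1 : ℝ) else 0)
      = (Set.Icc v.2 p).indicator (fun _ => if q ≤ topBid v then (1 : ℝ) else 0) u := by
    intro u
    simp only [Set.indicator, Set.mem_Icc]
    split_ifs <;> grind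
  simp only [hs]
  rw [integral_indicator_const _ measurableSet_Icc]
  have hvol : unif.real (Set.Icc v.2 p) = max (p - v.2) 0 := by
    have : Set.Icc v.2 p ∩ Set.Icc 0 1 = Set.Icc v.2 p :=
      Set.inter_eq_left.2 (Set.Icc_subset_Icc hv.2.1 hp.2)
    rw [unif, measureReal_restrict_apply measurableSet_Icc, this, Real.volume_real_Icc]
  rw [hvol]
  unfold gft2 gft
  by_cases h1 : v.2 ≤ p
  · rw [max_eq_left (by linarith)]
    by_cases h2 : q ≤ topBid v <;> simp [h1, h2]
  · rw [max_eq_right (by linarith)]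
    simp [h1]

/-- A quantile of the highest bid above `q`: the bids of `[q, y)` have probability at most `γ`
and those of `[q, y]` at least `γ`, unless all bids of `[q, 1)` together have at most `γ`. -/
lemma exists_quantile (P : Measure (Val n)) [IsProbabilityMeasure P] (q : ℝ) {γ : ℝ}
    (hγ : 0 ≤ γ) (h1 : γ < P.real {v | q ≤ topBid v ∧ topBid v < 1}) :
    ∃ y, P.real {v | q ≤ topBid v ∧ topBid v < y} ≤ γ ∧
      γ ≤ P.real {v | q ≤ topBid v ∧ topBid v ≤ y} := by
  have hm : ∀ y, MeasurableSet {v : Val n | q ≤ topBid v ∧ topBid v < y} := fun y =>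
    (measurableSet_le measurable_const measurable_topBid).inter
      (measurableSet_lt measurable_topBid measurable_const)
  have hmono : ∀ y y', y ≤ y' → P.real {v : Val n | q ≤ topBid v ∧ topBid v < y}
      ≤ P.real {v | q ≤ topBid v ∧ topBid v < y'} := fun y y' h =>
    measureReal_mono (fun v hv => ⟨hv.1, hv.2.trans_le h⟩) (measure_ne_top _ _)
  set S := {y | P.real {v : Val n | q ≤ topBid v ∧ topBid v < y} ≤ γ} with hS
  have hne : S.Nonempty := ⟨q, by
    have : {v : Val n | q ≤ topBid v ∧ topBid v < q} = ∅ := by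
      ext v; simp
    simp only [hS, Set.mem_ofPred_eq, this, measureReal_empty, hγ]⟩
  have hbdd : BddAbove S := ⟨1, fun y hy => by
    by_contra h
    exact absurd (h1.trans_le (hmono 1 y (not_le.1 h).le)) (not_lt.2 hy)⟩
  -- `y = sup S`: continuity of the measure from below at `[q, y)`, from above at `[q, y]`
  refine ⟨sSup S, ?_, ?_⟩
  · obtain ⟨u, hu, hlt, htend⟩ := exists_seq_strictMono_tendsto (sSup S)
    have hU : {v : Val n | q ≤ topBid v ∧ topBid v < sSup S}
        = ⋃ k, {v : Val n | q ≤ topBid v ∧ topBid v < u k} := by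
      ext v
      simp only [Set.mem_ofPred_eq, Set.mem_iUnion]
      constructor
      · rintro ⟨a, b⟩
        obtain ⟨k, hk⟩ := (htend.eventually (lt_mem_nhds b)).exists
        exact ⟨k, a, hk⟩
      · rintro ⟨k, a, b⟩
        exact ⟨a, b.trans (hlt k)⟩
    have ht := tendsto_measure_iUnion_atTop (μ := P)
      (s := fun k => {v : Val n | q ≤ topBid v ∧ topBid v < u k})
      (fun i j hij v hv => ⟨hv.1, hv.2.trans_le (hu.monotone hij)⟩)
    rw [← hU] at ht
    refine le_of_tendsto ((ENNReal.tendsto_toReal (measure_ne_top _ _)).comp ht)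
      (Filter.Eventually.of_forall fun k => ?_)
    obtain ⟨y, hy, hky⟩ := exists_lt_of_lt_csSup hne (hlt k)
    exact (hmono _ _ hky.le).trans hy
  · obtain ⟨u, hu, hlt, htend⟩ := exists_seq_strictAnti_tendsto (sSup S)
    have hU : {v : Val n | q ≤ topBid v ∧ topBid v ≤ sSup S}
        = ⋂ k, {v : Val n | q ≤ topBid v ∧ topBid v < u k} := by
      ext v
      simp only [Set.mem_ofPred_eq, Set.mem_iInter]
      constructor
      · rintro ⟨a, b⟩ k
        exact ⟨a, b.trans_lt (hlt k)⟩
      · intro h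
        exact ⟨(h 0).1, ge_of_tendsto htend (Filter.Eventually.of_forall fun k => (h k).2.le)⟩
    have ht := tendsto_measure_iInter_atTop (μ := P)
      (s := fun k => {v : Val n | q ≤ topBid v ∧ topBid v < u k})
      (fun k => (hm _).nullMeasurableSet)
      (fun i j hij v hv => ⟨hv.1, hv.2.trans_le (hu.antitone hij)⟩) ⟨0, measure_ne_top _ _⟩
    rw [← hU] at ht
    refine ge_of_tendsto ((ENNReal.tendsto_toReal (measure_ne_top _ _)).comp ht)
      (Filter.Eventually.of_forall fun k => ?_)
    by_contra h
    exact absurd (le_csSup hbdd (show u k ∈ S from (not_le.1 h).le)) (not_le.2 (hlt k))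

/-- Independent sides: raising the seller price to the grid costs at most the grid width. The
revenue factors as `G p * Pr[s ≤ p]`, where `G p` is the mean margin over the bids; feasibility gives
`0 ≤ G p`, so that `-κ ≤ G p'`, and the added trades gain `G p'` on average or more. -/
lemma UnitSupported.round_seller_of_independent (hP : UnitSupported P)
    (hI : IndependentSides P) {p p' q κ : ℝ} (hp : p ∈ Set.Icc (0 : ℝ) 1)
    (hp' : p' ∈ Set.Icc (0 : ℝ) 1) (hpp : p ≤ p') (hκ : p' ≤ p + κ) (hrev : 0 ≤ expRev P p q)
    (hpos : 0 < expGFT P p q) :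
    expGFT P p q - κ ≤ expGFT P p' q ∧ -κ ≤ expRev P p' q := by
  obtain ⟨PB, PS, hPB, hPS, rfl⟩ := hI
  set g : ℝ → (Fin n → ℝ) → ℝ := fun r b =>
    if q ≤ topBid (b, (0 : ℝ)) then max q (secondBid (b, (0 : ℝ))) - r else 0 with hg
  have hvB : ∀ᵐ b ∂PB, ∀ i, b i ∈ Set.Icc (0 : ℝ) 1 := by
    filter_upwards [Measure.ae_ae_of_ae_prod hP.valid] with b hb
    obtain ⟨s, hs⟩ := hb.exists
    exact hs.1
  have hgi : ∀ r ∈ Set.Icc (0 : ℝ) 1, Integrable (g r) PB := by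
    intro r hr
    have hm0 : Measurable fun b : Fin n → ℝ => ((b, (0 : ℝ)) : Val n) :=
      measurable_id.prodMk measurable_const
    refine Integrable.of_mem_Icc (-1) 1 (Measurable.ite
      (measurableSet_le measurable_const (measurable_topBid.comp hm0))
      ((measurable_const.max (measurable_secondBid.comp hm0)).sub_const r)
      measurable_const).aemeasurable ?_
    filter_upwards [hvB] with b hb
    have hv : Valid ((b, (0 : ℝ)) : Val n) := ⟨hb, by simp⟩
    have h1 := hv.topBid_le; have h2 := hv.secondBid_nonneg; have h3 := hv.secondBid_le
    simp only [hg]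
    split_ifs with hc
    · have h5 := le_max_right q (secondBid ((b, (0 : ℝ)) : Val n))
      have h6 := max_le (hc.trans h1) (h3.trans h1)
      constructor <;> linarith [hr.1, hr.2]
    · constructor <;> norm_num
  have htop : ∀ v : Val n, topBid v = topBid (v.1, (0 : ℝ)) := fun v => rfl
  have hsec : ∀ v : Val n, secondBid v = secondBid (v.1, (0 : ℝ)) := fun v => rfl
  have hR : ∀ r, expRev (PB.prod PS) r q
      = (∫ b, g r b ∂PB) * ∫ s, (if s ≤ r then (1 : ℝ) else 0) ∂PS := by
    intro r
    rw [← integral_prod_mul]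
    refine integral_congr_ae (Filter.Eventually.of_forall fun v => ?_)
    simp only [hg, rev, htop v, hsec v]
    split_ifs <;> simp_all
  have hind : ∀ Q : ℝ → Prop, [DecidablePred Q] →
      (∫ s, (if Q s then (1 : ℝ) else 0) ∂PS) ∈ Set.Icc (0 : ℝ) 1 := by
    intro Q _
    constructor
    · exact integral_nonneg fun s => by dsimp only; split_ifs <;> norm_num
    · by_cases hi : Integrable (fun s => if Q s then (1 : ℝ) else 0) PS
      · have := integral_mono hi (integrable_const (1 : ℝ))
          (fun s => by dsimp only; split_ifs <;> norm_num)
        simpa using this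
      · rw [integral_undef hi]; exact zero_le_one
  -- a positive gain from trade requires a positive probability of `s ≤ p`
  have hF : 0 < ∫ s, (if s ≤ p then (1 : ℝ) else 0) ∂PS := by
    refine lt_of_le_of_ne (hind _).1 fun h0 => ?_
    have hle : expGFT (PB.prod PS) p q ≤ ∫ v : Val n, (1 : ℝ) * (if v.2 ≤ p then (1 : ℝ) else 0)
        ∂(PB.prod PS) := by
      refine integral_mono_ae (hP.integrable_gft p q) ?_ ?_
      · refine Integrable.of_mem_Icc 0 1 (Measurable.aemeasurable ?_)
          (Filter.Eventually.of_forall fun v => ?_)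
        · exact (Measurable.ite (measurableSet_le measurable_snd measurable_const)
            measurable_const measurable_const).const_mul 1
        · split_ifs <;> simp
      · filter_upwards [hP.valid] with v hv
        have h1 := hv.topBid_le; have h2 := hv.2.1
        simp only [gft]
        split_ifs <;> linarith
    have := integral_prod_mul (μ := PB) (ν := PS) (fun _ => (1 : ℝ))
      (fun s => if s ≤ p then (1 : ℝ) else 0)
    rw [this, ← h0, mul_zero] at hle
    linarith
  have hgp : 0 ≤ ∫ b, g p b ∂PB := by
    rw [hR p] at hrev
    exact nonneg_of_mul_nonneg_left hrev hF
  have hκ0 : 0 ≤ κ := by linarith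
  have hgp' : -κ ≤ ∫ b, g p' b ∂PB := by
    have hmono := integral_mono ((hgi p hp).sub (integrable_const κ)) (hgi p' hp') (by
      intro b
      simp only [hg, Pi.sub_apply]
      split_ifs <;> linarith)
    rw [integral_sub' (hgi p hp) (integrable_const κ)] at hmono
    simp only [integral_const, probReal_univ, smul_eq_mul, one_mul] at hmono
    linarith
  constructor
  · -- on the added trades `s ≤ p'`, hence their gain is at least the margin at `p'`
    have hgain : (∫ b, g p' b ∂PB) * (∫ s, (if p < s ∧ s ≤ p' then (1 : ℝ) else 0) ∂PS)
        ≤ expGFT (PB.prod PS) p' q - expGFT (PB.prod PS) p q := by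
      have hi : Integrable (fun s => if p < s ∧ s ≤ p' then (1 : ℝ) else 0) PS :=
        Integrable.of_mem_Icc 0 1 (Measurable.ite
          ((measurableSet_lt measurable_const measurable_id).inter
            (measurableSet_le measurable_id measurable_const))
          measurable_const measurable_const).aemeasurable
          (Filter.Eventually.of_forall fun s => by split_ifs <;> simp)
      unfold expGFT
      rw [← integral_prod_mul, ← integral_sub (hP.integrable_gft p' q) (hP.integrable_gft p q)]
      refine integral_mono_ae ((hgi p' hp').mul_prod hi)
        ((hP.integrable_gft p' q).sub (hP.integrable_gft p q)) ?_
      filter_upwards [hP.valid] with v hv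
      have h3 := hv.secondBid_le
      have h6 : q ≤ topBid v → max q (secondBid v) ≤ topBid v := fun h => max_le h h3
      simp only [hg, gft, ← htop v, ← hsec v]
      split_ifs <;> first | linarith | (exfalso; grind) | (have := h6 (by grind); grind)
    have := hind fun s => p < s ∧ s ≤ p'
    nlinarith [this.1, this.2]
  · rw [hR p']
    have := hind fun s => s ≤ p'
    nlinarith [this.1, this.2]

/-- Bounded density: raising the seller price to the grid costs at most a multiple of the grid
width, because the seller's valuation falls between the two prices with probability at most
`|M| * κ`. -/
lemma UnitSupported.round_seller_of_density (hP : UnitSupported P) {M : ℝ}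
    (hD : BoundedDensity M P) {p p' q κ : ℝ}
    (hp : p ∈ Set.Icc (0 : ℝ) 1) (hp' : p' ∈ Set.Icc (0 : ℝ) 1) (hpp : p ≤ p')
    (hκ : p' ≤ p + κ) (hrev : 0 ≤ expRev P p q) :
    expGFT P p q - |M| * κ ≤ expGFT P p' q ∧ -((1 + |M|) * κ) ≤ expRev P p' q := by
  have hS : MeasurableSet {v : Val n | p < v.2 ∧ v.2 ≤ p'} :=
    (measurableSet_lt measurable_const measurable_snd).inter
      (measurableSet_le measurable_snd measurable_const)
  have hprob : P.real {v : Val n | p < v.2 ∧ v.2 ≤ p'} ≤ |M| * κ := by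
    obtain ⟨f, hf, hfM, hPf⟩ := hD
    have hκ0 : 0 ≤ κ := by linarith
    refine ENNReal.toReal_le_of_le_ofReal (by positivity) ?_
    have hae : {v : Val n | p < v.2 ∧ v.2 ≤ p'} ≤ᵐ[P]
        ((Set.pi Set.univ fun _ : Fin n => Set.Icc (0 : ℝ) 1) ×ˢ Set.Ioc p p' : Set (Val n)) := by
      filter_upwards [hP.valid] with v hv hvp
      exact ⟨fun i _ => hv.1 i, hvp⟩
    refine (measure_mono_ae hae).trans ?_
    have hbox : MeasurableSet
        ((Set.pi Set.univ fun _ : Fin n => Set.Icc (0 : ℝ) 1) ×ˢ Set.Ioc p p' : Set (Val n)) :=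
      (MeasurableSet.univ_pi fun _ => measurableSet_Icc).prod measurableSet_Ioc
    rw [hPf, withDensity_apply _ hbox]
    calc _ ≤ ∫⁻ v in ((Set.pi Set.univ fun _ : Fin n => Set.Icc (0 : ℝ) 1) ×ˢ Set.Ioc p p'
            : Set (Val n)), ENNReal.ofReal M := lintegral_mono fun v => hfM v
      _ = ENNReal.ofReal M * ENNReal.ofReal (p' - p) := by
          rw [setLIntegral_const, Measure.volume_eq_prod, Measure.prod_prod, volume_pi_pi]
          simp
      _ ≤ ENNReal.ofReal (|M| * κ) := by
          rw [← ENNReal.ofReal_mul' (by linarith)]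
          exact ENNReal.ofReal_le_ofReal (mul_le_mul (le_abs_self M) (by linarith)
            (by linarith) (abs_nonneg M))
  have hi := (integrable_indicator_iff hS).2 (integrable_const (μ := P) (1 : ℝ)).integrableOn
  constructor
  · have hmono := integral_mono_ae ((hP.integrable_gft p q).sub hi) (hP.integrable_gft p' q) (by
      filter_upwards [hP.valid] with v hv
      have h1 := (hv.gft_mem p' q).1
      simp only [Pi.sub_apply, Set.indicator, Set.mem_ofPred_eq]
      unfold gft at h1 ⊢
      split_ifs at h1 ⊢ <;> first | linarith | (exfalso; grind))
    rw [integral_sub' (hP.integrable_gft p q) hi, integral_indicator_const _ hS] at hmono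
    simp only [smul_eq_mul, mul_one] at hmono
    unfold expGFT
    linarith
  · have hmono := integral_mono_ae (((hP.integrable_rev hp q).sub hi).sub (integrable_const κ))
      (hP.integrable_rev hp' q) (by
      filter_upwards [hP.valid] with v hv
      have h1 := (hv.rev_mem hp' q).1
      simp only [Pi.sub_apply, Set.indicator, Set.mem_ofPred_eq]
      unfold rev at h1 ⊢
      split_ifs at h1 ⊢ <;> first | linarith | (exfalso; grind))
    rw [integral_sub' ((hP.integrable_rev hp q).sub hi) (integrable_const κ),
      integral_sub' (hP.integrable_rev hp q) hi, integral_indicator_const _ hS] at hmono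
    simp only [smul_eq_mul, mul_one, integral_const, probReal_univ, one_mul] at hmono
    unfold expRev at hrev ⊢
    linarith

/-- Rounding the seller price of a feasible pair up to the grid; a pair without gain is replaced by
the seller price zero. -/
lemma UnitSupported.exists_seller_price (hP : UnitSupported P) {M : ℝ}
    (hD : IndependentSides P ∨ BoundedDensity M P) {K : ℕ} (hK : 0 < K) {p q : ℝ}
    (hp : p ∈ Set.Icc (0 : ℝ) 1) (hrev : 0 ≤ expRev P p q) :
    ∃ i ≤ K, expGFT P p q - (1 + |M|) / K ≤ expGFT P ((i : ℝ) / K) q ∧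
      -((1 + |M|) / K) ≤ expRev P ((i : ℝ) / K) q := by
  have hK' : (0 : ℝ) < K := by exact_mod_cast hK
  have hM := abs_nonneg M
  have hc : 0 ≤ (1 + |M|) / K := by positivity
  have hc1 : (1 : ℝ) / K ≤ (1 + |M|) / K := by gcongr; linarith
  have hc2 : |M| * (1 / K) ≤ (1 + |M|) / K := by
    rw [mul_one_div]; gcongr; linarith
  have hc3 : (1 + |M|) * (1 / K) = (1 + |M|) / K := mul_one_div _ _
  by_cases hpos : 0 < expGFT P p q
  · obtain ⟨i, hi, hi1, hi2⟩ := exists_grid_ge hp hK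
    have hi' : ((i : ℝ) / K) ∈ Set.Icc (0 : ℝ) 1 :=
      ⟨by positivity, (div_le_one hK').2 (by exact_mod_cast hi)⟩
    refine ⟨i, hi, ?_⟩
    rcases hD with hD | hD
    · obtain ⟨a, b⟩ := hP.round_seller_of_independent hD hp hi' hi1 hi2 hrev hpos
      constructor <;> linarith
    · obtain ⟨a, b⟩ := hP.round_seller_of_density hD hp hi' hi1 hi2 hrev
      rw [hc3] at b
      exact ⟨by linarith, b⟩
  · refine ⟨0, Nat.zero_le _, ?_⟩
    simp only [Nat.cast_zero, zero_div]
    have h1 := hP.expGFT_zero_nonneg q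
    have h2 := hP.expRev_zero_nonneg q
    constructor <;> linarith

end Market

/-! ### Measurability of the algorithm -/

section Measurability

variable {Ω : Type*} [MeasurableSpace Ω]

/-- Evaluation at a random index, such as a stopping time or a chosen arm, is measurable. -/
lemma measurable_apply_of_countable {ι β : Type*} [Countable ι] [MeasurableSpace β]
    {f : ι → Ω → β} (hf : ∀ i, Measurable (f i)) {g : Ω → ι}
    (hg : ∀ i, MeasurableSet {ω | g ω = i}) : Measurable fun ω => f (g ω) ω := by
  intro S hS
  have : (fun ω => f (g ω) ω) ⁻¹' S = ⋃ i, {ω | g ω = i} ∩ f i ⁻¹' S := by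
    ext ω; simp
  rw [this]
  exact MeasurableSet.iUnion fun i => (hg i).inter (hf i hS)

lemma measurableSet_apply_of_countable {ι : Type*} [Countable ι]
    {Q : ι → Ω → Prop} (hQ : ∀ i, MeasurableSet {ω | Q i ω}) {g : Ω → ι}
    (hg : ∀ i, MeasurableSet {ω | g ω = i}) : MeasurableSet {ω | Q (g ω) ω} := by
  have : {ω | Q (g ω) ω} = ⋃ i, {ω | g ω = i} ∩ {ω | Q i ω} := by
    ext ω; simp
  rw [this]
  exact MeasurableSet.iUnion fun i => (hg i).inter (hQ i)

/-- A choice depends measurably on the random set of admissible elements of a finite set. -/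
lemma measurableSet_epsilon_eq {ι : Type*} [Nonempty ι] {Q : Ω → ι → Prop} (G : Finset ι)
    (hG : ∀ ω a, Q ω a → a ∈ G) (hQ : ∀ a, MeasurableSet {ω | Q ω a}) (a : ι) :
    MeasurableSet {ω | Classical.epsilon (Q ω) = a} := by
  classical
  have : {ω | Classical.epsilon (Q ω) = a}
      = ⋃ S ∈ G.powerset.filter (fun S => Classical.epsilon (fun b => b ∈ S) = a),
        ⋂ b ∈ G, {ω | Q ω b ↔ b ∈ S} := by
    ext ω
    simp only [Set.mem_ofPred_eq, Set.mem_iUnion, Set.mem_iInter, Finset.mem_filter,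
      Finset.mem_powerset, exists_prop]
    have key : ∀ S ⊆ G, (∀ b ∈ G, (Q ω b ↔ b ∈ S)) → (fun b => b ∈ S) = Q ω := by
      intro S hS h
      funext b
      refine propext ⟨fun hb => (h b (hS hb)).2 hb, fun hb => (h b (hG ω b hb)).1 hb⟩
    constructor
    · intro h
      have hs : ∀ b ∈ G, (Q ω b ↔ b ∈ G.filter (Q ω)) := fun b hb => by simp [hb]
      refine ⟨G.filter (Q ω), ⟨Finset.filter_subset _ _, ?_⟩, hs⟩
      rw [key _ (Finset.filter_subset _ _) hs]; exact h
    · rintro ⟨S, ⟨hS, h1⟩, h2⟩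
      rw [← key S hS h2]; exact h1
  rw [this]
  refine Finset.measurableSet_biUnion _ fun S _ => Finset.measurableSet_biInter _ fun b _ => ?_
  by_cases hb : b ∈ S
  · simpa [hb] using hQ b
  · have : {ω | Q ω b ↔ b ∈ S} = {ω | Q ω b}ᶜ := by ext ω; simp [hb]
    rw [this]; exact (hQ b).compl

lemma measurable_natCast_real {m : Ω → ℕ} (hm : Measurable m) :
    Measurable fun ω => (m ω : ℝ) :=
  (measurable_of_countable (fun k : ℕ => (k : ℝ))).comp hm

lemma measurable_upper (ℓ : ℝ) {m : Ω → ℕ} {s : Ω → ℝ} (hm : Measurable m) (hs : Measurable s) :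
    Measurable fun ω => upper ℓ (m ω) (s ω) := by
  have hm' := measurable_natCast_real hm
  refine Measurable.ite (hm (measurableSet_singleton 0)) measurable_const
    (measurable_coe_real_ereal.comp ((hs.div hm').add ?_))
  exact (measurable_const.mul (Real.continuous_sqrt.measurable.comp
    (measurable_const.div (measurable_const.mul hm'))))

lemma measurable_lower (ℓ : ℝ) {m : Ω → ℕ} {s : Ω → ℝ} (hm : Measurable m) (hs : Measurable s) :
    Measurable fun ω => lower ℓ (m ω) (s ω) := by
  have hm' := measurable_natCast_real hm
  refine Measurable.ite (hm (measurableSet_singleton 0)) measurable_const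
    (measurable_coe_real_ereal.comp ((hs.div hm').sub ?_))
  exact (measurable_const.mul (Real.continuous_sqrt.measurable.comp
    (measurable_const.div (measurable_const.mul hm'))))

variable {n : ℕ} (A : Params)

lemma measurable_nextCut {X : Ω → ℕ → ℝ} {a : Ω → ℝ} (hX : ∀ t, Measurable fun ω => X ω t)
    (ha : Measurable a) : Measurable fun ω => nextCut A (X ω) (a ω) := by
  classical
  let adm : ℕ → Ω → Prop := fun t ω =>
    (((Finset.range A.T0).filter fun s => a ω < X ω s ∧ X ω s < X ω t).card : ℝ)
      ≤ (A.T0 : ℝ) / A.K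
  have hadm : ∀ t, MeasurableSet {ω | adm t ω} := by
    intro t
    have : Measurable fun ω => (((Finset.range A.T0).filter
        fun s => a ω < X ω s ∧ X ω s < X ω t).card : ℝ) := by
      refine measurable_natCast_real ?_
      simp only [Finset.card_filter]
      exact Finset.measurable_fun_sum _ fun s _ => Measurable.ite
        ((measurableSet_lt ha (hX s)).inter (measurableSet_lt (hX s) (hX t)))
        measurable_const measurable_const
    exact measurableSet_le this measurable_const
  refine measurable_of_Ici fun y => ?_
  have hset : (fun ω => nextCut A (X ω) (a ω)) ⁻¹' Set.Ici y
      = (⋃ t ∈ Finset.range A.T0, {ω | adm t ω} ∩ {ω | y ≤ X ω t}) ∪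
        ((⋂ t ∈ Finset.range A.T0, {ω | adm t ω}ᶜ) ∩ {_ω | y ≤ 1}) := by
    ext ω
    simp only [Set.mem_preimage, Set.mem_Ici, Set.mem_union, Set.mem_iUnion, Set.mem_inter_iff,
      Set.mem_ofPred_eq, Set.mem_iInter, Set.mem_compl_iff, exists_prop]
    unfold nextCut
    dsimp only
    split_ifs with h
    · rw [show ∀ (c : Finset ℝ) (hc : c.Nonempty), y ≤ c.max' hc ↔ ∃ z ∈ c, y ≤ z from
        fun c hc => ⟨fun h => ⟨_, c.max'_mem hc, h⟩, fun ⟨z, hz, h⟩ => h.trans (c.le_max' z hz)⟩]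
      simp only [Finset.mem_filter, Finset.mem_image]
      constructor
      · rintro ⟨_, ⟨⟨t, ht, rfl⟩, h2⟩, h3⟩
        exact Or.inl ⟨t, ht, h2, h3⟩
      · rintro (⟨t, ht, h2, h3⟩ | ⟨h2, _⟩)
        · exact ⟨_, ⟨⟨t, ht, rfl⟩, h2⟩, h3⟩
        · obtain ⟨z, hz⟩ := h
          simp only [Finset.mem_filter, Finset.mem_image] at hz
          obtain ⟨⟨t, ht, rfl⟩, hz2⟩ := hz
          exact absurd hz2 (h2 t ht)
    · have hno : ∀ t ∈ Finset.range A.T0, ¬ adm t ω := by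
        intro t ht hadm
        exact h ⟨X ω t, by
          simp only [Finset.mem_filter, Finset.mem_image]; exact ⟨⟨t, ht, rfl⟩, hadm⟩⟩
      constructor
      · intro hy; exact Or.inr ⟨hno, hy⟩
      · rintro (⟨t, ht, h2, _⟩ | ⟨_, hy⟩)
        · exact absurd h2 (hno t ht)
        · exact hy
  rw [hset]
  exact (Finset.measurableSet_biUnion _ fun t _ =>
    (hadm t).inter (measurableSet_le measurable_const (hX t))).union
    ((Finset.measurableSet_biInter _ fun t _ => (hadm t).compl).inter (MeasurableSet.const _))

lemma measurable_cut {X : Ω → ℕ → ℝ} (hX : ∀ t, Measurable fun ω => X ω t) (k : ℕ) :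
    Measurable fun ω => cut A (X ω) k := by
  induction k with
  | zero => exact measurable_const
  | succ k ih => exact measurable_nextCut A hX ih

lemma measurable_buyerPrice (j : ℕ) :
    Measurable fun ω : ℕ → Round n => buyerPrice A ω j := by
  unfold buyerPrice
  split_ifs
  · exact measurable_cut A (fun t => measurable_topBid.comp
      (measurable_fst.comp (measurable_pi_apply t))) j
  · exact measurable_const

lemma measurable_round (t : ℕ) : Measurable fun ω : ℕ → Round n => (ω t).1 :=
  measurable_fst.comp (measurable_pi_apply t)

section Prices

variable {f : Ω → ℕ → Round n} {v : Ω → Val n}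

lemma measurable_fPrices (hf : Measurable f) (hv : Measurable v) (a : FArm) :
    Measurable fun ω => fPrices A (f ω) (v ω) a := by
  rcases a with ⟨i, j⟩ | ⟨i, j⟩
  · exact measurable_const
  · have hb := (measurable_buyerPrice A i).comp hf
    exact ((hb.max (measurable_secondBid.comp hv)).sub_const _).prodMk hb

/-- Revenue of a mechanism of `F_K` on given valuations. -/
noncomputable def fRev (A : Params) (ω : ℕ → Round n) (a : FArm) (v : Val n) : ℝ :=
  rev (fPrices A ω v a).1 (fPrices A ω v a).2 v

lemma measurable_fRev (hf : Measurable f) (hv : Measurable v) (a : FArm) :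
    Measurable fun ω => fRev A (f ω) a (v ω) :=
  measurable_rev (measurable_fst.comp (measurable_fPrices A hf hv a))
    (measurable_snd.comp (measurable_fPrices A hf hv a)) hv

end Prices

lemma measurable_ucbState (k : ℕ) :
    (∀ a, Measurable fun ω : ℕ → Round n => (ucbState A ω k).count a) ∧
    (∀ a, Measurable fun ω : ℕ → Round n => (ucbState A ω k).total a) ∧
    (∀ a, MeasurableSet {ω : ℕ → Round n | (ucbState A ω k).arm A = a}) := by
  have harm : ∀ σ : (ℕ → Round n) → UCBState, (∀ a, Measurable fun ω => (σ ω).count a) →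
      (∀ a, Measurable fun ω => (σ ω).total a) →
      ∀ a, MeasurableSet {ω | (σ ω).arm A = a} := by
    intro σ h1 h2 a
    refine measurableSet_epsilon_eq (fSet A) (fun ω a h => h.1) (fun a => ?_) a
    have : {ω | a ∈ fSet A ∧ ∀ b ∈ fSet A,
        upper (Real.log (2 * (fSet A).card * A.T / A.δ)) ((σ ω).count b) ((σ ω).total b) ≤
        upper (Real.log (2 * (fSet A).card * A.T / A.δ)) ((σ ω).count a) ((σ ω).total a)}
        = {_ω | a ∈ fSet A} ∩ ⋂ b ∈ fSet A, {ω |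
        upper (Real.log (2 * (fSet A).card * A.T / A.δ)) ((σ ω).count b) ((σ ω).total b) ≤
        upper (Real.log (2 * (fSet A).card * A.T / A.δ)) ((σ ω).count a) ((σ ω).total a)} := by
      ext ω; simp
    rw [this]
    refine (MeasurableSet.const _).inter (Finset.measurableSet_biInter _ fun b _ => ?_)
    exact measurableSet_le (measurable_upper _ (h1 b) (h2 b)) (measurable_upper _ (h1 a) (h2 a))
  induction k with
  | zero =>
    have h1 : ∀ a, Measurable fun ω : ℕ → Round n => (ucbState A ω 0).count a :=
      fun a => measurable_const
    have h2 : ∀ a, Measurable fun ω : ℕ → Round n => (ucbState A ω 0).total a :=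
      fun a => measurable_const
    exact ⟨h1, h2, harm _ h1 h2⟩
  | succ k ih =>
    obtain ⟨i1, i2, i3⟩ := ih
    have h1 : ∀ a, Measurable fun ω : ℕ → Round n => (ucbState A ω (k + 1)).count a := by
      intro a
      have : (fun ω : ℕ → Round n => (ucbState A ω (k + 1)).count a) = fun ω =>
          if (ucbState A ω k).arm A = a then (ucbState A ω k).count a + 1
          else (ucbState A ω k).count a := by
        funext ω
        simp only [ucbState, Function.update_apply, eq_comm (a := a)]
        split_ifs with h
        · rw [h]
        · rfl
      rw [this]
      exact Measurable.ite (i3 a) ((i1 a).add_const 1) (i1 a)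
    have h2 : ∀ a, Measurable fun ω : ℕ → Round n => (ucbState A ω (k + 1)).total a := by
      intro a
      have : (fun ω : ℕ → Round n => (ucbState A ω (k + 1)).total a) = fun ω =>
          if (ucbState A ω k).arm A = a then (ucbState A ω k).total a
            + fRev A ω a (ω (A.T0 + k)).1
          else (ucbState A ω k).total a := by
        funext ω
        simp only [ucbState, Function.update_apply, eq_comm (a := a), fRev]
        split_ifs with h
        · rw [h]
        · rfl
      rw [this]
      exact Measurable.ite (i3 a) ((i2 a).add (measurable_fRev A measurable_id
        (measurable_round _) a)) (i2 a)
    exact ⟨h1, h2, harm _ h1 h2⟩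

lemma measurable_ucbPrices (k : ℕ) :
    Measurable fun ω : ℕ → Round n => ucbPrices A ω k :=
  measurable_apply_of_countable
    (f := fun a (ω : ℕ → Round n) => fPrices A ω (ω (A.T0 + k)).1 a)
    (fun a => measurable_fPrices A measurable_id (measurable_round _) a)
    (measurable_ucbState A k).2.2

lemma measurable_cumRev (k : ℕ) : Measurable fun ω : ℕ → Round n => cumRev A ω k :=
  Finset.measurable_fun_sum _ fun i _ =>
    measurable_rev (measurable_fst.comp (measurable_ucbPrices A i))
      (measurable_snd.comp (measurable_ucbPrices A i)) (measurable_round _)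

lemma measurableSet_stopTime_eq (m : ℕ) :
    MeasurableSet {ω : ℕ → Round n | stopTime A ω = m} := by
  have hS : ∀ k, MeasurableSet {ω : ℕ → Round n | A.β ≤ cumRev A ω k} := fun k =>
    measurableSet_le measurable_const (measurable_cumRev A k)
  have hm : Measurable fun ω : ℕ → Round n => sInf {k | A.β ≤ cumRev A ω k} := by
    refine measurable_of_Ici fun y => ?_
    rcases Nat.eq_zero_or_pos y with rfl | hy
    · simp
    have : (fun ω : ℕ → Round n => sInf {k | A.β ≤ cumRev A ω k}) ⁻¹' Set.Ici y
        = (⋃ k, {ω | A.β ≤ cumRev A ω k}) ∩ ⋂ k ∈ Finset.range y, {ω | A.β ≤ cumRev A ω k}ᶜ := by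
      ext ω
      simp only [Set.mem_preimage, Set.mem_Ici, Set.mem_inter_iff, Set.mem_iUnion,
        Set.mem_ofPred_eq, Set.mem_iInter, Finset.mem_range, Set.mem_compl_iff]
      constructor
      · intro h
        have hne : {k | A.β ≤ cumRev A ω k}.Nonempty := Nat.nonempty_of_pos_sInf (by omega)
        exact ⟨hne, fun k hk hk' => absurd (Nat.sInf_le (s := {k | A.β ≤ cumRev A ω k}) hk')
          (by omega)⟩
      · rintro ⟨hne, h⟩
        by_contra hlt
        exact h _ (not_le.1 hlt) (Nat.sInf_mem (s := {k | A.β ≤ cumRev A ω k}) hne)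
    rw [this]
    exact (MeasurableSet.iUnion hS).inter
      (Finset.measurableSet_biInter _ fun k _ => (hS k).compl)
  exact (measurable_const.add hm) (measurableSet_singleton m)

lemma measurableSet_terminates : MeasurableSet {ω : ℕ → Round n | Terminates A ω} := by
  have : {ω : ℕ → Round n | Terminates A ω}
      = ⋃ k, {ω | A.β ≤ cumRev A ω k} ∩ {_ω | A.T0 + k + A.T0 < A.T} := by
    ext ω; simp [Terminates]
  rw [this]
  exact MeasurableSet.iUnion fun k => (measurableSet_le measurable_const
    (measurable_cumRev A k)).inter (MeasurableSet.const _)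

lemma measurable_gft1Bar (a : ℕ × ℕ) :
    Measurable fun ω : ℕ → Round n => gft1Bar A ω a := by
  refine measurable_apply_of_countable (g := stopTime A) (f := fun m (ω : ℕ → Round n) =>
    (1 / (A.T0 : ℝ)) * ∑ t ∈ Finset.Ico m (m + A.T0),
      (if ((ω t).1.2 ≤ (ω t).2 ∧ (ω t).2 ≤ sellerPrice A a.1) ∧
          buyerPrice A ω a.2 ≤ topBid (ω t).1 then (1 : ℝ) else 0)
    + 2 * √(Real.log ((grid A).card / A.δ) / (2 * A.T0))) (fun m => ?_)
    (measurableSet_stopTime_eq A)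
  refine (measurable_const.mul (Finset.measurable_fun_sum _ fun t _ => ?_)).add_const _
  have hs : Measurable fun ω : ℕ → Round n => (ω t).1.2 := measurable_snd.comp (measurable_round t)
  have hu : Measurable fun ω : ℕ → Round n => (ω t).2 := measurable_snd.comp (measurable_pi_apply t)
  exact Measurable.ite (((measurableSet_le hs hu).inter
    (measurableSet_le hu measurable_const)).inter (measurableSet_le
      (measurable_buyerPrice A a.2) (measurable_topBid.comp (measurable_round t))))
    measurable_const measurable_const

section Rewards

variable {f : Ω → ℕ → Round n} {v : Ω → Val n}

lemma measurable_reward (hf : Measurable f) (hv : Measurable v) (a : ℕ × ℕ) :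
    Measurable fun ω => reward A (f ω) (v ω) a :=
  ((((measurable_gft1Bar A a).comp hf)).add (Measurable.ite
    ((measurableSet_le ((measurable_buyerPrice A a.2).comp hf)
      (measurable_topBid.comp hv)).inter
      (measurableSet_le (measurable_snd.comp hv) measurable_const))
    ((measurable_topBid.comp hv).sub_const _) measurable_const)).const_mul _

lemma measurable_cost (hf : Measurable f) (hv : Measurable v) (a : ℕ × ℕ) :
    Measurable fun ω => cost A (f ω) (v ω) a :=
  ((measurable_rev measurable_const ((measurable_buyerPrice A a.2).comp hf) hv).neg.sub_const
    _).const_mul _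

end Rewards

/-- A random state of the elimination procedure whose components are measurable. -/
structure MeasurableState (σ : (ℕ → Round n) → SAEState) : Prop where
  alive_subset : ∀ ω, (σ ω).alive ⊆ grid A
  alive : ∀ b, MeasurableSet {ω | b ∈ (σ ω).alive}
  count : ∀ b, Measurable fun ω => (σ ω).count b
  rewardSum : ∀ b, Measurable fun ω => (σ ω).rewardSum b
  costSum : ∀ b, Measurable fun ω => (σ ω).costSum b

variable {A}

lemma MeasurableState.measurableSet_line {σ : (ℕ → Round n) → SAEState}
    (h : MeasurableState A σ) (i : ℕ) : MeasurableSet {ω | (σ ω).line A = i} := by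
  have h1 : ∀ a, MeasurableSet {ω | argmaxOn (σ ω).alive ((σ ω).rUp A) = a} := by
    intro a
    refine measurableSet_epsilon_eq (grid A) (fun ω a ha => h.alive_subset ω ha.1) (fun a => ?_) a
    have : {ω | a ∈ (σ ω).alive ∧ ∀ b ∈ (σ ω).alive, (σ ω).rUp A b ≤ (σ ω).rUp A a}
        = {ω | a ∈ (σ ω).alive} ∩ ⋂ b ∈ grid A,
          ({ω | b ∈ (σ ω).alive}ᶜ ∪ {ω | (σ ω).rUp A b ≤ (σ ω).rUp A a}) := by
      ext ω
      simp only [Set.mem_ofPred_eq, Set.mem_inter_iff, Set.mem_iInter, Set.mem_union,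
        Set.mem_compl_iff]
      refine and_congr_right fun _ => ⟨fun H b _ => ?_, fun H b hb => ?_⟩
      · exact (em (b ∈ (σ ω).alive)).symm.imp id (H b)
      · exact (H b (h.alive_subset ω hb)).resolve_left (fun h' => h' hb)
    rw [this]
    exact (h.alive a).inter (Finset.measurableSet_biInter _ fun b _ => (h.alive b).compl.union
      (measurableSet_le (measurable_upper _ (h.count b) (h.rewardSum b))
        (measurable_upper _ (h.count a) (h.rewardSum a))))
  have : {ω | (σ ω).line A = i} = ⋃ j, {ω | argmaxOn (σ ω).alive ((σ ω).rUp A) = (i, j)} := by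
    ext ω
    simp only [SAEState.line, Set.mem_ofPred_eq, Set.mem_iUnion]
    exact ⟨fun H => ⟨_, Prod.ext H rfl⟩, fun ⟨j, H⟩ => by rw [H]⟩
  rw [this]
  exact MeasurableSet.iUnion fun j => h1 _

lemma MeasurableState.measurableSet_candidate {σ : (ℕ → Round n) → SAEState}
    (h : MeasurableState A σ) (i j : ℕ) : MeasurableSet {ω | (σ ω).Candidate A i j} := by
  have : {ω | (σ ω).Candidate A i j}
      = {ω | (i, j) ∈ (σ ω).alive} ∩ ⋂ b ∈ grid A,
        ({ω | b ∈ (σ ω).alive}ᶜ ∪ ({_ω | b.1 ≠ i} ∪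
          {ω | (σ ω).rLow A b ≤ (σ ω).rUp A (i, j)})) := by
    ext ω
    simp only [SAEState.Candidate, Set.mem_ofPred_eq, Set.mem_inter_iff, Set.mem_iInter,
      Set.mem_union, Set.mem_compl_iff]
    refine and_congr_right fun _ => ⟨fun H b _ => ?_, fun H b hb hi => ?_⟩
    · have := H b
      tauto
    · have := H b (h.alive_subset ω hb)
      tauto
  rw [this]
  exact (h.alive _).inter (Finset.measurableSet_biInter _ fun b _ => (h.alive b).compl.union
    ((MeasurableSet.const _).union
      (measurableSet_le (measurable_lower _ (h.count b) (h.rewardSum b))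
        (measurable_upper _ (h.count _) (h.rewardSum _)))))

lemma mem_grid_iff {a : ℕ × ℕ} : a ∈ grid A ↔ a.1 < A.K + 1 ∧ a.2 < 2 * A.K + 2 := by
  simp [grid]

lemma MeasurableState.measurableSet_arm {σ : (ℕ → Round n) → SAEState}
    (h : MeasurableState A σ) (a : ℕ × ℕ) : MeasurableSet {ω | (σ ω).arm A ω = a} := by
  have hne : MeasurableSet {ω | (σ ω).alive.Nonempty} := by
    have : {ω | (σ ω).alive.Nonempty} = ⋃ b, {ω | b ∈ (σ ω).alive} := by
      ext ω; simp [Finset.Nonempty]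
    rw [this]
    exact MeasurableSet.iUnion h.alive
  have heps : ∀ i j, MeasurableSet {ω : ℕ → Round n |
      Classical.epsilon (fun j => (σ ω).Candidate A i j ∧
      ∀ j', (σ ω).Candidate A i j' → buyerPrice A ω j ≤ buyerPrice A ω j') = j} := by
    intro i j
    refine measurableSet_epsilon_eq (Finset.range (2 * A.K + 2))
      (fun ω j hj => Finset.mem_range.2 (mem_grid_iff.1 (h.alive_subset ω hj.1.1)).2)
      (fun j => ?_) j
    have : {ω : ℕ → Round n | (σ ω).Candidate A i j ∧
        ∀ j', (σ ω).Candidate A i j' → buyerPrice A ω j ≤ buyerPrice A ω j'}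
        = {ω | (σ ω).Candidate A i j} ∩ ⋂ j', ({ω | (σ ω).Candidate A i j'}ᶜ ∪
          {ω : ℕ → Round n | buyerPrice A ω j ≤ buyerPrice A ω j'}) := by
      ext ω
      simp only [Set.mem_ofPred_eq, Set.mem_inter_iff, Set.mem_iInter,
        Set.mem_union, Set.mem_compl_iff, imp_iff_not_or]
    rw [this]
    exact (h.measurableSet_candidate i j).inter (MeasurableSet.iInter fun j' =>
      (h.measurableSet_candidate i j').compl.union
        (measurableSet_le (measurable_buyerPrice A j) (measurable_buyerPrice A j')))
  have : {ω : ℕ → Round n | (σ ω).arm A ω = a}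
      = ({ω | (σ ω).alive.Nonempty} ∩ ({ω | (σ ω).line A = a.1} ∩
          {ω : ℕ → Round n | Classical.epsilon (fun j => (σ ω).Candidate A a.1 j ∧
      ∀ j', (σ ω).Candidate A a.1 j' → buyerPrice A ω j ≤ buyerPrice A ω j') = a.2})) ∪
        ({ω | (σ ω).alive.Nonempty}ᶜ ∩ {_ω | (0, 2 * A.K + 1) = a}) := by
    ext ω
    simp only [SAEState.arm, Set.mem_ofPred_eq, Set.mem_inter_iff, Set.mem_union,
      Set.mem_compl_iff]
    split_ifs with hn
    · simp only [hn, true_and, not_true, false_and, or_false]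
      constructor
      · rintro rfl; exact ⟨rfl, rfl⟩
      · rintro ⟨h1, h2⟩
        refine Prod.ext h1 ?_
        rw [h1]; exact h2
    · simp [hn]
  rw [this]
  exact (hne.inter ((h.measurableSet_line _).inter (heps _ _))).union
    (hne.compl.inter (MeasurableSet.const _))

/-- The arms observed in a round in which the arm `a` is played: those of its line with at least
its reserve price. -/
def Observed (A : Params) (ω : ℕ → Round n) (a b : ℕ × ℕ) : Prop :=
  b ∈ grid A ∧ b.1 = a.1 ∧ buyerPrice A ω a.2 ≤ buyerPrice A ω b.2

lemma MeasurableState.measurableSet_observed {σ : (ℕ → Round n) → SAEState}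
    (h : MeasurableState A σ) (b : ℕ × ℕ) :
    MeasurableSet {ω | Observed A ω ((σ ω).arm A ω) b} := by
  refine measurableSet_apply_of_countable (g := fun ω => (σ ω).arm A ω)
    (Q := fun a ω => Observed A ω a b) (fun a => ?_) h.measurableSet_arm
  exact (MeasurableSet.const _).inter ((MeasurableSet.const _).inter
    (measurableSet_le (measurable_buyerPrice A _) (measurable_buyerPrice A _)))

section Step
open scoped Classical

lemma SAEState.step_count (ω : ℕ → Round n) (v : Val n) (σ : SAEState) (b : ℕ × ℕ) :
    (σ.step A ω v).count b
      = if Observed A ω (σ.arm A ω) b then σ.count b + 1 else σ.count b := by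
  simp only [SAEState.step, Observed]
  congr

lemma SAEState.step_rewardSum (ω : ℕ → Round n) (v : Val n) (σ : SAEState) (b : ℕ × ℕ) :
    (σ.step A ω v).rewardSum b
      = if Observed A ω (σ.arm A ω) b then σ.rewardSum b + reward A ω v b
        else σ.rewardSum b := by
  simp only [SAEState.step, Observed]
  congr

lemma SAEState.step_costSum (ω : ℕ → Round n) (v : Val n) (σ : SAEState) (b : ℕ × ℕ) :
    (σ.step A ω v).costSum b
      = if Observed A ω (σ.arm A ω) b then σ.costSum b + cost A ω v b else σ.costSum b := by
  simp only [SAEState.step, Observed]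
  congr

lemma SAEState.mem_step_alive (ω : ℕ → Round n) (v : Val n) (σ : SAEState) (b : ℕ × ℕ) :
    b ∈ (σ.step A ω v).alive ↔ b ∈ σ.alive ∧ (b.1 = (σ.arm A ω).1 →
      (buyerPrice A ω (σ.arm A ω).2 ≤ buyerPrice A ω b.2 ∧
        (σ.step A ω v).cLow A b ≤ 0)) := by
  simp only [SAEState.step, SAEState.cLow, Finset.mem_filter]

end Step

lemma MeasurableState.step {σ : (ℕ → Round n) → SAEState} (h : MeasurableState A σ)
    {v : (ℕ → Round n) → Val n} (hv : Measurable v) :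
    MeasurableState A fun ω => (σ ω).step A ω (v ω) := by
  have hc : ∀ b, Measurable fun ω => ((σ ω).step A ω (v ω)).count b := fun b => by
    simp only [SAEState.step_count]
    exact Measurable.ite (h.measurableSet_observed b) ((h.count b).add_const 1) (h.count b)
  have hcs : ∀ b, Measurable fun ω => ((σ ω).step A ω (v ω)).costSum b := fun b => by
    simp only [SAEState.step_costSum]
    exact Measurable.ite (h.measurableSet_observed b)
      ((h.costSum b).add (measurable_cost A measurable_id hv b)) (h.costSum b)
  refine ⟨fun ω b hb => h.alive_subset ω ((SAEState.mem_step_alive ω _ _ b).1 hb).1,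
    fun b => ?_, hc, fun b => ?_, hcs⟩
  · have : {ω | b ∈ ((σ ω).step A ω (v ω)).alive} = {ω | b ∈ (σ ω).alive} ∩
        ({ω | (σ ω).arm A ω ∈ {a : ℕ × ℕ | b.1 = a.1}}ᶜ ∪
        ({ω | buyerPrice A ω ((σ ω).arm A ω).2 ≤ buyerPrice A ω b.2} ∩
          {ω | ((σ ω).step A ω (v ω)).cLow A b ≤ 0})) := by
      ext ω
      simp only [SAEState.mem_step_alive, Set.mem_ofPred_eq, Set.mem_inter_iff, Set.mem_union,
        Set.mem_compl_iff, imp_iff_not_or]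
    rw [this]
    refine (h.alive b).inter (MeasurableSet.union (MeasurableSet.compl ?_)
      (MeasurableSet.inter ?_ ?_))
    · exact measurableSet_apply_of_countable (g := fun ω => (σ ω).arm A ω)
        (Q := fun a _ => b.1 = a.1) (fun a => MeasurableSet.const _) h.measurableSet_arm
    · exact measurableSet_apply_of_countable (g := fun ω => (σ ω).arm A ω)
        (Q := fun a (ω : ℕ → Round n) => buyerPrice A ω a.2 ≤ buyerPrice A ω b.2)
        (fun a => measurableSet_le (measurable_buyerPrice A _) (measurable_buyerPrice A _))
        h.measurableSet_arm
    · exact measurableSet_le (measurable_lower _ (hc b) (hcs b)) measurable_const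
  · simp only [SAEState.step_rewardSum]
    exact Measurable.ite (h.measurableSet_observed b)
      ((h.rewardSum b).add (measurable_reward A measurable_id hv b)) (h.rewardSum b)

variable (A)

lemma measurableState_saeState (k : ℕ) :
    MeasurableState A fun ω : ℕ → Round n => saeState A ω k := by
  induction k with
  | zero =>
    exact ⟨fun ω => subset_rfl, fun b => MeasurableSet.const (b ∈ grid A),
      fun b => measurable_const,
      fun b => measurable_const, fun b => measurable_const⟩
  | succ k ih =>
    refine ih.step (v := fun ω => (ω (stopTime A ω + A.T0 + k)).1) ?_
    exact measurable_apply_of_countable (g := stopTime A)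
      (f := fun m (ω : ℕ → Round n) => (ω (m + A.T0 + k)).1) (fun m => measurable_round _)
      (measurableSet_stopTime_eq A)

lemma measurable_saePrices (k : ℕ) :
    Measurable fun ω : ℕ → Round n => saePrices A ω k := by
  unfold saePrices
  exact measurable_apply_of_countable (g := fun ω : ℕ → Round n => (saeState A ω k).arm A ω)
    (f := fun a (ω : ℕ → Round n) => (sellerPrice A a.1, buyerPrice A ω a.2))
    (fun a => measurable_const.prodMk (measurable_buyerPrice A _))
    (measurableState_saeState A k).measurableSet_arm

lemma measurable_prices (t : ℕ) : Measurable fun ω : ℕ → Round n => prices A ω t := by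
  have hst : ∀ Q : ℕ → Prop, MeasurableSet {ω : ℕ → Round n | Q (stopTime A ω)} := fun Q =>
    measurableSet_apply_of_countable (Q := fun m _ => Q m) (fun m => MeasurableSet.const _)
      (measurableSet_stopTime_eq A)
  unfold prices
  refine Measurable.ite (MeasurableSet.const _)
    ((measurable_secondBid.comp (measurable_round t)).prodMk measurable_const)
    (Measurable.ite ((measurableSet_terminates A).inter (hst (· ≤ t)))
      (Measurable.ite (hst fun m => t < m + A.T0)
        ((measurable_snd.comp (measurable_pi_apply t)).prodMk measurable_const) ?_)
      (measurable_ucbPrices A _))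
  exact measurable_apply_of_countable (g := stopTime A)
    (f := fun m (ω : ℕ → Round n) => saePrices A ω (t - (m + A.T0)))
    (fun m => measurable_saePrices A _) (measurableSet_stopTime_eq A)

lemma measurable_totalGFT : Measurable fun ω : ℕ → Round n => totalGFT A ω :=
  Finset.measurable_fun_sum _ fun t _ =>
    measurable_gft (measurable_fst.comp (measurable_prices A t))
      (measurable_snd.comp (measurable_prices A t)) (measurable_round t)

end Measurability

/-! ### The decisions of a round depend on the earlier rounds only -/

section Predictable

set_option linter.unusedSectionVars false

variable {n : ℕ} (A : Params) {ω ω' : ℕ → Round n}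

lemma nextCut_congr {x y : ℕ → ℝ} (h : ∀ t < A.T0, x t = y t) (a : ℝ) :
    nextCut A x a = nextCut A y a := by
  have h1 : (Finset.range A.T0).image x = (Finset.range A.T0).image y :=
    Finset.image_congr fun t ht => h t (Finset.mem_range.1 ht)
  have h2 : ∀ q, ((Finset.range A.T0).filter fun t => a < x t ∧ x t < q)
      = (Finset.range A.T0).filter fun t => a < y t ∧ y t < q := fun q =>
    Finset.filter_congr fun t ht => by rw [h t (Finset.mem_range.1 ht)]
  unfold nextCut
  simp only [h1, h2]

lemma cut_congr {x y : ℕ → ℝ} (h : ∀ t < A.T0, x t = y t) (k : ℕ) : cut A x k = cut A y k := by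
  induction k with
  | zero => rfl
  | succ k ih => rw [cut, cut, ih, nextCut_congr A h]

lemma buyerPrice_congr (h : AgreeBefore A.T0 ω ω') (j : ℕ) :
    buyerPrice A ω j = buyerPrice A ω' j := by
  unfold buyerPrice
  rw [cut_congr A (fun t ht => by rw [h t ht])]

lemma fPrices_congr (h : AgreeBefore A.T0 ω ω') (v : Val n) (a : FArm) :
    fPrices A ω v a = fPrices A ω' v a := by
  rcases a with ⟨i, j⟩ | ⟨i, j⟩
  · rfl
  · simp only [fPrices, buyerPrice_congr A h]

lemma ucbState_congr {k : ℕ} (h : AgreeBefore (A.T0 + k) ω ω') :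
    ucbState A ω k = ucbState A ω' k := by
  induction k with
  | zero => rfl
  | succ k ih =>
    have h0 : AgreeBefore A.T0 ω ω' := h.mono (by omega)
    simp only [ucbState, ih (h.mono (by omega)), h (A.T0 + k) (by omega), fPrices_congr A h0]

lemma cumRev_congr {k : ℕ} (h : AgreeBefore (A.T0 + k) ω ω') : cumRev A ω k = cumRev A ω' k := by
  refine Finset.sum_congr rfl fun i hi => ?_
  have hi := Finset.mem_range.1 hi
  rw [ucbPrices, ucbPrices, ucbState_congr A (k := i) (h.mono (by omega)), h (A.T0 + i) (by omega),
    fPrices_congr A (h.mono (by omega))]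

/-- The accumulated revenue has reached the threshold within the first `t` rounds. -/
def Started (A : Params) (t : ℕ) (ω : ℕ → Round n) : Prop :=
  ∃ k, A.β ≤ cumRev A ω k ∧ A.T0 + k ≤ t

variable {A}

lemma Started.congr {t : ℕ} (hs : Started A t ω) (h : AgreeBefore t ω ω') : Started A t ω' := by
  obtain ⟨k, hk, hkt⟩ := hs
  exact ⟨k, cumRev_congr A (h.mono hkt) ▸ hk, hkt⟩

lemma Started.stopTime_le {t : ℕ} (hs : Started A t ω) : stopTime A ω ≤ t := by
  obtain ⟨k, hk, hkt⟩ := hs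
  have := Nat.sInf_le (s := {k | A.β ≤ cumRev A ω k}) hk
  unfold stopTime
  omega

lemma Started.stopTime_mem {t : ℕ} (hs : Started A t ω) :
    A.β ≤ cumRev A ω (stopTime A ω - A.T0) := by
  obtain ⟨k, hk, hkt⟩ := hs
  have := Nat.sInf_mem (s := {k | A.β ≤ cumRev A ω k}) ⟨k, hk⟩
  simpa [stopTime] using this

lemma le_stopTime : A.T0 ≤ stopTime A ω := Nat.le_add_right _ _

lemma Started.stopTime_congr {t : ℕ} (hs : Started A t ω) (h : AgreeBefore t ω ω') :
    stopTime A ω' = stopTime A ω := by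
  have key : ∀ {ω ω' : ℕ → Round n}, Started A t ω → AgreeBefore t ω ω' →
      stopTime A ω' ≤ stopTime A ω := by
    intro ω ω' hs h
    refine Started.stopTime_le ⟨stopTime A ω - A.T0, ?_, ?_⟩
    · rw [← cumRev_congr A (h.mono ?_)]
      · exact hs.stopTime_mem
      · have := hs.stopTime_le; have := le_stopTime (A := A) (ω := ω); omega
    · have := le_stopTime (A := A) (ω := ω); omega
  exact le_antisymm (key hs h) (key (hs.congr h) h.symm)

variable (A) in
/-- Round `t` belongs to the elimination phase. -/
def InElim (t : ℕ) (ω : ℕ → Round n) : Prop := Started A t ω ∧ stopTime A ω + A.T0 ≤ t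

variable (A) in
/-- Round `t` belongs to the exploration phase. -/
def InExplore (t : ℕ) (ω : ℕ → Round n) : Prop := Started A t ω ∧ t < stopTime A ω + A.T0

lemma InElim.congr {t : ℕ} (hs : InElim A t ω) (h : AgreeBefore t ω ω') :
    InElim A t ω' ∧ stopTime A ω' = stopTime A ω := by
  have h1 := hs.1.stopTime_congr h
  exact ⟨⟨hs.1.congr h, h1 ▸ hs.2⟩, h1⟩

lemma InExplore.congr {t : ℕ} (hs : InExplore A t ω) (h : AgreeBefore t ω ω') :
    InExplore A t ω' ∧ stopTime A ω' = stopTime A ω := by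
  have h1 := hs.1.stopTime_congr h
  exact ⟨⟨hs.1.congr h, h1 ▸ hs.2⟩, h1⟩

lemma gft1Bar_congr {t : ℕ} (hs : InElim A t ω) (h : AgreeBefore t ω ω') (a : ℕ × ℕ) :
    gft1Bar A ω' a = gft1Bar A ω a := by
  unfold gft1Bar
  rw [(hs.congr h).2]
  congr 2
  refine Finset.sum_congr rfl fun s hs' => ?_
  rw [← h s ((Finset.mem_Ico.1 hs').2.trans_le hs.2),
    buyerPrice_congr A (h.mono ((Nat.le_add_left _ _).trans hs.2))]

lemma reward_congr {t : ℕ} (hs : InElim A t ω) (h : AgreeBefore t ω ω') (v : Val n)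
    (a : ℕ × ℕ) : reward A ω' v a = reward A ω v a := by
  unfold reward
  rw [gft1Bar_congr hs h, buyerPrice_congr A (h.mono ((Nat.le_add_left _ _).trans hs.2))]

lemma cost_congr {t : ℕ} (hs : InElim A t ω) (h : AgreeBefore t ω ω') (v : Val n)
    (a : ℕ × ℕ) : cost A ω' v a = cost A ω v a := by
  unfold cost
  rw [buyerPrice_congr A (h.mono ((Nat.le_add_left _ _).trans hs.2))]

lemma arm_congr {t : ℕ} (hs : InElim A t ω) (h : AgreeBefore t ω ω') (σ : SAEState) :
    σ.arm A ω' = σ.arm A ω := by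
  have : buyerPrice A ω' = buyerPrice A ω :=
    funext fun j => (buyerPrice_congr A (h.mono ((Nat.le_add_left _ _).trans hs.2)) j).symm
  unfold SAEState.arm
  rw [this]

/-- Within the elimination phase its state depends on the earlier rounds only. `Started` makes the
stopping time, and with it the beginning of the phase, a function of these rounds. -/
lemma saeState_congr {t : ℕ} (hs : InElim A t ω) (h : AgreeBefore t ω ω') {k : ℕ}
    (hk : stopTime A ω + A.T0 + k ≤ t) : saeState A ω' k = saeState A ω k := by
  induction k with
  | zero => rfl
  | succ k ih =>
    have hb : buyerPrice A ω' = buyerPrice A ω :=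
      funext fun j => (buyerPrice_congr A (h.mono ((Nat.le_add_left _ _).trans hs.2)) j).symm
    have hr : reward A ω' = reward A ω :=
      funext fun v => funext fun a => reward_congr hs h v a
    have hc : cost (n := n) A ω' = cost A ω :=
      funext fun v => funext fun a => cost_congr hs h v a
    rw [saeState, saeState, ih (by omega), (hs.congr h).2, h _ (show _ < t by omega)]
    unfold SAEState.step
    simp only [arm_congr hs h, hb, hr, hc]

/-- The state of the elimination procedure before round `t`. -/
noncomputable def elimState (A : Params) (t : ℕ) (ω : ℕ → Round n) : SAEState :=
  saeState A ω (t - (stopTime A ω + A.T0))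

lemma elimState_congr {t : ℕ} (hs : InElim A t ω) (h : AgreeBefore t ω ω') :
    elimState A t ω' = elimState A t ω := by
  unfold elimState
  rw [(hs.congr h).2, saeState_congr hs h]
  have := hs.2
  omega

/-! ### The sampling schemes of the algorithm -/

variable (A)

lemma measurableSet_started (t : ℕ) : MeasurableSet {ω : ℕ → Round n | Started A t ω} := by
  have : {ω : ℕ → Round n | Started A t ω}
      = ⋃ k, {ω | A.β ≤ cumRev A ω k} ∩ {_ω | A.T0 + k ≤ t} := by
    ext ω; simp [Started]
  rw [this]
  exact MeasurableSet.iUnion fun k => (measurableSet_le measurable_const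
    (measurable_cumRev A k)).inter (MeasurableSet.const _)

lemma measurableSet_stopTime (Q : ℕ → Prop) :
    MeasurableSet {ω : ℕ → Round n | Q (stopTime A ω)} :=
  measurableSet_apply_of_countable (Q := fun m _ => Q m) (fun _ => MeasurableSet.const _)
    (measurableSet_stopTime_eq A)

lemma measurableSet_inElim (t : ℕ) : MeasurableSet {ω : ℕ → Round n | InElim A t ω} :=
  (measurableSet_started A t).inter (measurableSet_stopTime A fun m => m + A.T0 ≤ t)

lemma measurableSet_inExplore (t : ℕ) : MeasurableSet {ω : ℕ → Round n | InExplore A t ω} :=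
  (measurableSet_started A t).inter (measurableSet_stopTime A fun m => t < m + A.T0)

variable {P : Measure (Val n)} [IsProbabilityMeasure P]

lemma UnitSupported.valid_round (hP : UnitSupported P) :
    ∀ᵐ x ∂(P.prod unif), Valid x.1 ∧ x.2 ∈ Set.Icc (0 : ℝ) 1 := by
  have h1 : ∀ᵐ x ∂(P.prod unif), Valid x.1 :=
    Measure.quasiMeasurePreserving_fst.ae hP.valid
  have h2 : ∀ᵐ x ∂(P.prod unif), x.2 ∈ Set.Icc (0 : ℝ) 1 :=
    Measure.quasiMeasurePreserving_snd.ae (ae_restrict_mem measurableSet_Icc)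
  filter_upwards [h1, h2] with x hx1 hx2 using ⟨hx1, hx2⟩

lemma UnitSupported.ae_valid (hP : UnitSupported P) :
    ∀ᵐ ω ∂(seqLaw P), ∀ t, Valid (ω t).1 ∧ (ω t).2 ∈ Set.Icc (0 : ℝ) 1 := by
  rw [ae_all_iff]
  intro t
  exact (measurePreserving_eval_infinitePi (fun _ : ℕ => P.prod unif) t).quasiMeasurePreserving.ae
    hP.valid_round

lemma integral_round_fst (g : Val n → ℝ) : ∫ x : Round n, g x.1 ∂(P.prod unif) = ∫ v, g v ∂P := by
  rw [integral_fun_fst]; simp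

/-- The bids of the grid estimation phase that fall into a fixed set. -/
lemma sampling_grid (S : Set (Val n)) (hS : MeasurableSet S) :
    Sampling (P.prod unif) (fun t _ => t < A.T0)
      (fun _ _ x => S.indicator (fun _ => (1 : ℝ)) x.1) 1 where
  measurableSet t := MeasurableSet.const _
  measurable t := (measurable_const.indicator hS).comp (measurable_fst.comp measurable_snd)
  predictable t ω ω' _ h := ⟨h, rfl⟩
  range t ω _ := ⟨0, Filter.Eventually.of_forall fun x => by
    simp only [Set.indicator]; split_ifs <;> simp⟩

/-- The revenues of a fixed mechanism during the revenue accumulation phase. -/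
lemma UnitSupported.sampling_ucb (hP : UnitSupported P) {a : FArm} (ha : a ∈ fSet A) :
    Sampling (P.prod unif) (fun t ω => A.T0 ≤ t ∧ (ucbState A ω (t - A.T0)).arm A = a)
      (fun _ ω x => fRev A ω a x.1) 1 where
  measurableSet t := (MeasurableSet.const _).inter ((measurable_ucbState A _).2.2 a)
  measurable t := measurable_fRev A measurable_fst (measurable_fst.comp measurable_snd) a
  predictable t ω ω' h hi := by
    refine ⟨⟨hi.1, ?_⟩, ?_⟩
    · rw [← ucbState_congr A (h.mono (by have := hi.1; omega))]; exact hi.2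
    · funext x
      simp only [fRev, fPrices_congr A (h.mono hi.1)]
  range t ω _ := by
    refine ⟨0, ?_⟩
    filter_upwards [hP.valid_round] with x hx
    rcases a with ⟨i, j⟩ | ⟨i, j⟩
    · simpa [fRev, fPrices] using hx.1.rev_add_mem (p := sellerPrice A i)
        (by unfold sellerPrice; positivity) (inv_two_pow_mem j).1
    · simpa [fRev, fPrices] using
        rev_max_sub_mem (v := x.1) (buyerPrice A ω i) (inv_two_pow_mem j).1 (inv_two_pow_mem j).2

/-- The indicator recorded by the exploration phase for a grid point. -/
noncomputable def exploreInd (A : Params) (ω : ℕ → Round n) (a : ℕ × ℕ) (x : Round n) : ℝ :=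
  if (x.1.2 ≤ x.2 ∧ x.2 ≤ sellerPrice A a.1) ∧ buyerPrice A ω a.2 ≤ topBid x.1 then 1 else 0

lemma sampling_explore (a : ℕ × ℕ) :
    Sampling (P.prod unif) (InExplore A) (fun _ ω x => exploreInd A ω a x) 1 where
  measurableSet t := measurableSet_inExplore A t
  measurable t := by
    have hs : Measurable fun z : (ℕ → Round n) × Round n => z.2.1.2 :=
      measurable_snd.comp (measurable_fst.comp measurable_snd)
    have hu : Measurable fun z : (ℕ → Round n) × Round n => z.2.2 :=
      measurable_snd.comp measurable_snd
    exact Measurable.ite (((measurableSet_le hs hu).inter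
      (measurableSet_le hu measurable_const)).inter (measurableSet_le
        ((measurable_buyerPrice A a.2).comp measurable_fst)
        (measurable_topBid.comp (measurable_fst.comp measurable_snd))))
      measurable_const measurable_const
  predictable t ω ω' h hi := by
    refine ⟨(hi.congr h).1, ?_⟩
    funext x
    simp only [exploreInd, buyerPrice_congr A (h.mono (le_stopTime.trans hi.1.stopTime_le))]
  range t ω _ := ⟨0, Filter.Eventually.of_forall fun x => by
    simp only [exploreInd]; split_ifs <;> simp⟩

/-- Round `t` of the elimination phase observes the arm `a`. -/
def Observes (A : Params) (a : ℕ × ℕ) (t : ℕ) (ω : ℕ → Round n) : Prop :=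
  InElim A t ω ∧ Observed A ω ((elimState A t ω).arm A ω) a

lemma measurableSet_elim_of_state {Q : ℕ → (ℕ → Round n) → Prop}
    (hQ : ∀ k, MeasurableSet {ω | Q k ω}) (t : ℕ) :
    MeasurableSet {ω : ℕ → Round n | Q (t - (stopTime A ω + A.T0)) ω} :=
  measurableSet_apply_of_countable (g := stopTime A)
    (Q := fun m ω => Q (t - (m + A.T0)) ω) (fun _ => hQ _) (measurableSet_stopTime_eq A)

lemma measurableSet_observes (a : ℕ × ℕ) (t : ℕ) :
    MeasurableSet {ω : ℕ → Round n | Observes A a t ω} :=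
  (measurableSet_inElim A t).inter (measurableSet_elim_of_state A
    (Q := fun k ω => Observed A ω ((saeState A ω k).arm A ω) a)
    (fun k => (measurableState_saeState A k).measurableSet_observed a) t)

lemma Observes.congr {a : ℕ × ℕ} {t : ℕ} (hs : Observes A a t ω) (h : AgreeBefore t ω ω') :
    Observes A a t ω' := by
  refine ⟨(hs.1.congr h).1, ?_⟩
  have hb : buyerPrice A ω' = buyerPrice A ω :=
    funext fun j => (buyerPrice_congr A (h.mono ((Nat.le_add_left _ _).trans hs.1.2)) j).symm
  rw [elimState_congr hs.1 h, arm_congr hs.1 h]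
  unfold Observed
  rw [hb]
  exact hs.2

lemma sellerPrice_mem {i : ℕ} (hi : i ≤ A.K) : sellerPrice A i ∈ Set.Icc (0 : ℝ) 1 := by
  unfold sellerPrice
  exact ⟨by positivity, div_le_one_of_le₀ (by exact_mod_cast hi) (by positivity)⟩

lemma UnitSupported.sampling_reward (hP : UnitSupported P) {a : ℕ × ℕ} (ha : a ∈ grid A) :
    Sampling (P.prod unif) (Observes A a) (fun _ ω x => reward A ω x.1 a) 1 where
  measurableSet t := measurableSet_observes A a t
  measurable t := measurable_reward A measurable_fst (measurable_fst.comp measurable_snd) a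
  predictable t ω ω' h hi :=
    ⟨hi.congr A h, funext fun x => reward_congr hi.1 h x.1 a⟩
  range t ω _ := by
    have hp := sellerPrice_mem A (i := a.1) (by have := (mem_grid_iff.1 ha).1; omega)
    refine ⟨(1 / 2) * (gft1Bar A ω a - sellerPrice A a.1), ?_⟩
    filter_upwards [hP.valid_round] with x hx
    have h1 := hx.1.gft2_mem hp (buyerPrice A ω a.2)
    unfold gft2 at h1
    unfold reward
    constructor <;> linarith [h1.1, h1.2]

lemma UnitSupported.sampling_cost (hP : UnitSupported P) {a : ℕ × ℕ} (ha : a ∈ grid A)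
    (hζ : 0 ≤ A.ζ) :
    Sampling (P.prod unif) (Observes A a) (fun _ ω x => cost A ω x.1 a) 2 where
  measurableSet t := measurableSet_observes A a t
  measurable t := measurable_cost A measurable_fst (measurable_fst.comp measurable_snd) a
  predictable t ω ω' h hi :=
    ⟨hi.congr A h, funext fun x => cost_congr hi.1 h x.1 a⟩
  range t ω _ := by
    have hp := sellerPrice_mem A (i := a.1) (by have := (mem_grid_iff.1 ha).1; omega)
    refine ⟨-1, ?_⟩
    filter_upwards [hP.valid_round] with x hx
    have h1 := hx.1.rev_mem hp (buyerPrice A ω a.2)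
    have h2 : 0 < 1 + A.ζ := by linarith
    unfold cost
    rw [one_div_mul_eq_div]
    constructor
    · rw [le_div_iff₀ h2]; linarith [h1.2]
    · rw [div_le_iff₀ h2]; linarith [h1.1]

/-- The prices posted in round `t` of the elimination phase. -/
noncomputable def elimPrices (A : Params) (t : ℕ) (ω : ℕ → Round n) : ℝ × ℝ :=
  saePrices A ω (t - (stopTime A ω + A.T0))

lemma measurable_elimPrices (t : ℕ) : Measurable fun ω : ℕ → Round n => elimPrices A t ω :=
  measurable_apply_of_countable (g := stopTime A)
    (f := fun m (ω : ℕ → Round n) => saePrices A ω (t - (m + A.T0)))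
    (fun _ => measurable_saePrices A _) (measurableSet_stopTime_eq A)

lemma elimPrices_congr {t : ℕ} (hs : InElim A t ω) (h : AgreeBefore t ω ω') :
    elimPrices A t ω' = elimPrices A t ω := by
  have h1 := elimState_congr hs h
  unfold elimState at h1
  have hb : buyerPrice A ω' = buyerPrice A ω :=
    funext fun j => (buyerPrice_congr A (h.mono ((Nat.le_add_left _ _).trans hs.2)) j).symm
  simp only [elimPrices, saePrices, h1, arm_congr hs h, hb]

variable {A} in
lemma saeState_alive_subset (k : ℕ) : (saeState A ω k).alive ⊆ grid A :=
  (measurableState_saeState A k).alive_subset ω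

variable {A} in
/-- The maximiser is attained on a nonempty set. -/
lemma argmaxOn_spec {ι : Type} [Nonempty ι] {s : Finset ι} (hs : s.Nonempty) (f : ι → EReal) :
    argmaxOn s f ∈ s ∧ ∀ b ∈ s, f b ≤ f (argmaxOn s f) :=
  Classical.epsilon_spec (p := fun a => a ∈ s ∧ ∀ b ∈ s, f b ≤ f a) (s.exists_max_image f hs)

variable {A} in
/-- The arm played by the elimination procedure: it lies on the line of an arm with the largest
upper confidence bound, is a candidate of this line, and has the smallest reserve price among the
candidates. -/
lemma arm_spec {σ : SAEState} (hsub : σ.alive ⊆ grid A) (hne : σ.alive.Nonempty) :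
    (∃ a ∈ σ.alive, a.1 = (σ.arm A ω).1 ∧ ∀ b ∈ σ.alive, σ.rUp A b ≤ σ.rUp A a) ∧
    σ.arm A ω ∈ σ.alive ∧
    (∀ b ∈ σ.alive, b.1 = (σ.arm A ω).1 → σ.rLow A b ≤ σ.rUp A (σ.arm A ω)) ∧
    (∀ j, σ.Candidate A (σ.arm A ω).1 j →
      buyerPrice A ω (σ.arm A ω).2 ≤ buyerPrice A ω j) := by
  classical
  obtain ⟨h1, h2⟩ := argmaxOn_spec hne (σ.rUp A)
  set i := σ.line A with hi
  have hline : (argmaxOn σ.alive (σ.rUp A)).1 = i := rfl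
  -- the arm of the line with the largest lower bound is a candidate
  have hex : ∃ j, σ.Candidate A i j := by
    obtain ⟨b, hb, hmax⟩ := (σ.alive.filter fun b => b.1 = i).exists_max_image (σ.rLow A)
      ⟨_, Finset.mem_filter.2 ⟨h1, hline⟩⟩
    obtain ⟨hb1, hb2⟩ := Finset.mem_filter.1 hb
    refine ⟨b.2, by rw [← hb2]; exact hb1, fun a ha hai => ?_⟩
    refine (hmax a (Finset.mem_filter.2 ⟨ha, hai⟩)).trans ?_
    rw [← hb2]
    unfold SAEState.rLow SAEState.rUp lower upper
    split_ifs
    · exact bot_le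
    · have := Real.sqrt_nonneg (saeLog A / (2 * σ.count b))
      exact EReal.coe_le_coe_iff.2 (by linarith)
  have hex' : ∃ j, σ.Candidate A i j ∧
      ∀ j', σ.Candidate A i j' → buyerPrice A ω j ≤ buyerPrice A ω j' := by
    obtain ⟨j0, hj0⟩ := hex
    have hmem : ∀ j, σ.Candidate A i j → j ∈ Finset.range (2 * A.K + 2) := fun j hj =>
      Finset.mem_range.2 (mem_grid_iff.1 (hsub hj.1)).2
    obtain ⟨j, hj, hmin⟩ := ((Finset.range (2 * A.K + 2)).filter
      fun j => σ.Candidate A i j).exists_min_image (buyerPrice A ω)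
      ⟨j0, Finset.mem_filter.2 ⟨hmem j0 hj0, hj0⟩⟩
    exact ⟨j, (Finset.mem_filter.1 hj).2, fun j' hj' =>
      hmin j' (Finset.mem_filter.2 ⟨hmem j' hj', hj'⟩)⟩
  have hspec := Classical.epsilon_spec hex'
  have harm : σ.arm A ω = (i, Classical.epsilon fun j => σ.Candidate A i j ∧
      ∀ j', σ.Candidate A i j' → buyerPrice A ω j ≤ buyerPrice A ω j') := by
    unfold SAEState.arm
    rw [if_pos hne]
  rw [harm]
  exact ⟨⟨_, h1, hline, h2⟩, hspec.1.1, hspec.1.2, hspec.2⟩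

variable {A} in
lemma arm_mem_grid {σ : SAEState} (hsub : σ.alive ⊆ grid A) : σ.arm A ω ∈ grid A := by
  by_cases hne : σ.alive.Nonempty
  · exact hsub (arm_spec hsub hne).2.1
  · unfold SAEState.arm
    rw [if_neg hne]
    exact mem_grid_iff.2 ⟨by omega, by omega⟩

lemma elimPrices_fst_mem (t : ℕ) : (elimPrices A t ω).1 ∈ Set.Icc (0 : ℝ) 1 := by
  refine sellerPrice_mem A ?_
  have := (mem_grid_iff.1 (arm_mem_grid (ω := ω) (saeState_alive_subset (A := A) (ω := ω)
    (t - (stopTime A ω + A.T0))))).1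
  omega

lemma UnitSupported.sampling_gft (hP : UnitSupported P) :
    Sampling (P.prod unif) (InElim A)
      (fun t ω x => gft (elimPrices A t ω).1 (elimPrices A t ω).2 x.1) 2 where
  measurableSet t := measurableSet_inElim A t
  measurable t := measurable_gft (measurable_fst.comp ((measurable_elimPrices A t).comp
    measurable_fst)) (measurable_snd.comp ((measurable_elimPrices A t).comp measurable_fst))
    (measurable_fst.comp measurable_snd)
  predictable t ω ω' h hi := ⟨(hi.congr h).1, by simp only [elimPrices_congr A hi h]⟩
  range t ω _ := ⟨-1, by
    filter_upwards [hP.valid_round] with x hx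
    have := hx.1.gft_mem (elimPrices A t ω).1 (elimPrices A t ω).2
    constructor <;> linarith [this.1, this.2]⟩

lemma UnitSupported.sampling_rev (hP : UnitSupported P) :
    Sampling (P.prod unif) (InElim A)
      (fun t ω x => rev (elimPrices A t ω).1 (elimPrices A t ω).2 x.1) 2 where
  measurableSet t := measurableSet_inElim A t
  measurable t := measurable_rev (measurable_fst.comp ((measurable_elimPrices A t).comp
    measurable_fst)) (measurable_snd.comp ((measurable_elimPrices A t).comp measurable_fst))
    (measurable_fst.comp measurable_snd)
  predictable t ω ω' h hi := ⟨(hi.congr h).1, by simp only [elimPrices_congr A hi h]⟩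
  range t ω _ := ⟨-1, by
    filter_upwards [hP.valid_round] with x hx
    have := hx.1.rev_mem (elimPrices_fst_mem A (ω := ω) t) (elimPrices A t ω).2
    constructor <;> linarith [this.1, this.2]⟩

/-! ### The statistics of the algorithm as sums over the sampled rounds -/

/-- The counters of UCB are those of the sampling scheme. -/
lemma ucbState_eq_sampling (a : FArm) (k : ℕ) :
    sampleCount (fun t ω => A.T0 ≤ t ∧ (ucbState A ω (t - A.T0)).arm A = a) (A.T0 + k) ω
      = (ucbState A ω k).count a ∧
    ∑ t ∈ Finset.range (A.T0 + k), centred (P.prod unif)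
      (fun t ω => A.T0 ≤ t ∧ (ucbState A ω (t - A.T0)).arm A = a)
      (fun _ ω x => fRev A ω a x.1) t ω
      = (ucbState A ω k).total a - (ucbState A ω k).count a * ∫ v, fRev A ω a v ∂P := by
  classical
  induction k with
  | zero =>
    constructor
    · simp only [sampleCount, ucbState, Pi.zero_apply, Finset.card_eq_zero]
      refine Finset.filter_eq_empty_iff.2 fun t ht h => ?_
      have := Finset.mem_range.1 ht; have := h.1; omega
    · simp only [ucbState, Pi.zero_apply]
      rw [Finset.sum_eq_zero]
      · simp
      · intro t ht
        unfold centred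
        rw [if_neg]
        rintro ⟨h, _⟩
        have := Finset.mem_range.1 ht; omega
  | succ k ih =>
    obtain ⟨ih1, ih2⟩ := ih
    rw [← add_assoc, Finset.sum_range_succ, ih2]
    by_cases h : (ucbState A ω k).arm A = a
    · have hI : A.T0 ≤ A.T0 + k ∧ (ucbState A ω (A.T0 + k - A.T0)).arm A = a :=
        ⟨by omega, by rw [Nat.add_sub_cancel_left]; exact h⟩
      rw [sampleCount_succ_of_mem (I := fun t ω => A.T0 ≤ t ∧
        (ucbState A ω (t - A.T0)).arm A = a) hI, ih1]
      simp only [centred, if_pos hI]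
      rw [integral_round_fst]
      subst h
      simp only [ucbState, Function.update_self, fRev]
      refine ⟨trivial, ?_⟩
      push_cast
      ring
    · have hI : ¬ (A.T0 ≤ A.T0 + k ∧ (ucbState A ω (A.T0 + k - A.T0)).arm A = a) := by
        rw [Nat.add_sub_cancel_left]; exact fun h' => h h'.2
      rw [sampleCount_succ_of_notMem (I := fun t ω => A.T0 ≤ t ∧
        (ucbState A ω (t - A.T0)).arm A = a) hI, ih1]
      simp only [centred, if_neg hI, add_zero]
      simp only [ucbState, Function.update_of_ne (Ne.symm h)]
      exact ⟨trivial, trivial⟩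

variable {A} in
lemma Terminates.started (h : Terminates A ω) {t : ℕ} (ht : stopTime A ω ≤ t) :
    Started A t ω := by
  obtain ⟨k, hk, _⟩ := h
  have h1 : Started A (A.T0 + k) ω := ⟨k, hk, le_rfl⟩
  have h2 := le_stopTime (A := A) (ω := ω)
  exact ⟨_, h1.stopTime_mem, by omega⟩

variable {A} in
lemma Terminates.stopTime_lt (h : Terminates A ω) : stopTime A ω + A.T0 < A.T := by
  obtain ⟨k, hk, hkT⟩ := h
  have h1 : Started A (A.T0 + k) ω := ⟨k, hk, le_rfl⟩
  have := h1.stopTime_le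
  omega

variable {A} in
/-- The counters of the elimination procedure are those of the sampling scheme. -/
lemma saeState_eq_sampling (hT : Terminates A ω) (a : ℕ × ℕ) (k : ℕ) :
    sampleCount (Observes A a) (stopTime A ω + A.T0 + k) ω = (saeState A ω k).count a ∧
    ∑ t ∈ Finset.range (stopTime A ω + A.T0 + k), centred (P.prod unif) (Observes A a)
      (fun _ ω x => reward A ω x.1 a) t ω
      = (saeState A ω k).rewardSum a - (saeState A ω k).count a * ∫ v, reward A ω v a ∂P ∧
    ∑ t ∈ Finset.range (stopTime A ω + A.T0 + k), centred (P.prod unif) (Observes A a)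
      (fun _ ω x => cost A ω x.1 a) t ω
      = (saeState A ω k).costSum a - (saeState A ω k).count a * ∫ v, cost A ω v a ∂P := by
  classical
  induction k with
  | zero =>
    have hno : ∀ t ∈ Finset.range (stopTime A ω + A.T0 + 0), ¬ Observes A a t ω := by
      intro t ht h
      have := Finset.mem_range.1 ht; have := h.1.2; omega
    refine ⟨?_, ?_, ?_⟩
    · simp only [sampleCount, saeState, Pi.zero_apply, Finset.card_eq_zero]
      exact Finset.filter_eq_empty_iff.2 fun {t} ht => hno t ht
    all_goals
      simp only [saeState, Pi.zero_apply]
      rw [Finset.sum_eq_zero]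
      · simp
      · intro t ht
        unfold centred
        rw [if_neg (hno t ht)]
  | succ k ih =>
    obtain ⟨ih1, ih2, ih3⟩ := ih
    have hel : InElim A (stopTime A ω + A.T0 + k) ω := ⟨hT.started (by omega), by omega⟩
    have hst : elimState A (stopTime A ω + A.T0 + k) ω = saeState A ω k := by
      unfold elimState; congr 1; omega
    rw [← add_assoc, Finset.sum_range_succ, ih2, Finset.sum_range_succ, ih3]
    simp only [saeState, SAEState.step_count, SAEState.step_rewardSum, SAEState.step_costSum]
    by_cases h : Observed A ω ((saeState A ω k).arm A ω) a
    · have hI : Observes A a (stopTime A ω + A.T0 + k) ω := ⟨hel, by rw [hst]; exact h⟩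
      rw [sampleCount_succ_of_mem hI, ih1]
      simp only [centred, if_pos hI, if_pos h]
      rw [integral_round_fst (fun v => reward A ω v a), integral_round_fst (fun v => cost A ω v a)]
      refine ⟨trivial, ?_, ?_⟩ <;> push_cast <;> ring
    · have hI : ¬ Observes A a (stopTime A ω + A.T0 + k) ω := fun h' => h (by
        have := h'.2; rwa [hst] at this)
      rw [sampleCount_succ_of_notMem hI, ih1]
      simp only [centred, if_neg hI, if_neg h, add_zero]
      exact ⟨trivial, trivial, trivial⟩

end Predictable

/-! ### The adaptive grid -/

section AdaptiveGrid

variable {A : Params} {x : ℕ → ℝ}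

/-- The next cut is the largest admissible observation. The default value `1` never occurs, since
the smallest observation is always admissible. -/
lemma nextCut_spec (hT0 : 0 < A.T0) (a : ℝ) :
    (∃ t < A.T0, nextCut A x a = x t ∧
      (((Finset.range A.T0).filter fun s => a < x s ∧ x s < x t).card : ℝ) ≤ (A.T0 : ℝ) / A.K) ∧
    ∀ t < A.T0, (((Finset.range A.T0).filter fun s => a < x s ∧ x s < x t).card : ℝ)
      ≤ (A.T0 : ℝ) / A.K → x t ≤ nextCut A x a := by
  set c := ((Finset.range A.T0).image x).filter fun q =>
    (((Finset.range A.T0).filter fun t => a < x t ∧ x t < q).card : ℝ) ≤ (A.T0 : ℝ) / A.K with hc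
  have hne : c.Nonempty := by
    obtain ⟨t, ht, hmin⟩ := (Finset.range A.T0).exists_min_image x
      ⟨0, Finset.mem_range.2 hT0⟩
    refine ⟨x t, Finset.mem_filter.2 ⟨Finset.mem_image_of_mem x ht, ?_⟩⟩
    rw [Finset.filter_eq_empty_iff.2]
    · simp only [Finset.card_empty, Nat.cast_zero]; positivity
    · intro s hs h
      exact absurd h.2 (not_lt.2 (hmin s hs))
  have hval : nextCut A x a = c.max' hne := dif_pos hne
  rw [hval]
  constructor
  · obtain ⟨h1, h2⟩ := Finset.mem_filter.1 (c.max'_mem hne)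
    obtain ⟨t, ht, hxt⟩ := Finset.mem_image.1 h1
    exact ⟨t, Finset.mem_range.1 ht, hxt.symm, by rw [hxt]; exact h2⟩
  · intro t ht h
    exact c.le_max' _ (Finset.mem_filter.2
      ⟨Finset.mem_image_of_mem x (Finset.mem_range.2 ht), h⟩)

/-- As long as observations remain above the next cut, the step to it passes more than `T0 / K`
observations. -/
lemma lt_card_step (hT0 : 0 < A.T0) (k : ℕ) {t₀ : ℕ} (ht₀ : t₀ < A.T0)
    (h : cut A x (k + 1) < x t₀) :
    (A.T0 : ℝ) / A.K <
      ((Finset.range A.T0).filter fun s => cut A x k < x s ∧ x s ≤ cut A x (k + 1)).card := by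
  obtain ⟨t, ht, hmin⟩ :=
    ((Finset.range A.T0).filter fun s => cut A x (k + 1) < x s).exists_min_image
    x ⟨t₀, Finset.mem_filter.2 ⟨Finset.mem_range.2 ht₀, h⟩⟩
  obtain ⟨ht1, ht2⟩ := Finset.mem_filter.1 ht
  by_contra hle
  refine absurd ((nextCut_spec hT0 (cut A x k)).2 t (Finset.mem_range.1 ht1) ?_) (not_le.2 ht2)
  refine le_trans ?_ (not_lt.1 hle)
  refine Nat.cast_le.2 (Finset.card_le_card fun s hs => ?_)
  obtain ⟨hs1, hs2, hs3⟩ := Finset.mem_filter.1 hs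
  refine Finset.mem_filter.2 ⟨hs1, hs2, ?_⟩
  by_contra hgt
  exact absurd (hmin s (Finset.mem_filter.2 ⟨hs1, not_le.1 hgt⟩)) (not_le.2 hs3)

/-- An interval that contains more than `T0 / K` observations contains a point of the adaptive
grid. -/
lemma exists_cut_mem (hT0 : 0 < A.T0) (hK : 0 < A.K) {q y : ℝ} (hq : 0 < q)
    (hcard : (A.T0 : ℝ) / A.K <
      ((Finset.range A.T0).filter fun t => q ≤ x t ∧ x t ≤ y).card) :
    ∃ k ≤ A.K, q ≤ cut A x k ∧ cut A x k ≤ y := by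
  have hK' : (0 : ℝ) < A.K := by exact_mod_cast hK
  have hr : 0 ≤ (A.T0 : ℝ) / A.K := by positivity
  obtain ⟨t₀, ht₀⟩ : ((Finset.range A.T0).filter fun t => q ≤ x t ∧ x t ≤ y).Nonempty := by
    rw [← Finset.card_pos]; exact_mod_cast hr.trans_lt hcard
  obtain ⟨ht0, hqt, _⟩ := Finset.mem_filter.1 ht₀
  -- otherwise each of the `K` steps passes more than `T0 / K` observations, all below `q`
  have hreach : ∃ k ≤ A.K, q ≤ cut A x k := by
    by_contra hno
    push Not at hno
    have hind : ∀ k ≤ A.K, (k : ℝ) * ((A.T0 : ℝ) / A.K)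
        ≤ ((Finset.range A.T0).filter fun s => x s ≤ cut A x k).card := by
      intro k hk
      induction k with
      | zero => simp
      | succ k ih =>
        have hlt := lt_card_step hT0 k (Finset.mem_range.1 ht0) ((hno _ hk).trans_le hqt)
        obtain ⟨s, hs⟩ : ((Finset.range A.T0).filter
            fun s => cut A x k < x s ∧ x s ≤ cut A x (k + 1)).Nonempty := by
          rw [← Finset.card_pos]; exact_mod_cast hr.trans_lt hlt
        obtain ⟨_, hs1, hs2⟩ := Finset.mem_filter.1 hs
        have hdisj : Disjoint ((Finset.range A.T0).filter fun s => x s ≤ cut A x k)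
            ((Finset.range A.T0).filter
              fun s => cut A x k < x s ∧ x s ≤ cut A x (k + 1)) := by
          refine Finset.disjoint_filter.2 fun s _ h1 h2 => absurd h1 (not_le.2 h2.1)
        have hsub : ((Finset.range A.T0).filter fun s => x s ≤ cut A x k) ∪
            ((Finset.range A.T0).filter fun s => cut A x k < x s ∧ x s ≤ cut A x (k + 1))
            ⊆ (Finset.range A.T0).filter fun s => x s ≤ cut A x (k + 1) := by
          refine Finset.union_subset (fun s hs => ?_) (fun s hs => ?_)
          · obtain ⟨h1, h2⟩ := Finset.mem_filter.1 hs
            exact Finset.mem_filter.2 ⟨h1, by linarith⟩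
          · obtain ⟨h1, h2⟩ := Finset.mem_filter.1 hs
            exact Finset.mem_filter.2 ⟨h1, h2.2⟩
        have hc := Finset.card_le_card hsub
        rw [Finset.card_union_of_disjoint hdisj] at hc
        have hc' : ((((Finset.range A.T0).filter fun s => x s ≤ cut A x k).card : ℝ)
          + ((Finset.range A.T0).filter
              fun s => cut A x k < x s ∧ x s ≤ cut A x (k + 1)).card)
          ≤ ((Finset.range A.T0).filter fun s => x s ≤ cut A x (k + 1)).card := by
          exact_mod_cast hc
        have := ih (by omega)
        push_cast
        linarith
    have h1 := hind A.K le_rfl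
    rw [mul_div_cancel₀ _ hK'.ne'] at h1
    have h2 : ((Finset.range A.T0).filter fun s => x s ≤ cut A x A.K).card
        < (Finset.range A.T0).card :=
      Finset.card_lt_card (Finset.filter_ssubset.2
        ⟨t₀, ht0, not_le.2 ((hno _ le_rfl).trans_le hqt)⟩)
    rw [Finset.card_range] at h2
    exact absurd h1 (not_le.2 (by exact_mod_cast h2))
  classical
  -- the first cut above `q` cannot jump over the interval
  have hfind := Nat.find_spec hreach
  have hmin := fun k => Nat.find_min hreach (m := k)
  set k := Nat.find hreach
  refine ⟨k, hfind.1, hfind.2, ?_⟩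
  obtain ⟨m, hm⟩ : ∃ m, k = m + 1 := Nat.exists_eq_succ_of_ne_zero (fun h0 => by
    have := hfind.2; rw [h0] at this; exact absurd this (not_le.2 hq))
  have hmq : cut A x m < q := by
    by_contra h
    exact hmin m (by omega) ⟨by omega, not_lt.1 h⟩
  obtain ⟨t, ht, hcut, hadm⟩ := (nextCut_spec (x := x) hT0 (cut A x m)).1
  by_contra hy
  rw [hm] at hy
  change ¬ nextCut A x (cut A x m) ≤ y at hy
  rw [hcut] at hy
  refine absurd hcard (not_lt.2 (le_trans
    (Nat.cast_le.2 (Finset.card_le_card fun s hs => ?_)) hadm))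
  obtain ⟨h1, h2, h3⟩ := Finset.mem_filter.1 hs
  exact Finset.mem_filter.2 ⟨h1, hmq.trans_le h2, h3.trans_lt (not_le.1 hy)⟩

end AdaptiveGrid

/-! ### Confidence bounds -/

section ConfidenceBounds

/-- Multiplied by the number of samples, a confidence width is the deviation allowed for a sum of
`m` samples. -/
lemma natCast_mul_width {m : ℕ} (hm : 0 < m) (ℓ : ℝ) :
    (m : ℝ) * (2 * √(ℓ / (2 * m))) = √(m * (2 * ℓ)) := by
  have hm' : (0 : ℝ) < m := by exact_mod_cast hm
  have h : (m : ℝ) * (2 * ℓ) = (2 * m) ^ 2 * (ℓ / (2 * m)) := by field_simp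
  rw [h, Real.sqrt_mul (sq_nonneg _), Real.sqrt_sq (by positivity)]
  ring

lemma le_upper_iff {ℓ s y : ℝ} {m : ℕ} :
    (y : EReal) ≤ upper ℓ m s ↔ (0 < m → m * y - s ≤ √(m * (2 * ℓ))) := by
  unfold upper
  split_ifs with h
  · simp [h]
  · have hm : 0 < m := Nat.pos_of_ne_zero h
    have hm' : (0 : ℝ) < m := by exact_mod_cast hm
    rw [EReal.coe_le_coe_iff, ← natCast_mul_width hm]
    simp only [hm, forall_const]
    have e : (m : ℝ) * (s / m + 2 * √(ℓ / (2 * m))) = s + m * (2 * √(ℓ / (2 * m))) := by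
      field_simp
    rw [← mul_le_mul_iff_right₀ hm', e]
    constructor <;> intro h <;> linarith

lemma lower_le_iff {ℓ s y : ℝ} {m : ℕ} :
    lower ℓ m s ≤ (y : EReal) ↔ (0 < m → s - m * y ≤ √(m * (2 * ℓ))) := by
  unfold lower
  split_ifs with h
  · simp [h]
  · have hm : 0 < m := Nat.pos_of_ne_zero h
    have hm' : (0 : ℝ) < m := by exact_mod_cast hm
    rw [EReal.coe_le_coe_iff, ← natCast_mul_width hm]
    simp only [hm, forall_const]
    have e : (m : ℝ) * (s / m - 2 * √(ℓ / (2 * m))) = s - m * (2 * √(ℓ / (2 * m))) := by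
      field_simp
    rw [← mul_le_mul_iff_right₀ hm', e]
    constructor <;> intro h <;> linarith

lemma lower_le_upper_iff {ℓ s s' : ℝ} {m : ℕ} (hm : 0 < m) :
    lower ℓ m s ≤ upper ℓ m s' ↔ s - √(m * (2 * ℓ)) ≤ s' + √(m * (2 * ℓ)) := by
  have hm' : (0 : ℝ) < m := by exact_mod_cast hm
  unfold lower upper
  rw [if_neg hm.ne', if_neg hm.ne', EReal.coe_le_coe_iff, ← natCast_mul_width hm]
  have e : (m : ℝ) * (s / m - 2 * √(ℓ / (2 * m))) = s - m * (2 * √(ℓ / (2 * m))) := by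
    field_simp
  have e' : (m : ℝ) * (s' / m + 2 * √(ℓ / (2 * m))) = s' + m * (2 * √(ℓ / (2 * m))) := by
    field_simp
  rw [← mul_le_mul_iff_right₀ hm', e, e']

/-- The inequality of arithmetic and geometric means with a free weight `y`; summed over the arms it
replaces the Cauchy–Schwarz inequality. -/
lemma sqrt_mul_le_half {a b y : ℝ} (ha : 0 ≤ a) (hb : 0 ≤ b) (hy : 0 < y) :
    √(a * b) ≤ (a / y + b * y) / 2 := by
  rw [Real.sqrt_le_left (by positivity)]
  have : a * b = (a / y) * (b * y) := by field_simp
  rw [this]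
  nlinarith [sq_nonneg (a / y - b * y)]

end ConfidenceBounds

/-! ### Revenue accumulation on a typical sample path -/

section RevenueAccumulation

variable {n : ℕ} {A : Params} {ω : ℕ → Round n}

lemma fRev_mem {v : Val n} (hv : Valid v) (a : FArm) :
    fRev A ω a v ∈ Set.Icc (0 : ℝ) 1 := by
  rcases a with ⟨i, j⟩ | ⟨i, j⟩
  · simpa [fRev, fPrices] using hv.rev_add_mem (p := sellerPrice A i)
      (by unfold sellerPrice; positivity) (inv_two_pow_mem j).1
  · simpa [fRev, fPrices] using
      rev_max_sub_mem (v := v) (buyerPrice A ω i) (inv_two_pow_mem j).1 (inv_two_pow_mem j).2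

lemma ucb_arm_mem (hF : (fSet A).Nonempty) (σ : UCBState) : σ.arm A ∈ fSet A :=
  (argmaxOn_spec hF _).1

lemma ucbState_succ_total (k : ℕ) : (ucbState A ω (k + 1)).total
    = Function.update (ucbState A ω k).total ((ucbState A ω k).arm A)
      ((ucbState A ω k).total ((ucbState A ω k).arm A)
        + fRev A ω ((ucbState A ω k).arm A) (ω (A.T0 + k)).1) := rfl

lemma ucbState_succ_count (k : ℕ) : (ucbState A ω (k + 1)).count
    = Function.update (ucbState A ω k).count ((ucbState A ω k).arm A)
      ((ucbState A ω k).count ((ucbState A ω k).arm A) + 1) := rfl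

lemma cumRev_succ (k : ℕ) : cumRev A ω (k + 1)
    = cumRev A ω k + fRev A ω ((ucbState A ω k).arm A) (ω (A.T0 + k)).1 :=
  Finset.sum_range_succ _ _

lemma sum_total_eq_cumRev (hF : (fSet A).Nonempty) (k : ℕ) :
    ∑ a ∈ fSet A, (ucbState A ω k).total a = cumRev A ω k := by
  induction k with
  | zero => simp [ucbState, cumRev]
  | succ k ih =>
    rw [cumRev_succ, ← ih, ucbState_succ_total,
      Finset.sum_update_of_mem (ucb_arm_mem hF _),
      ← Finset.add_sum_erase _ _ (ucb_arm_mem hF (ucbState A ω k)), Finset.sdiff_singleton_eq_erase]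
    ring

lemma sum_count_eq (hF : (fSet A).Nonempty) (k : ℕ) :
    ∑ a ∈ fSet A, (ucbState A ω k).count a = k := by
  induction k with
  | zero => simp [ucbState]
  | succ k ih =>
    rw [ucbState_succ_count, Finset.sum_update_of_mem (ucb_arm_mem hF _)]
    conv_rhs => rw [← ih]
    rw [← Finset.add_sum_erase _ _ (ucb_arm_mem hF (ucbState A ω k)),
      Finset.sdiff_singleton_eq_erase]
    ring

/-- UCB collects almost the revenue of the best mechanism. Only the optimism of the index of the
comparator `a₀` is needed: the index of the arm played is then at least `ρ`, and this index
bounds the revenue collected by that arm from below. -/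
lemma le_cumRev (hω : ∀ t, Valid (ω t).1) {ρ : ℝ} (hρ : ρ ∈ Set.Icc (0 : ℝ) 1) {a₀ : FArm}
    (ha₀ : a₀ ∈ fSet A) {N : ℕ} {L y : ℝ} (hL : L = Real.log (2 * (fSet A).card * A.T / A.δ))
    (hL0 : 0 ≤ L) (hy : 0 < y)
    (hdev : ∀ k ≤ N, 0 < (ucbState A ω k).count a₀ →
      (ucbState A ω k).count a₀ * ρ - (ucbState A ω k).total a₀
        ≤ √((ucbState A ω k).count a₀ * (2 * L))) :
    ρ * N - (fSet A).card - (N / y + (fSet A).card * (2 * L * y)) / 2 ≤ cumRev A ω N := by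
  have hF : (fSet A).Nonempty := ⟨a₀, ha₀⟩
  -- the bound for an arm is preserved by its own plays, and `m` plays count as `m - 1` since the
  -- index was above `ρ` before the last of them
  have hinv : ∀ k ≤ N, ∀ a, 0 ≤ (ucbState A ω k).total a ∧
      ρ * ((ucbState A ω k).count a - 1) - √((ucbState A ω k).count a * (2 * L))
        ≤ (ucbState A ω k).total a := by
    intro k hk
    induction k with
    | zero => intro a; simp [ucbState, hρ.1]
    | succ k ih =>
      intro a
      rw [ucbState_succ_total, ucbState_succ_count]
      by_cases ha : a = (ucbState A ω k).arm A
      · subst ha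
        set a := (ucbState A ω k).arm A with hadef
        simp only [Function.update_self]
        have hr := fRev_mem (A := A) (ω := ω) (hω (A.T0 + k)) a
        have h0 := (ih (by omega) a).1
        refine ⟨add_nonneg h0 hr.1, ?_⟩
        set m := (ucbState A ω k).count a with hm
        push_cast
        have hidx : (ρ : EReal) ≤ upper L m ((ucbState A ω k).total a) := by
          refine le_trans (le_upper_iff.2 (hdev k (by omega))) ?_
          rw [hL]
          exact (argmaxOn_spec hF fun a => upper (Real.log (2 * (fSet A).card * A.T / A.δ))
            ((ucbState A ω k).count a) ((ucbState A ω k).total a)).2 a₀ ha₀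
        rcases Nat.eq_zero_or_pos m with hm0 | hm0
        · rw [hm0]
          have := Real.sqrt_nonneg ((((0 : ℕ) : ℝ) + 1) * (2 * L))
          push_cast at this ⊢
          linarith [hr.1]
        · have h1 := le_upper_iff.1 hidx hm0
          have h2 : √((m : ℝ) * (2 * L)) ≤ √(((m : ℝ) + 1) * (2 * L)) :=
            Real.sqrt_le_sqrt (by nlinarith)
          linarith [hr.1]
      · rw [Function.update_of_ne ha, Function.update_of_ne ha]
        exact ih (by omega) a
  have hsum := Finset.sum_le_sum fun a (_ : a ∈ fSet A) => (hinv N le_rfl a).2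
  rw [sum_total_eq_cumRev hF] at hsum
  refine le_trans ?_ hsum
  have hcnt : (∑ a ∈ fSet A, ((ucbState A ω N).count a : ℝ)) = N := by
    exact_mod_cast sum_count_eq hF N
  have hsq : ∑ a ∈ fSet A, √((ucbState A ω N).count a * (2 * L))
      ≤ ∑ a ∈ fSet A, (((ucbState A ω N).count a : ℝ) / y + (2 * L) * y) / 2 :=
    Finset.sum_le_sum fun a _ => sqrt_mul_le_half (Nat.cast_nonneg _) (by linarith) hy
  have h1 : ∑ a ∈ fSet A, (((ucbState A ω N).count a : ℝ) / y + (2 * L) * y) / 2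
      = (N / y + (fSet A).card * (2 * L * y)) / 2 := by
    rw [← Finset.sum_div, Finset.sum_add_distrib, ← Finset.sum_div, hcnt]
    simp
  have h2 : ∑ a ∈ fSet A, ρ * (((ucbState A ω N).count a : ℝ) - 1)
      = ρ * N - ρ * (fSet A).card := by
    rw [← Finset.mul_sum, Finset.sum_sub_distrib, hcnt]
    simp [mul_sub]
  rw [Finset.sum_sub_distrib, h2]
  have h3 : ρ * (fSet A).card ≤ (fSet A).card :=
    mul_le_of_le_one_left (Nat.cast_nonneg _) hρ.2
  linarith

end RevenueAccumulation

/-! ### Elimination on a typical sample path -/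

section Elimination

variable {n : ℕ} {A : Params} {ω : ℕ → Round n}

variable (A ω) in
/-- The arm played in the `k`-th round of the elimination procedure. -/
noncomputable def elimArm (k : ℕ) : ℕ × ℕ := (saeState A ω k).arm A ω

variable (A ω) in
/-- How often line `i` was played in the first `k` rounds of the elimination procedure. -/
noncomputable def lineCount (k i : ℕ) : ℕ :=
  ((Finset.range k).filter fun l => (elimArm A ω l).1 = i).card

lemma lineCount_succ (k i : ℕ) : lineCount A ω (k + 1) i
    = if (elimArm A ω k).1 = i then lineCount A ω k i + 1 else lineCount A ω k i := by
  unfold lineCount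
  rw [Finset.range_add_one, Finset.filter_insert]
  split_ifs with h
  · rw [Finset.card_insert_of_notMem (by simp)]
  · rfl

lemma elimArm_mem_grid (k : ℕ) : elimArm A ω k ∈ grid A := arm_mem_grid (saeState_alive_subset k)

lemma sum_lineCount (k : ℕ) : ∑ i ∈ Finset.range (A.K + 1), lineCount A ω k i = k := by
  unfold lineCount
  rw [← Finset.card_eq_sum_card_fiberwise (f := fun l => (elimArm A ω l).1)]
  · simp
  · intro l _
    simpa using (mem_grid_iff.1 (elimArm_mem_grid (ω := ω) (A := A) l)).1

/-- Per-round losses that are bounded by increments of a potential `φ` of the number of plays of the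
line telescope along each line. -/
lemma sum_le_sum_lineCount {g : ℕ → ℝ} {φ : ℕ → ℝ} (hφ : φ 0 = 0) (N : ℕ)
    (hg : ∀ k < N, g k ≤ φ (lineCount A ω k (elimArm A ω k).1 + 1)
      - φ (lineCount A ω k (elimArm A ω k).1)) :
    ∑ k ∈ Finset.range N, g k ≤ ∑ i ∈ Finset.range (A.K + 1), φ (lineCount A ω N i) := by
  induction N with
  | zero => simp [lineCount, hφ]
  | succ N ih =>
    rw [Finset.sum_range_succ]
    have h1 := ih fun k hk => hg k (by omega)
    have h2 := hg N (by omega)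
    have h3 : ∑ i ∈ Finset.range (A.K + 1), φ (lineCount A ω (N + 1) i)
        = ∑ i ∈ Finset.range (A.K + 1), (φ (lineCount A ω N i) +
          if (elimArm A ω N).1 = i then φ (lineCount A ω N (elimArm A ω N).1 + 1)
            - φ (lineCount A ω N (elimArm A ω N).1) else 0) := by
      refine Finset.sum_congr rfl fun i _ => ?_
      rw [lineCount_succ]
      split_ifs with h
      · rw [h]; ring
      · ring
    rw [h3, Finset.sum_add_distrib, Finset.sum_ite_eq, if_pos (Finset.mem_range.2
      (mem_grid_iff.1 (elimArm_mem_grid (ω := ω) (A := A) N)).1)]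
    linarith

/-- Losses of order `1 / √m` at the `m`-th play of a line sum to order `√(K N)`. -/
lemma sum_le_of_line_bound {g : ℕ → ℝ} {D c y : ℝ} (hD : 0 ≤ D) (hc : 0 ≤ c) (hy : 0 < y) (N : ℕ)
    (h0 : ∀ k < N, lineCount A ω k (elimArm A ω k).1 = 0 → g k ≤ D)
    (h1 : ∀ k < N, 0 < lineCount A ω k (elimArm A ω k).1 →
      lineCount A ω k (elimArm A ω k).1 * g k ≤ c * √(lineCount A ω k (elimArm A ω k).1)) :
    ∑ k ∈ Finset.range N, g k ≤ (A.K + 1) * D + 3 * c * ((N / y + (A.K + 1) * y) / 2) := by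
  set φ : ℕ → ℝ := fun m => (if m = 0 then 0 else D) + 3 * c * √m with hφ
  refine (sum_le_sum_lineCount (A := A) (ω := ω) (φ := φ) (by simp [hφ]) N fun k hk => ?_).trans ?_
  · rcases Nat.eq_zero_or_pos (lineCount A ω k (elimArm A ω k).1) with hm | hm
    · have := h0 k hk hm
      rw [hm]
      simp only [hφ, zero_add, if_true, if_neg one_ne_zero, Nat.cast_zero, Real.sqrt_zero,
        Nat.cast_one, Real.sqrt_one]
      linarith
    · have h2 := h1 k hk hm
      set m := lineCount A ω k (elimArm A ω k).1
      have hm' : (0 : ℝ) < m := by exact_mod_cast hm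
      have hm1 : (1 : ℝ) ≤ m := by exact_mod_cast hm
      have hs0 : 0 < √(m : ℝ) := Real.sqrt_pos.2 hm'
      have hsq : √(m : ℝ) * √(m : ℝ) = m := Real.mul_self_sqrt hm'.le
      have ht : √((m : ℝ) + 1) * √((m : ℝ) + 1) = m + 1 := Real.mul_self_sqrt (by linarith)
      have hst : √((m : ℝ) + 1) ≤ 2 * √(m : ℝ) := by
        rw [Real.sqrt_le_left (by positivity), mul_pow, Real.sq_sqrt hm'.le]; linarith
      have hle : √(m : ℝ) ≤ √((m : ℝ) + 1) := Real.sqrt_le_sqrt (by linarith)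
      -- `1 / √m` is at most an increment of the potential: `1 ≤ 3 √m (√(m+1) - √m)`
      have hinc : 1 ≤ 3 * (√(m : ℝ) * (√((m : ℝ) + 1) - √(m : ℝ))) := by nlinarith
      have hg : √(m : ℝ) * g k ≤ c := by
        have : √(m : ℝ) * (√(m : ℝ) * g k) ≤ √(m : ℝ) * c := by
          rw [← mul_assoc, hsq, mul_comm _ c]; exact h2
        exact le_of_mul_le_mul_left this hs0
      have hfin : √(m : ℝ) * g k
          ≤ √(m : ℝ) * (3 * c * (√((m : ℝ) + 1) - √(m : ℝ))) := by nlinarith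
      have := le_of_mul_le_mul_left hfin hs0
      simp only [hφ, if_neg hm.ne', if_neg (Nat.succ_ne_zero m), Nat.cast_succ]
      linarith
  · have hb : ∀ i ∈ Finset.range (A.K + 1), φ (lineCount A ω N i)
        ≤ D + 3 * c * ((lineCount A ω N i / y + y) / 2) := by
      intro i _
      have h2 := sqrt_mul_le_half (Nat.cast_nonneg (α := ℝ) (lineCount A ω N i)) zero_le_one hy
      rw [mul_one, one_mul] at h2
      have h3 : (if lineCount A ω N i = 0 then 0 else D) ≤ D := by split_ifs <;> linarith
      have h4 : 3 * c * √(lineCount A ω N i : ℝ) ≤ 3 * c * ((lineCount A ω N i / y + y) / 2) := by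
        gcongr
      simp only [hφ]
      linarith
    refine (Finset.sum_le_sum hb).trans (le_of_eq ?_)
    have hcnt : ∑ i ∈ Finset.range (A.K + 1), (lineCount A ω N i : ℝ) = N := by
      exact_mod_cast sum_lineCount (ω := ω) (A := A) N
    rw [Finset.sum_add_distrib, ← Finset.mul_sum, ← Finset.sum_div, Finset.sum_add_distrib,
      ← Finset.sum_div, hcnt]
    simp

/-- All surviving arms of a line have been observed at every play of the line. -/
lemma count_eq_lineCount {k : ℕ} {b : ℕ × ℕ} (hb : b ∈ (saeState A ω k).alive) :
    (saeState A ω k).count b = lineCount A ω k b.1 := by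
  induction k with
  | zero => simp [saeState, lineCount]
  | succ k ih =>
    rw [saeState, SAEState.mem_step_alive] at hb
    have hg := saeState_alive_subset k hb.1
    rw [lineCount_succ, saeState, SAEState.step_count, ← ih hb.1]
    by_cases h : (elimArm A ω k).1 = b.1
    · rw [if_pos h, if_pos ⟨hg, h.symm, (hb.2 h.symm).1⟩]
    · rw [if_neg h, if_neg fun h' => h h'.2.1.symm]

/-- Surviving arms have passed the last cost test. -/
lemma cLow_le_zero {k : ℕ} {b : ℕ × ℕ} (hb : b ∈ (saeState A ω k).alive) :
    (saeState A ω k).cLow A b ≤ 0 := by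
  induction k with
  | zero => simp [saeState, SAEState.cLow, lower]
  | succ k ih =>
    have hb0 := hb
    rw [saeState, SAEState.mem_step_alive] at hb
    by_cases h : b.1 = (elimArm A ω k).1
    · exact (hb.2 h).2
    · have := ih hb.1
      unfold SAEState.cLow at this ⊢
      rw [saeState, SAEState.step_count, SAEState.step_costSum, if_neg fun h' => h h'.2.1,
        if_neg fun h' => h h'.2.1]
      exact this

variable {N : ℕ} {mr mc : ℕ × ℕ → ℝ} {a₀ : ℕ × ℕ}

/-- The line of a comparator `a₀` with nonpositive mean cost always keeps an arm that is at least
as good. An arm is eliminated by a play of a larger reserve price only when another arm of the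
line, with a still larger reserve price, has a larger reward; by the precedence property `hmono`
its cost is then no larger. -/
lemma exists_good_alive (ha₀ : a₀ ∈ grid A) (hc₀ : mc a₀ ≤ 0)
    (hmono : ∀ b ∈ grid A, ∀ b' ∈ grid A, b.1 = a₀.1 → b'.1 = a₀.1 →
      buyerPrice A ω b.2 ≤ buyerPrice A ω b'.2 → mr b < mr b' → mc b' ≤ mc b)
    (hR : ∀ k ≤ N, ∀ a ∈ grid A, 0 < (saeState A ω k).count a →
      |(saeState A ω k).rewardSum a - (saeState A ω k).count a * mr a|
        ≤ √((saeState A ω k).count a * (2 * saeLog A)))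
    (hC : ∀ k ≤ N, ∀ a ∈ grid A, a.1 = a₀.1 → 0 < (saeState A ω k).count a →
      (saeState A ω k).costSum a - (saeState A ω k).count a * mc a
        ≤ √((saeState A ω k).count a * (2 * saeLog A))) :
    ∀ k ≤ N, ∃ b ∈ (saeState A ω k).alive, b.1 = a₀.1 ∧ mr a₀ ≤ mr b ∧ mc b ≤ 0 := by
  intro k hk
  induction k with
  | zero => exact ⟨a₀, ha₀, rfl, le_rfl, hc₀⟩
  | succ k ih =>
    obtain ⟨b, hb, hb1, hbr, hbc⟩ := ih (by omega)
    have hsub := saeState_alive_subset (A := A) (ω := ω) k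
    -- an arm of the line with nonpositive mean cost passes the cost test
    have hkeep : ∀ b' ∈ (saeState A ω k).alive, b'.1 = a₀.1 → mc b' ≤ 0 →
        (b'.1 = (elimArm A ω k).1 →
          buyerPrice A ω (elimArm A ω k).2 ≤ buyerPrice A ω b'.2) →
        b' ∈ (saeState A ω (k + 1)).alive := by
      intro b' hb' hb'1 hb'c hpr
      rw [saeState, SAEState.mem_step_alive]
      refine ⟨hb', fun h => ⟨hpr h, ?_⟩⟩
      have hcost := hC (k + 1) hk b' (hsub hb') hb'1
      rw [saeState] at hcost
      refine lower_le_iff.2 fun hpos => ?_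
      have := hcost hpos
      have h2 := mul_nonpos_of_nonneg_of_nonpos (Nat.cast_nonneg (α := ℝ)
        ((saeState A ω k).step A ω (ω (stopTime A ω + A.T0 + k)).1 |>.count b')) hb'c
      simp only [mul_zero]
      linarith
    by_cases hline : b.1 = (elimArm A ω k).1
    swap
    · exact ⟨b, hkeep b hb hb1 hbc fun h => absurd h hline, hb1, hbr, hbc⟩
    by_cases hprice : buyerPrice A ω (elimArm A ω k).2 ≤ buyerPrice A ω b.2
    · exact ⟨b, hkeep b hb hb1 hbc fun _ => hprice, hb1, hbr, hbc⟩
    -- now `b` is no candidate; take the arm of the line with the largest lower bound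
    have hspec := arm_spec (ω := ω) hsub ⟨b, hb⟩
    change _ ∧ elimArm A ω k ∈ _ ∧ (∀ b ∈ (saeState A ω k).alive, b.1 = (elimArm A ω k).1 → _) ∧
      (∀ j, (saeState A ω k).Candidate A (elimArm A ω k).1 j →
      buyerPrice A ω (elimArm A ω k).2 ≤ buyerPrice A ω j) at hspec
    have hnc : ¬ (saeState A ω k).Candidate A (elimArm A ω k).1 b.2 := fun h =>
      hprice (hspec.2.2.2 _ h)
    obtain ⟨d, hd, hmax⟩ := ((saeState A ω k).alive.filter fun d => d.1 = b.1).exists_max_image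
      ((saeState A ω k).rLow A) ⟨b, Finset.mem_filter.2 ⟨hb, rfl⟩⟩
    obtain ⟨hda, hd1⟩ := Finset.mem_filter.1 hd
    have hcount : ∀ e ∈ (saeState A ω k).alive, e.1 = b.1 →
        (saeState A ω k).count e = (saeState A ω k).count b := fun e he h => by
      rw [count_eq_lineCount he, count_eq_lineCount hb, h]
    have hdcand : (saeState A ω k).Candidate A (elimArm A ω k).1 d.2 := by
      rw [← hline, ← hd1]
      refine ⟨hda, fun e he he1 => ?_⟩
      refine (hmax e (Finset.mem_filter.2 ⟨he, he1.trans hd1⟩)).trans ?_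
      unfold SAEState.rLow SAEState.rUp
      rcases Nat.eq_zero_or_pos ((saeState A ω k).count d) with h0 | h0
      · simp [lower, h0]
      · rw [lower_le_upper_iff h0]
        linarith [Real.sqrt_nonneg ((saeState A ω k).count d * (2 * saeLog A))]
    have hdprice := hspec.2.2.2 _ hdcand
    have hlt : (saeState A ω k).rUp A b < (saeState A ω k).rLow A d := by
      by_contra hge
      refine hnc ?_
      rw [← hline]
      exact ⟨hb, fun e he he1 =>
        (hmax e (Finset.mem_filter.2 ⟨he, he1⟩)).trans (not_lt.1 hge)⟩
    have hm : 0 < (saeState A ω k).count b := by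
      by_contra h0
      have h0 : (saeState A ω k).count b = 0 := by omega
      unfold SAEState.rUp upper at hlt
      rw [if_pos h0] at hlt
      exact absurd hlt not_top_lt
    have hrlt : mr b < mr d := by
      by_contra hge
      refine absurd hlt (not_lt.2 ?_)
      unfold SAEState.rUp SAEState.rLow
      have hcd := hcount d hda hd1
      have h1 := abs_le.1 (hR k (by omega) b (hsub hb) hm)
      have h2 := abs_le.1 (hR k (by omega) d (hsub hda) (by omega))
      rw [hcd] at h2 ⊢
      rw [lower_le_upper_iff hm]
      have h3 : ((saeState A ω k).count b : ℝ) * mr d ≤ (saeState A ω k).count b * mr b :=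
        mul_le_mul_of_nonneg_left (not_lt.1 hge) (Nat.cast_nonneg _)
      linarith [h1.1, h2.2]
    have hd0 : d.1 = a₀.1 := hd1.trans hb1
    have hdc : mc d ≤ 0 := (hmono b (hsub hb) d (hsub hda) hb1 hd0
      ((not_le.1 hprice).le.trans hdprice) hrlt).trans hbc
    exact ⟨d, hkeep d hda hd0 hdc fun _ => hdprice, hd0, hbr.trans hrlt.le, hdc⟩

/-- The arm played is worse than the comparator by at most four confidence widths. -/
lemma reward_gap_le (ha : ∀ k ≤ N, ∃ b ∈ (saeState A ω k).alive, mr a₀ ≤ mr b)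
    (hR : ∀ k ≤ N, ∀ a ∈ grid A, 0 < (saeState A ω k).count a →
      |(saeState A ω k).rewardSum a - (saeState A ω k).count a * mr a|
        ≤ √((saeState A ω k).count a * (2 * saeLog A))) {k : ℕ} (hk : k < N)
    (hpos : 0 < lineCount A ω k (elimArm A ω k).1) :
    lineCount A ω k (elimArm A ω k).1 * (mr a₀ - mr (elimArm A ω k))
      ≤ 4 * √(lineCount A ω k (elimArm A ω k).1 * (2 * saeLog A)) := by
  obtain ⟨b, hb, hbr⟩ := ha k hk.le
  have hsub := saeState_alive_subset (A := A) (ω := ω) k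
  obtain ⟨⟨d, hd, hd1, hmax⟩, harm, hcand, -⟩ := arm_spec (ω := ω) hsub ⟨b, hb⟩
  change d.1 = (elimArm A ω k).1 at hd1
  change elimArm A ω k ∈ _ at harm
  change ∀ b ∈ (saeState A ω k).alive, b.1 = (elimArm A ω k).1 →
    _ ≤ (saeState A ω k).rUp A (elimArm A ω k) at hcand
  have hca := count_eq_lineCount harm
  have hcd := count_eq_lineCount hd
  rw [hd1] at hcd
  set m := lineCount A ω k (elimArm A ω k).1
  have h1 : ((mr a₀ : ℝ) : EReal) ≤ (saeState A ω k).rUp A d := by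
    refine le_trans ?_ (hmax b hb)
    refine le_upper_iff.2 fun h0 => ?_
    have := abs_le.1 (hR k hk.le b (hsub hb) h0)
    have h3 : ((saeState A ω k).count b : ℝ) * mr a₀ ≤ (saeState A ω k).count b * mr b :=
      mul_le_mul_of_nonneg_left hbr (Nat.cast_nonneg _)
    linarith [this.1]
  have h2 := le_upper_iff.1 h1
  rw [hcd] at h2
  have h2 := h2 hpos
  have h3 := hcand d hd hd1
  unfold SAEState.rLow SAEState.rUp at h3
  rw [hca, hcd, lower_le_upper_iff hpos] at h3
  have h4 := abs_le.1 (hR k hk.le _ (hsub harm) (by omega))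
  rw [hca] at h4
  rw [mul_sub]
  linarith [h4.2]

/-- The mean cost of the arm played is at most two confidence widths. -/
lemma cost_le_width
    (hC : ∀ k ≤ N, ∀ a ∈ grid A, 0 < (saeState A ω k).count a →
      (saeState A ω k).count a * mc a - (saeState A ω k).costSum a
        ≤ √((saeState A ω k).count a * (2 * saeLog A))) {k : ℕ} (hk : k < N)
    (hne : (saeState A ω k).alive.Nonempty)
    (hpos : 0 < lineCount A ω k (elimArm A ω k).1) :
    lineCount A ω k (elimArm A ω k).1 * mc (elimArm A ω k)
      ≤ 2 * √(lineCount A ω k (elimArm A ω k).1 * (2 * saeLog A)) := by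
  have hsub := saeState_alive_subset (A := A) (ω := ω) k
  obtain ⟨-, harm, -, -⟩ := arm_spec (ω := ω) hsub hne
  change elimArm A ω k ∈ _ at harm
  have hca := count_eq_lineCount harm
  have h1 := cLow_le_zero harm
  unfold SAEState.cLow at h1
  have h2 := lower_le_iff (y := 0).1 h1 (by omega)
  have h3 := hC k hk.le _ (hsub harm) (by omega)
  rw [hca] at h2 h3
  simp only [mul_zero, sub_zero] at h2
  linarith

end Elimination

/-! ### Decomposition of the horizon into the phases -/

section Phases

variable {n : ℕ} {A : Params} {ω : ℕ → Round n}

lemma Valid.gft_secondBid_nonneg {v : Val n} (hv : Valid v) : 0 ≤ gft (secondBid v) 0 v := by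
  unfold gft
  split_ifs with h
  · linarith [h.1, hv.secondBid_le]
  · exact le_rfl

lemma Valid.rev_secondBid_eq {v : Val n} (hv : Valid v) : rev (secondBid v) 0 v = 0 := by
  unfold rev
  rw [max_eq_right hv.secondBid_nonneg, sub_self, ite_self]

lemma gft_nonneg_of_le {p q : ℝ} {v : Val n} (h : v.2 ≤ p → q ≤ topBid v → v.2 ≤ topBid v) :
    0 ≤ gft p q v := by
  unfold gft
  split_ifs with h'
  · linarith [h h'.1 h'.2]
  · exact le_rfl

/-- A mechanism of `F_K` only executes trades with a gain. -/
lemma Valid.gft_fPrices_nonneg {v : Val n} (hv : Valid v) (a : FArm) :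
    0 ≤ gft (fPrices A ω v a).1 (fPrices A ω v a).2 v := by
  rcases a with ⟨i, j⟩ | ⟨i, j⟩
  · have := (inv_two_pow_mem j).1
    exact gft_nonneg_of_le fun (h1 : v.2 ≤ sellerPrice A i)
      (h2 : sellerPrice A i + 2⁻¹ ^ j ≤ topBid v) => by linarith
  · have := (inv_two_pow_mem j).1
    exact gft_nonneg_of_le fun (h1 : v.2 ≤ max (buyerPrice A ω i) (secondBid v) - 2⁻¹ ^ j)
      (h2 : buyerPrice A ω i ≤ topBid v) => by linarith [max_le h2 hv.secondBid_le]

/-- Before the exploration phase no round loses gain from trade or revenue. -/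
lemma early_round_nonneg (hω : ∀ t, Valid (ω t).1) {t : ℕ}
    (ht : ¬ (Terminates A ω ∧ stopTime A ω ≤ t) ∨ t < A.T0) :
    0 ≤ gft (prices A ω t).1 (prices A ω t).2 (ω t).1 ∧
      0 ≤ rev (prices A ω t).1 (prices A ω t).2 (ω t).1 := by
  unfold prices
  by_cases h0 : t < A.T0
  · rw [if_pos h0]
    exact ⟨(hω t).gft_secondBid_nonneg, (hω t).rev_secondBid_eq.ge⟩
  · rw [if_neg h0, if_neg (ht.resolve_right h0)]
    have h1 : A.T0 + (t - A.T0) = t := by omega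
    unfold ucbPrices
    rw [h1]
    exact ⟨(hω t).gft_fPrices_nonneg _, (fRev_mem (hω t) _).1⟩

lemma totals_nonneg_of_not_terminates (hω : ∀ t, Valid (ω t).1) (hT : ¬ Terminates A ω) :
    0 ≤ totalGFT A ω ∧ 0 ≤ totalRev A ω :=
  ⟨Finset.sum_nonneg fun _ _ => (early_round_nonneg hω (Or.inl fun h => hT h.1)).1,
    Finset.sum_nonneg fun _ _ => (early_round_nonneg hω (Or.inl fun h => hT h.1)).2⟩

lemma prices_elim (hT : Terminates A ω) (k : ℕ) :
    prices A ω (stopTime A ω + A.T0 + k) = saePrices A ω k := by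
  unfold prices
  rw [if_neg (by have := le_stopTime (A := A) (ω := ω); omega), if_pos ⟨hT, by omega⟩,
    if_neg (by omega)]
  congr 1
  omega

lemma prices_explore (hT : Terminates A ω) {t : ℕ}
    (h1 : stopTime A ω ≤ t) (h2 : t < stopTime A ω + A.T0) :
    prices A ω t = ((ω t).2, 0) := by
  unfold prices
  rw [if_neg (by have := le_stopTime (A := A) (ω := ω); omega), if_pos ⟨hT, h1⟩, if_pos h2]

variable (A ω) in
/-- Number of rounds of the elimination phase. -/
noncomputable def elimRounds : ℕ := A.T - (stopTime A ω + A.T0)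

/-- The exploration phase loses at most `T0` of either quantity; the phases before it lose nothing
and earn a revenue of at least `β`. -/
lemma totals_ge_of_terminates (hω : ∀ t, Valid (ω t).1 ∧ (ω t).2 ∈ Set.Icc (0 : ℝ) 1)
    (hT : Terminates A ω) :
    -(A.T0 : ℝ) + ∑ k ∈ Finset.range (elimRounds A ω),
      gft (saePrices A ω k).1 (saePrices A ω k).2 (ω (stopTime A ω + A.T0 + k)).1
      ≤ totalGFT A ω ∧
    A.β - A.T0 + ∑ k ∈ Finset.range (elimRounds A ω),
      rev (saePrices A ω k).1 (saePrices A ω k).2 (ω (stopTime A ω + A.T0 + k)).1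
      ≤ totalRev A ω := by
  have hv : ∀ t, Valid (ω t).1 := fun t => (hω t).1
  have hsplit : A.T = stopTime A ω + A.T0 + elimRounds A ω := by
    have := hT.stopTime_lt; unfold elimRounds; omega
  have hle := le_stopTime (A := A) (ω := ω)
  unfold totalGFT totalRev
  rw [hsplit, Finset.sum_range_add, Finset.sum_range_add, Finset.sum_range_add,
    Finset.sum_range_add]
  simp only [prices_elim hT]
  constructor
  · refine add_le_add_left ?_ _
    have h1 : 0 ≤ ∑ t ∈ Finset.range (stopTime A ω),
        gft (prices A ω t).1 (prices A ω t).2 (ω t).1 :=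
      Finset.sum_nonneg fun t ht => (early_round_nonneg hv
        (Or.inl fun h => absurd h.2 (not_le.2 (Finset.mem_range.1 ht)))).1
    have h2 : ∑ k ∈ Finset.range A.T0, (-1 : ℝ) ≤ ∑ k ∈ Finset.range A.T0,
        gft (prices A ω (stopTime A ω + k)).1 (prices A ω (stopTime A ω + k)).2
          (ω (stopTime A ω + k)).1 :=
      Finset.sum_le_sum fun k _ => ((hv _).gft_mem _ _).1
    simp only [Finset.sum_const, Finset.card_range, nsmul_eq_mul] at h2
    linarith
  · refine add_le_add_left ?_ _
    have h1 : A.β ≤ ∑ t ∈ Finset.range (stopTime A ω),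
        rev (prices A ω t).1 (prices A ω t).2 (ω t).1 := by
      have hs : stopTime A ω = A.T0 + (stopTime A ω - A.T0) := by omega
      have hβ := (hT.started le_rfl).stopTime_mem
      set k := stopTime A ω - A.T0 with hk
      rw [hs, Finset.sum_range_add]
      have h3 : 0 ≤ ∑ t ∈ Finset.range A.T0, rev (prices A ω t).1 (prices A ω t).2 (ω t).1 :=
        Finset.sum_nonneg fun t ht => (early_round_nonneg hv
          (Or.inr (Finset.mem_range.1 ht))).2
      have h4 : cumRev A ω k = ∑ i ∈ Finset.range k,
          rev (prices A ω (A.T0 + i)).1 (prices A ω (A.T0 + i)).2 (ω (A.T0 + i)).1 := by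
        refine Finset.sum_congr rfl fun i hi => ?_
        have hi := Finset.mem_range.1 hi
        have : prices A ω (A.T0 + i) = ucbPrices A ω i := by
          unfold prices
          rw [if_neg (by omega), if_neg (fun h => by have := h.2; omega), Nat.add_sub_cancel_left]
        rw [this]
      linarith
    have h2 : ∑ k ∈ Finset.range A.T0, (-1 : ℝ) ≤ ∑ k ∈ Finset.range A.T0,
        rev (prices A ω (stopTime A ω + k)).1 (prices A ω (stopTime A ω + k)).2
          (ω (stopTime A ω + k)).1 := by
      refine Finset.sum_le_sum fun k hk => ?_
      have hk := Finset.mem_range.1 hk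
      rw [prices_explore hT (by omega) (by omega)]
      exact ((hv _).rev_mem (hω _).2 _).1
    simp only [Finset.sum_const, Finset.card_range, nsmul_eq_mul] at h2
    linarith

lemma abs_totalGFT_le (hω : ∀ t, Valid (ω t).1) : |totalGFT A ω| ≤ A.T := by
  unfold totalGFT
  refine (Finset.abs_sum_le_sum_abs _ _).trans ?_
  refine (Finset.sum_le_sum (g := fun _ => (1 : ℝ)) fun t _ => abs_le.2
    ((hω t).gft_mem _ _)).trans ?_
  simp

/-- Until shortly before the revenue phase ends, the accumulated revenue is below the
threshold. -/
lemma exists_cumRev_lt (hβ : 0 < A.β) (h2 : 2 * A.T0 < A.T) :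
    ∃ k, A.T0 + k ≤ A.T ∧ cumRev A ω k < A.β ∧
      (Terminates A ω → stopTime A ω = A.T0 + k + 1) ∧
      (¬ Terminates A ω → A.T = 2 * A.T0 + k + 1) := by
  by_cases hT : Terminates A ω
  · have hlt := hT.stopTime_lt
    have hmem := (hT.started le_rfl).stopTime_mem
    have hle := le_stopTime (A := A) (ω := ω)
    have hpos : 0 < stopTime A ω - A.T0 := by
      rcases Nat.eq_zero_or_pos (stopTime A ω - A.T0) with h | h
      · rw [h] at hmem
        simp only [cumRev, Finset.range_zero, Finset.sum_empty] at hmem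
        linarith
      · exact h
    refine ⟨stopTime A ω - A.T0 - 1, by omega, ?_, fun _ => by omega, fun h => absurd hT h⟩
    by_contra hge
    have : Started A (stopTime A ω - 1) ω :=
      ⟨stopTime A ω - A.T0 - 1, not_lt.1 hge, by omega⟩
    have := this.stopTime_le
    omega
  · refine ⟨A.T - 2 * A.T0 - 1, by omega, ?_, fun h => absurd h hT, fun _ => by omega⟩
    by_contra hge
    exact hT ⟨_, not_lt.1 hge, by omega⟩

end Phases

/-! ### Probabilities of the deviations -/

section Deviations

variable {n : ℕ} (A : Params) {P : Measure (Val n)} [IsProbabilityMeasure P]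

instance : IsProbabilityMeasure (seqLaw P) := by
  unfold seqLaw
  infer_instance

/-- The reserve price `q` has a neighbour above it in the buyers' grid that skips bids of
probability at most `γ`. -/
def HasGridNeighbour (P : Measure (Val n)) (q γ : ℝ) (ω : ℕ → Round n) : Prop :=
  ∃ j < 2 * A.K + 2, q ≤ buyerPrice A ω j ∧
    P.real {v | q ≤ topBid v ∧ topBid v < buyerPrice A ω j} ≤ γ

/-- If the adaptive grid has no such point, then too few observations fall between `q` and its
quantile. Near the ends of `[0,1]` the uniform grid points `0` and `1` serve as neighbours. -/
lemma prob_not_hasGridNeighbour (hT0 : 0 < A.T0) (hK : 0 < A.K) {q γ ε : ℝ}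
    (hq : q ∈ Set.Icc (0 : ℝ) 1) (hγ : 0 ≤ γ) (hε : 0 ≤ ε) (h : ε + (A.T0 : ℝ) / A.K ≤ A.T0 * γ) :
    (seqLaw P).real {ω | ¬ HasGridNeighbour A P q γ ω} ≤ Real.exp (-2 * ε ^ 2 / A.T0) := by
  classical
  have hK' : (0 : ℝ) < A.K := by exact_mod_cast hK
  have hempty : (∀ ω : ℕ → Round n, HasGridNeighbour A P q γ ω) →
      (seqLaw P).real {ω : ℕ → Round n | ¬ HasGridNeighbour A P q γ ω}
        ≤ Real.exp (-2 * ε ^ 2 / A.T0) := by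
    intro hall
    have : {ω : ℕ → Round n | ¬ HasGridNeighbour A P q γ ω} = ∅ := by
      ext ω; simp [hall ω]
    rw [this, measureReal_empty]
    positivity
  rcases hq.1.eq_or_lt with h0 | h0
  · refine hempty fun ω => ⟨A.K + 1, by omega, ?_⟩
    have hb : buyerPrice A ω (A.K + 1) = 0 := by simp [buyerPrice]
    rw [hb, ← h0]
    refine ⟨le_rfl, ?_⟩
    have : {v : Val n | 0 ≤ topBid v ∧ topBid v < 0} = ∅ := by
      ext v; simp
    rw [this, measureReal_empty]
    exact hγ
  rcases le_or_gt (P.real {v | q ≤ topBid v ∧ topBid v < 1}) γ with h1 | h1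
  · refine hempty fun ω => ⟨2 * A.K + 1, by omega, ?_⟩
    have hb : buyerPrice A ω (2 * A.K + 1) = 1 := by
      unfold buyerPrice
      rw [if_neg (by omega)]
      push_cast
      rw [show (2 * (A.K : ℝ) + 1 - (A.K + 1)) = A.K by ring, div_self hK'.ne']
    rw [hb]
    exact ⟨hq.2, h1⟩
  obtain ⟨y, hy1, hy2⟩ := exists_quantile P q hγ h1
  set S : Set (Val n) := {v | q ≤ topBid v ∧ topBid v ≤ y} with hS
  have hSm : MeasurableSet S := (measurableSet_le measurable_const measurable_topBid).inter
    (measurableSet_le measurable_topBid measurable_const)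
  have hdev := (sampling_grid (P := P) A S hSm).neg.hoeffding one_pos (N := A.T0) hT0
    (fun ω => by
      have h := Finset.card_filter_le (Finset.range A.T0) (fun t => t < A.T0)
      rw [Finset.card_range] at h
      convert h) hε
  simp only [one_pow, mul_one] at hdev
  refine le_trans (measureReal_mono ?_ (measure_ne_top _ _)) hdev
  intro ω hω
  by_contra hsmall
  refine hω ?_
  have hmean : ∫ x : Round n, S.indicator (fun _ => (1 : ℝ)) x.1 ∂(P.prod unif) = P.real S := by
    rw [integral_round_fst (fun v => S.indicator (fun _ => (1 : ℝ)) v),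
      integral_indicator_const _ hSm]
    simp
  have hsum : ∑ t ∈ Finset.range A.T0, centred (P.prod unif) (fun t _ => t < A.T0)
      (fun _ _ x => -S.indicator (fun _ => (1 : ℝ)) x.1) t ω
      = A.T0 * P.real S - ((Finset.range A.T0).filter fun t => (ω t).1 ∈ S).card := by
    have h1 : ∀ t ∈ Finset.range A.T0, centred (P.prod unif) (fun t (_ : ℕ → Round n) => t < A.T0)
        (fun _ _ x => -S.indicator (fun _ => (1 : ℝ)) x.1) t ω
        = P.real S - if (ω t).1 ∈ S then (1 : ℝ) else 0 := by
      intro t ht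
      unfold centred
      rw [if_pos (Finset.mem_range.1 ht), integral_neg, hmean]
      simp only [Set.indicator]
      ring
    rw [Finset.sum_congr rfl h1, Finset.sum_sub_distrib, Finset.sum_const, Finset.card_range,
      nsmul_eq_mul, Finset.sum_boole]
  have hcard : (A.T0 : ℝ) / A.K < ((Finset.range A.T0).filter
      fun t => q ≤ topBid (ω t).1 ∧ topBid (ω t).1 ≤ y).card := by
    have h2 : ∑ t ∈ Finset.range A.T0, centred (P.prod unif) (fun t _ => t < A.T0)
      (fun _ _ x => -S.indicator (fun _ => (1 : ℝ)) x.1) t ω < ε := not_le.1 hsmall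
    rw [hsum] at h2
    have h3 : (A.T0 : ℝ) * γ ≤ A.T0 * P.real S := by gcongr
    have h4 : ((Finset.range A.T0).filter fun t => (ω t).1 ∈ S)
        = (Finset.range A.T0).filter fun t => q ≤ topBid (ω t).1 ∧ topBid (ω t).1 ≤ y :=
      Finset.filter_congr fun t _ => Iff.rfl
    rw [h4] at h2
    linarith
  obtain ⟨k, hk, hk1, hk2⟩ := exists_cut_mem (x := fun t => topBid (ω t).1) hT0 hK h0 hcard
  have hb : buyerPrice A ω k = cut A (fun t => topBid (ω t).1) k := by
    unfold buyerPrice; rw [if_pos hk]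
  refine ⟨k, by omega, by rw [hb]; exact hk1, ?_⟩
  rw [hb]
  refine le_trans (measureReal_mono ?_ (measure_ne_top _ _)) hy1
  exact fun v hv => ⟨hv.1, hv.2.trans_le hk2⟩

/-- The index of UCB stays optimistic for a mechanism of mean revenue `ρ`. -/
def UCBOptimistic (a₀ : FArm) (ρ L : ℝ) (ω : ℕ → Round n) : Prop :=
  ∀ k, A.T0 + k ≤ A.T → 0 < (ucbState A ω k).count a₀ →
    (ucbState A ω k).count a₀ * ρ - (ucbState A ω k).total a₀
      ≤ √((ucbState A ω k).count a₀ * (2 * L))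

lemma UnitSupported.prob_not_ucbOptimistic (hP : UnitSupported P) {a₀ : FArm} (ha₀ : a₀ ∈ fSet A)
    {ρ L : ℝ} (hρ : ∀ ω, ∫ v, fRev A ω a₀ v ∂P = ρ) (hL : 0 ≤ L) :
    (seqLaw P).real {ω | ¬ UCBOptimistic A a₀ ρ L ω} ≤ A.T * Real.exp (-(4 * L)) := by
  have hdev := (hP.sampling_ucb A ha₀).neg.uniform_deviation one_pos A.T (v := 2 * L)
    (by linarith)
  rw [show -2 * (2 * L) / 1 ^ 2 = -(4 * L) by ring] at hdev
  refine le_trans (measureReal_mono ?_ (measure_ne_top _ _)) hdev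
  intro ω hω
  unfold UCBOptimistic at hω
  simp only [Set.mem_ofPred_eq, not_forall, not_le] at hω ⊢
  obtain ⟨k, hk, hpos, hlt⟩ := hω
  obtain ⟨h1, h2⟩ := ucbState_eq_sampling (P := P) (ω := ω) A a₀ k
  refine ⟨A.T0 + k, hk, by rw [h1]; exact hpos, ?_⟩
  rw [h1]
  simp only [centred_neg, Finset.sum_neg_distrib]
  rw [h2, hρ]
  linarith

/-- The optimistic estimate of the first part of the gain from trade is an upper bound that
exceeds it by at most `e`. -/
def ExploreAccurate (P : Measure (Val n)) (e : ℝ) (ω : ℕ → Round n) : Prop :=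
  Terminates A ω → ∀ a ∈ grid A,
    ∫ x, exploreInd A ω a x ∂(P.prod unif) ≤ gft1Bar A ω a ∧
      gft1Bar A ω a ≤ ∫ x, exploreInd A ω a x ∂(P.prod unif) + e

lemma prob_not_exploreAccurate (hT0 : 0 < A.T0) (hL : 0 ≤ Real.log ((grid A).card / A.δ)) :
    (seqLaw P).real {ω | ¬ ExploreAccurate A P
      (4 * √(Real.log ((grid A).card / A.δ) / (2 * A.T0))) ω}
      ≤ 2 * (grid A).card * Real.exp (-(4 * Real.log ((grid A).card / A.δ))) := by
  classical
  set L := Real.log ((grid A).card / A.δ)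
  have hT0' : (0 : ℝ) < A.T0 := by exact_mod_cast hT0
  set ε := √((A.T0 : ℝ) * (2 * L)) with hε
  have hcard : ∀ ω : ℕ → Round n,
      ((Finset.range A.T).filter fun t => InExplore A t ω).card ≤ A.T0 := by
    intro ω
    refine (Finset.card_le_card (t := Finset.Ico (stopTime A ω) (stopTime A ω + A.T0))
      fun t ht => ?_).trans (by simp)
    have := (Finset.mem_filter.1 ht).2
    exact Finset.mem_Ico.2 ⟨this.1.stopTime_le, this.2⟩
  let F : ℕ × ℕ → Set (ℕ → Round n) := fun a =>
    {ω | ε ≤ ∑ t ∈ Finset.range A.T, centred (P.prod unif) (InExplore A)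
      (fun _ ω x => exploreInd A ω a x) t ω} ∪
    {ω | ε ≤ ∑ t ∈ Finset.range A.T, centred (P.prod unif) (InExplore A)
      (fun _ ω x => -exploreInd A ω a x) t ω}
  have hexp : -2 * ε ^ 2 / (A.T0 * 1 ^ 2) = -(4 * L) := by
    rw [hε, Real.sq_sqrt (by positivity)]; field_simp; ring
  have hF : ∀ a, (seqLaw P).real (F a) ≤ 2 * Real.exp (-(4 * L)) := by
    intro a
    have h1 := (sampling_explore (P := P) A a).hoeffding one_pos hT0 hcard (Real.sqrt_nonneg _)
      (ε := ε)
    have h2 := (sampling_explore (P := P) A a).neg.hoeffding one_pos hT0 hcard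
      (Real.sqrt_nonneg _) (ε := ε)
    rw [hexp] at h1 h2
    refine (measureReal_union_le _ _).trans ?_
    exact (add_le_add h1 h2).trans (two_mul _).ge
  have hsub : {ω | ¬ ExploreAccurate A P (4 * √(L / (2 * A.T0))) ω} ⊆ ⋃ a ∈ grid A, F a := by
    intro ω hω
    by_contra hno
    refine hω fun hT a ha => ?_
    simp only [Set.mem_iUnion, not_exists] at hno
    have hna := hno a ha
    simp only [F, Set.mem_union, not_or, Set.mem_ofPred_eq, not_le] at hna
    obtain ⟨h1, h2⟩ := hna
    simp only [centred_neg, Finset.sum_neg_distrib] at h2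
    have hfil : (Finset.range A.T).filter (fun t => InExplore A t ω)
        = Finset.Ico (stopTime A ω) (stopTime A ω + A.T0) := by
      ext t
      rw [Finset.mem_filter, Finset.mem_Ico, Finset.mem_range]
      have := hT.stopTime_lt
      constructor
      · rintro ⟨_, h⟩; exact ⟨h.1.stopTime_le, h.2⟩
      · rintro ⟨ha, hb⟩; exact ⟨by omega, hT.started ha, hb⟩
    have hsum : ∑ t ∈ Finset.range A.T, centred (P.prod unif) (InExplore A)
        (fun _ ω x => exploreInd A ω a x) t ω
        = ∑ t ∈ Finset.Ico (stopTime A ω) (stopTime A ω + A.T0), exploreInd A ω a (ω t)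
          - A.T0 * ∫ x, exploreInd A ω a x ∂(P.prod unif) := by
      unfold centred
      rw [← Finset.sum_filter, hfil, Finset.sum_sub_distrib, Finset.sum_const, Nat.card_Ico,
        Nat.add_sub_cancel_left, nsmul_eq_mul]
    rw [hsum] at h1 h2
    have hbar : gft1Bar A ω a = (1 / (A.T0 : ℝ)) *
        ∑ t ∈ Finset.Ico (stopTime A ω) (stopTime A ω + A.T0), exploreInd A ω a (ω t)
          + 2 * √(L / (2 * A.T0)) := rfl
    have hw : (A.T0 : ℝ) * (2 * √(L / (2 * A.T0))) = ε := natCast_mul_width hT0 L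
    set s := ∑ t ∈ Finset.Ico (stopTime A ω) (stopTime A ω + A.T0), exploreInd A ω a (ω t)
    set G := ∫ x, exploreInd A ω a x ∂(P.prod unif)
    have hmul : (A.T0 : ℝ) * gft1Bar A ω a = s + ε := by
      rw [hbar, mul_add, hw, ← mul_assoc, mul_one_div_cancel hT0'.ne', one_mul]
    constructor
    · refine le_of_mul_le_mul_left ?_ hT0'
      rw [hmul]; linarith
    · refine le_of_mul_le_mul_left ?_ hT0'
      rw [hmul]; linarith
  calc _ ≤ (seqLaw P).real (⋃ a ∈ grid A, F a) := measureReal_mono hsub (measure_ne_top _ _)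
    _ ≤ ∑ a ∈ grid A, (seqLaw P).real (F a) := measureReal_biUnion_finset_le _ _
    _ ≤ ∑ a ∈ grid A, 2 * Real.exp (-(4 * L)) := Finset.sum_le_sum fun a _ => hF a
    _ = _ := by rw [Finset.sum_const, nsmul_eq_mul]; ring

/-- The confidence intervals of the mean rewards are valid throughout the elimination phase. -/
def RewardAccurate (P : Measure (Val n)) (ω : ℕ → Round n) : Prop :=
  Terminates A ω → ∀ k ≤ elimRounds A ω, ∀ a ∈ grid A, 0 < (saeState A ω k).count a →
    |(saeState A ω k).rewardSum a - (saeState A ω k).count a * ∫ v, reward A ω v a ∂P|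
      ≤ √((saeState A ω k).count a * (2 * saeLog A))

lemma add_le_horizon {ω : ℕ → Round n} (hT : Terminates A ω) {k : ℕ} (hk : k ≤ elimRounds A ω) :
    stopTime A ω + A.T0 + k ≤ A.T := by
  have := hT.stopTime_lt
  unfold elimRounds at hk
  omega

lemma UnitSupported.prob_not_rewardAccurate (hP : UnitSupported P) (hL : 0 ≤ saeLog A) :
    (seqLaw P).real {ω | ¬ RewardAccurate A P ω}
      ≤ 2 * (grid A).card * A.T * Real.exp (-(4 * saeLog A)) := by
  classical
  set L := saeLog A
  let F : ℕ × ℕ → Set (ℕ → Round n) := fun a =>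
    {ω | ∃ t ≤ A.T, 0 < sampleCount (Observes A a) t ω ∧
      √(sampleCount (Observes A a) t ω * (2 * L)) ≤ ∑ s ∈ Finset.range t,
        centred (P.prod unif) (Observes A a) (fun _ ω x => reward A ω x.1 a) s ω} ∪
    {ω | ∃ t ≤ A.T, 0 < sampleCount (Observes A a) t ω ∧
      √(sampleCount (Observes A a) t ω * (2 * L)) ≤ ∑ s ∈ Finset.range t,
        centred (P.prod unif) (Observes A a) (fun _ ω x => -reward A ω x.1 a) s ω}
  have hF : ∀ a ∈ grid A, (seqLaw P).real (F a) ≤ 2 * (A.T * Real.exp (-(4 * L))) := by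
    intro a ha
    have h1 := (hP.sampling_reward A ha).uniform_deviation one_pos A.T (v := 2 * L) (by linarith)
    have h2 := (hP.sampling_reward A ha).neg.uniform_deviation one_pos A.T (v := 2 * L)
      (by linarith)
    rw [show -2 * (2 * L) / 1 ^ 2 = -(4 * L) by ring] at h1 h2
    refine (measureReal_union_le _ _).trans ?_
    exact (add_le_add h1 h2).trans (two_mul _).ge
  have hsub : {ω | ¬ RewardAccurate A P ω} ⊆ ⋃ a ∈ grid A, F a := by
    intro ω hω
    by_contra hno
    refine hω fun hT k hk a ha hpos => ?_
    simp only [Set.mem_iUnion, not_exists] at hno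
    have hna := hno a ha
    simp only [F, Set.mem_union, not_or, Set.mem_ofPred_eq, not_exists, not_and, not_le] at hna
    obtain ⟨h1, h2⟩ := hna
    obtain ⟨e1, e2, -⟩ := saeState_eq_sampling (P := P) hT a k
    have h1 := h1 _ (add_le_horizon A hT hk) (by rw [e1]; exact hpos)
    have h2 := h2 _ (add_le_horizon A hT hk) (by rw [e1]; exact hpos)
    simp only [centred_neg, Finset.sum_neg_distrib] at h2
    rw [e1, e2] at h1 h2
    exact abs_le.2 ⟨by linarith, h1.le⟩
  calc _ ≤ (seqLaw P).real (⋃ a ∈ grid A, F a) := measureReal_mono hsub (measure_ne_top _ _)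
    _ ≤ ∑ a ∈ grid A, (seqLaw P).real (F a) := measureReal_biUnion_finset_le _ _
    _ ≤ ∑ a ∈ grid A, 2 * (A.T * Real.exp (-(4 * L))) := Finset.sum_le_sum hF
    _ = _ := by rw [Finset.sum_const, nsmul_eq_mul]; ring

/-- No arm of line `i` accumulates much more cost than expected. -/
def CostNotHigh (P : Measure (Val n)) (i : ℕ) (ω : ℕ → Round n) : Prop :=
  Terminates A ω → ∀ k ≤ elimRounds A ω, ∀ a ∈ grid A, a.1 = i → 0 < (saeState A ω k).count a →
    (saeState A ω k).costSum a - (saeState A ω k).count a * ∫ v, cost A ω v a ∂P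
      ≤ √((saeState A ω k).count a * (2 * saeLog A))

/-- No arm accumulates much less cost than expected. -/
def CostNotLow (P : Measure (Val n)) (ω : ℕ → Round n) : Prop :=
  Terminates A ω → ∀ k ≤ elimRounds A ω, ∀ a ∈ grid A, 0 < (saeState A ω k).count a →
    (saeState A ω k).count a * ∫ v, cost A ω v a ∂P - (saeState A ω k).costSum a
      ≤ √((saeState A ω k).count a * (2 * saeLog A))

/-- The union bound runs over a single line only, which gains the factor `1 / (K + 1)` that the
bound on the expected regret needs. -/
lemma UnitSupported.prob_not_costNotHigh (hP : UnitSupported P) (hL : 0 ≤ saeLog A)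
    (hζ : 0 ≤ A.ζ) (i : ℕ) :
    (seqLaw P).real {ω | ¬ CostNotHigh A P i ω}
      ≤ (2 * A.K + 2) * A.T * Real.exp (-saeLog A) := by
  classical
  set L := saeLog A
  let F : ℕ × ℕ → Set (ℕ → Round n) := fun a =>
    {ω | ∃ t ≤ A.T, 0 < sampleCount (Observes A a) t ω ∧
      √(sampleCount (Observes A a) t ω * (2 * L)) ≤ ∑ s ∈ Finset.range t,
        centred (P.prod unif) (Observes A a) (fun _ ω x => cost A ω x.1 a) s ω}
  have hF : ∀ a ∈ grid A, (seqLaw P).real (F a) ≤ A.T * Real.exp (-L) := by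
    intro a ha
    have h1 := (hP.sampling_cost A ha hζ).uniform_deviation two_pos A.T (v := 2 * L) (by linarith)
    rwa [show -2 * (2 * L) / 2 ^ 2 = -L by ring] at h1
  have hsub : {ω | ¬ CostNotHigh A P i ω} ⊆ ⋃ a ∈ (grid A).filter (fun a => a.1 = i), F a := by
    intro ω hω
    by_contra hno
    refine hω fun hT k hk a ha hai hpos => ?_
    simp only [Set.mem_iUnion, not_exists] at hno
    have hna := hno a (Finset.mem_filter.2 ⟨ha, hai⟩)
    simp only [F, Set.mem_ofPred_eq, not_exists, not_and, not_le] at hna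
    obtain ⟨e1, -, e2⟩ := saeState_eq_sampling (P := P) hT a k
    have h1 := hna _ (add_le_horizon A hT hk) (by rw [e1]; exact hpos)
    rw [e1, e2] at h1
    exact h1.le
  have hcard : (((grid A).filter fun a => a.1 = i).card : ℝ) ≤ 2 * A.K + 2 := by
    have : ((grid A).filter fun a => a.1 = i).card ≤ 2 * A.K + 2 := by
      refine (Finset.card_le_card_of_injOn (t := Finset.range (2 * A.K + 2)) (fun a => a.2)
        (fun a ha => ?_) (fun a ha b hb hab => ?_)).trans (by simp)
      · exact Finset.mem_coe.2 (Finset.mem_range.2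
          (mem_grid_iff.1 (Finset.mem_filter.1 (Finset.mem_coe.1 ha)).1).2)
      · exact Prod.ext ((Finset.mem_filter.1 (Finset.mem_coe.1 ha)).2.trans
          (Finset.mem_filter.1 (Finset.mem_coe.1 hb)).2.symm) hab
    exact_mod_cast this
  calc _ ≤ (seqLaw P).real (⋃ a ∈ (grid A).filter (fun a => a.1 = i), F a) :=
        measureReal_mono hsub (measure_ne_top _ _)
    _ ≤ ∑ a ∈ (grid A).filter (fun a => a.1 = i), (seqLaw P).real (F a) :=
        measureReal_biUnion_finset_le _ _
    _ ≤ ∑ a ∈ (grid A).filter (fun a => a.1 = i), A.T * Real.exp (-L) :=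
        Finset.sum_le_sum fun a ha => hF a (Finset.mem_filter.1 ha).1
    _ = ((grid A).filter fun a => a.1 = i).card * (A.T * Real.exp (-L)) := by
        rw [Finset.sum_const, nsmul_eq_mul]
    _ ≤ (2 * A.K + 2) * (A.T * Real.exp (-L)) := by gcongr
    _ = _ := by ring

lemma UnitSupported.prob_not_costNotLow (hP : UnitSupported P) (hL : 0 ≤ saeLog A)
    (hζ : 0 ≤ A.ζ) :
    (seqLaw P).real {ω | ¬ CostNotLow A P ω}
      ≤ (grid A).card * A.T * Real.exp (-saeLog A) := by
  classical
  set L := saeLog A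
  let F : ℕ × ℕ → Set (ℕ → Round n) := fun a =>
    {ω | ∃ t ≤ A.T, 0 < sampleCount (Observes A a) t ω ∧
      √(sampleCount (Observes A a) t ω * (2 * L)) ≤ ∑ s ∈ Finset.range t,
        centred (P.prod unif) (Observes A a) (fun _ ω x => -cost A ω x.1 a) s ω}
  have hF : ∀ a ∈ grid A, (seqLaw P).real (F a) ≤ A.T * Real.exp (-L) := by
    intro a ha
    have h1 := (hP.sampling_cost A ha hζ).neg.uniform_deviation two_pos A.T (v := 2 * L)
      (by linarith)
    rwa [show -2 * (2 * L) / 2 ^ 2 = -L by ring] at h1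
  have hsub : {ω | ¬ CostNotLow A P ω} ⊆ ⋃ a ∈ grid A, F a := by
    intro ω hω
    by_contra hno
    refine hω fun hT k hk a ha hpos => ?_
    simp only [Set.mem_iUnion, not_exists] at hno
    have hna := hno a ha
    simp only [F, Set.mem_ofPred_eq, not_exists, not_and, not_le] at hna
    obtain ⟨e1, -, e2⟩ := saeState_eq_sampling (P := P) hT a k
    have h1 := hna _ (add_le_horizon A hT hk) (by rw [e1]; exact hpos)
    simp only [centred_neg, Finset.sum_neg_distrib] at h1
    rw [e1, e2] at h1
    linarith
  calc _ ≤ (seqLaw P).real (⋃ a ∈ grid A, F a) := measureReal_mono hsub (measure_ne_top _ _)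
    _ ≤ ∑ a ∈ grid A, (seqLaw P).real (F a) := measureReal_biUnion_finset_le _ _
    _ ≤ ∑ a ∈ grid A, A.T * Real.exp (-L) := Finset.sum_le_sum hF
    _ = _ := by rw [Finset.sum_const, nsmul_eq_mul]; ring

/-- The sum of the centred records over the elimination phase. -/
lemma sum_centred_elim {ω : ℕ → Round n} (hT : Terminates A ω) (g : ℝ → ℝ → Val n → ℝ) :
    ∑ t ∈ Finset.range A.T, centred (P.prod unif) (InElim A)
      (fun t ω x => g (elimPrices A t ω).1 (elimPrices A t ω).2 x.1) t ω
      = ∑ k ∈ Finset.range (elimRounds A ω),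
        g (saePrices A ω k).1 (saePrices A ω k).2 (ω (stopTime A ω + A.T0 + k)).1
        - ∑ k ∈ Finset.range (elimRounds A ω),
          ∫ v, g (saePrices A ω k).1 (saePrices A ω k).2 v ∂P := by
  classical
  have hfil : (Finset.range A.T).filter (fun t => InElim A t ω)
      = Finset.Ico (stopTime A ω + A.T0) A.T := by
    ext t
    rw [Finset.mem_filter, Finset.mem_Ico, Finset.mem_range]
    constructor
    · rintro ⟨h1, h⟩; exact ⟨h.2, h1⟩
    · rintro ⟨ha, hb⟩; exact ⟨hb, hT.started (by omega), ha⟩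
  unfold centred
  rw [← Finset.sum_filter, hfil, Finset.sum_Ico_eq_sum_range, ← Finset.sum_sub_distrib]
  refine Finset.sum_congr rfl fun k _ => ?_
  have : elimPrices A (stopTime A ω + A.T0 + k) ω = saePrices A ω k := by
    unfold elimPrices; congr 1; omega
  simp only [this]
  rw [integral_round_fst (fun v => g (saePrices A ω k).1 (saePrices A ω k).2 v)]

/-- The gain from trade of the elimination phase is not much smaller than expected. -/
def GFTNotLow (P : Measure (Val n)) (ε : ℝ) (ω : ℕ → Round n) : Prop :=
  Terminates A ω → ∑ k ∈ Finset.range (elimRounds A ω),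
      expGFT P (saePrices A ω k).1 (saePrices A ω k).2 - ε
    ≤ ∑ k ∈ Finset.range (elimRounds A ω),
      gft (saePrices A ω k).1 (saePrices A ω k).2 (ω (stopTime A ω + A.T0 + k)).1

/-- The revenue of the elimination phase is not much smaller than expected. -/
def RevNotLow (P : Measure (Val n)) (ε : ℝ) (ω : ℕ → Round n) : Prop :=
  Terminates A ω → ∑ k ∈ Finset.range (elimRounds A ω),
      expRev P (saePrices A ω k).1 (saePrices A ω k).2 - ε
    ≤ ∑ k ∈ Finset.range (elimRounds A ω),
      rev (saePrices A ω k).1 (saePrices A ω k).2 (ω (stopTime A ω + A.T0 + k)).1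

lemma UnitSupported.prob_not_gftNotLow (hP : UnitSupported P) (hT : 0 < A.T) {ε : ℝ}
    (hε : 0 ≤ ε) :
    (seqLaw P).real {ω | ¬ GFTNotLow A P ε ω} ≤ Real.exp (-2 * ε ^ 2 / (A.T * 2 ^ 2)) := by
  have hdev := (hP.sampling_gft A).neg.hoeffding two_pos (N := A.T) hT
    (fun ω => by
      classical exact (Finset.card_filter_le _ _).trans (by simp)) hε
  refine le_trans (measureReal_mono ?_ (measure_ne_top _ _)) hdev
  intro ω hω
  by_contra hno
  refine hω fun hT => ?_
  simp only [Set.mem_ofPred_eq, centred_neg, Finset.sum_neg_distrib, not_le,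
    sum_centred_elim A hT gft] at hno
  unfold expGFT
  linarith

lemma UnitSupported.prob_not_revNotLow (hP : UnitSupported P) (hT : 0 < A.T) {ε : ℝ}
    (hε : 0 ≤ ε) :
    (seqLaw P).real {ω | ¬ RevNotLow A P ε ω} ≤ Real.exp (-2 * ε ^ 2 / (A.T * 2 ^ 2)) := by
  have hdev := (hP.sampling_rev A).neg.hoeffding two_pos (N := A.T) hT
    (fun ω => by
      classical exact (Finset.card_filter_le _ _).trans (by simp)) hε
  refine le_trans (measureReal_mono ?_ (measure_ne_top _ _)) hdev
  intro ω hω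
  by_contra hno
  refine hω fun hT => ?_
  simp only [Set.mem_ofPred_eq, centred_neg, Finset.sum_neg_distrib, not_le,
    sum_centred_elim A hT rev] at hno
  unfold expRev
  linarith

end Deviations

/-! ### Expected losses of the phases on a typical sample path -/

section ElimMean

variable {n : ℕ} {A : Params} {ω : ℕ → Round n} {P : Measure (Val n)} [IsProbabilityMeasure P]

/-- Expected gain from trade of the arm `a`. -/
noncomputable def armGFT (A : Params) (P : Measure (Val n)) (ω : ℕ → Round n) (a : ℕ × ℕ) : ℝ :=
  expGFT P (sellerPrice A a.1) (buyerPrice A ω a.2)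

/-- Expected revenue of the arm `a`. -/
noncomputable def armRev (A : Params) (P : Measure (Val n)) (ω : ℕ → Round n) (a : ℕ × ℕ) : ℝ :=
  expRev P (sellerPrice A a.1) (buyerPrice A ω a.2)

lemma sellerPrice_mem_of_mem_grid {a : ℕ × ℕ} (ha : a ∈ grid A) :
    sellerPrice A a.1 ∈ Set.Icc (0 : ℝ) 1 :=
  sellerPrice_mem A (by have := (mem_grid_iff.1 ha).1; omega)

lemma UnitSupported.integral_reward (hP : UnitSupported P) {a : ℕ × ℕ} (ha : a ∈ grid A) :
    ∫ v, reward A ω v a ∂P = (1 / 2) * (gft1Bar A ω a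
      + ∫ v, gft2 (sellerPrice A a.1) (buyerPrice A ω a.2) v ∂P) := by
  have h : ∀ v, reward A ω v a = (1 / 2) * (gft1Bar A ω a
      + gft2 (sellerPrice A a.1) (buyerPrice A ω a.2) v) := fun v => by
    unfold reward gft2
    simp only [and_comm]
  simp only [h]
  rw [integral_const_mul, integral_add (integrable_const _)
    (hP.integrable_gft2 (sellerPrice_mem_of_mem_grid ha) _)]
  simp

lemma UnitSupported.integral_cost (hP : UnitSupported P) {a : ℕ × ℕ} (ha : a ∈ grid A) :
    ∫ v, cost A ω v a ∂P = (1 / (1 + A.ζ)) * (-armRev A P ω a - A.ζ) := by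
  unfold cost armRev expRev
  have h := hP.integrable_rev (sellerPrice_mem_of_mem_grid ha) (buyerPrice A ω a.2)
  rw [integral_const_mul, integral_sub h.fun_neg (integrable_const _), integral_neg]
  simp

/-- The optimistic estimate of the first part of the gain from trade decreases in the reserve
price. -/
lemma gft1Bar_anti {b b' : ℕ × ℕ} (h1 : b.1 = b'.1)
    (h2 : buyerPrice A ω b.2 ≤ buyerPrice A ω b'.2) : gft1Bar A ω b' ≤ gft1Bar A ω b := by
  unfold gft1Bar
  rw [h1]
  gcongr with t ht
  split_ifs with h h'
  · exact le_rfl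
  · exact absurd ⟨h.1, h2.trans h.2⟩ h'
  · exact zero_le_one
  · exact le_rfl

/-- Precedence: along a line, an arm with a larger reserve price and a larger mean reward has no
larger mean cost. -/
lemma UnitSupported.integral_cost_le_of_reward_lt (hP : UnitSupported P) (hζ : 0 ≤ A.ζ)
    {b b' : ℕ × ℕ} (hb : b ∈ grid A) (hb' : b' ∈ grid A) (h1 : b.1 = b'.1)
    (h2 : buyerPrice A ω b.2 ≤ buyerPrice A ω b'.2)
    (h3 : ∫ v, reward A ω v b ∂P < ∫ v, reward A ω v b' ∂P) :
    ∫ v, cost A ω v b' ∂P ≤ ∫ v, cost A ω v b ∂P := by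
  rw [hP.integral_reward hb, hP.integral_reward hb'] at h3
  rw [hP.integral_cost hb, hP.integral_cost hb']
  have h4 := gft1Bar_anti h1 h2
  have h5 := hP.expRev_sub_ge (sellerPrice_mem_of_mem_grid hb') h2
  unfold armRev
  rw [h1] at h3 ⊢
  have : 0 ≤ 1 / (1 + A.ζ) := by positivity
  refine mul_le_mul_of_nonneg_left ?_ this
  linarith

/-- Twice the mean reward is an optimistic estimate of the gain from trade, exact up to `e`. -/
lemma UnitSupported.reward_bounds (hP : UnitSupported P) {e : ℝ} (hT : Terminates A ω)
    (hE : ExploreAccurate A P e ω) {a : ℕ × ℕ} (ha : a ∈ grid A) :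
    armGFT A P ω a ≤ 2 * ∫ v, reward A ω v a ∂P ∧
      2 * ∫ v, reward A ω v a ∂P ≤ armGFT A P ω a + e := by
  have h1 := hE hT a ha
  have h2 : ∫ x, exploreInd A ω a x ∂(P.prod unif)
      + ∫ v, gft2 (sellerPrice A a.1) (buyerPrice A ω a.2) v ∂P = armGFT A P ω a :=
    hP.integral_explore (sellerPrice_mem_of_mem_grid ha) _
  rw [hP.integral_reward ha]
  constructor <;> linarith [h1.1, h1.2]

variable {a₀ : ℕ × ℕ}

lemma UnitSupported.exists_alive (hP : UnitSupported P) (hζ : 0 ≤ A.ζ) (hT : Terminates A ω)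
    (ha₀ : a₀ ∈ grid A) (hrev : -A.ζ ≤ armRev A P ω a₀)
    (hR : RewardAccurate A P ω) (hC : CostNotHigh A P a₀.1 ω) :
    ∀ k ≤ elimRounds A ω, ∃ b ∈ (saeState A ω k).alive,
      ∫ v, reward A ω v a₀ ∂P ≤ ∫ v, reward A ω v b ∂P := by
  intro k hk
  obtain ⟨b, hb, -, hb2, -⟩ := exists_good_alive (N := elimRounds A ω)
    (mr := fun a => ∫ v, reward A ω v a ∂P) (mc := fun a => ∫ v, cost A ω v a ∂P) ha₀
    (by
      rw [hP.integral_cost ha₀]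
      exact mul_nonpos_of_nonneg_of_nonpos (by positivity) (by linarith))
    (fun b hb b' hb' h1 h1' h2 h3 =>
      hP.integral_cost_le_of_reward_lt hζ hb hb' (h1.trans h1'.symm) h2 h3)
    (hR hT) (hC hT) k hk
  exact ⟨b, hb, hb2⟩

lemma sqrt_lineCount_mul (m : ℕ) (L : ℝ) (c : ℝ) : c * √(m * (2 * L)) = c * √(2 * L) * √m := by
  rw [Real.sqrt_mul (Nat.cast_nonneg m)]; ring

/-- Regret of the elimination phase, in expectation over the valuations of each round. -/
lemma UnitSupported.sum_gap_le (hP : UnitSupported P) (hζ : 0 ≤ A.ζ) (hT : Terminates A ω)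
    (ha₀ : a₀ ∈ grid A) (hrev : -A.ζ ≤ armRev A P ω a₀) {e y : ℝ} (he : 0 ≤ e) (hy : 0 < y)
    (hE : ExploreAccurate A P e ω) (hR : RewardAccurate A P ω) (hC : CostNotHigh A P a₀.1 ω) :
    ∑ k ∈ Finset.range (elimRounds A ω), (armGFT A P ω a₀ - e - armGFT A P ω (elimArm A ω k))
      ≤ (A.K + 1) * 2 + 3 * (8 * √(2 * saeLog A))
        * ((elimRounds A ω / y + (A.K + 1) * y) / 2) := by
  have hal := hP.exists_alive hζ hT ha₀ hrev hR hC
  refine sum_le_of_line_bound (A := A) (ω := ω) (by norm_num) (by positivity) hy _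
    (fun k _ _ => ?_) (fun k hk hpos => ?_)
  · have h1 := (hP.expGFT_mem (sellerPrice A a₀.1) (buyerPrice A ω a₀.2)).2
    have h2 := (hP.expGFT_mem (sellerPrice A (elimArm A ω k).1)
      (buyerPrice A ω (elimArm A ω k).2)).1
    unfold armGFT
    linarith
  · have h1 := reward_gap_le hal (hR hT) hk hpos
    rw [sqrt_lineCount_mul] at h1
    have h2 := (hP.reward_bounds hT hE ha₀).1
    have h3 := (hP.reward_bounds hT hE (elimArm_mem_grid (ω := ω) k)).2
    have h4 : (lineCount A ω k (elimArm A ω k).1 : ℝ) *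
        (armGFT A P ω a₀ - e - armGFT A P ω (elimArm A ω k)) ≤
        lineCount A ω k (elimArm A ω k).1 * (2 * (∫ v, reward A ω v a₀ ∂P
          - ∫ v, reward A ω v (elimArm A ω k) ∂P)) := by
      gcongr
      linarith
    linarith

/-- Negative revenue of the elimination phase, in expectation over the valuations of each
round. -/
lemma UnitSupported.sum_neg_rev_le (hP : UnitSupported P) (hζ : 0 ≤ A.ζ) (hT : Terminates A ω)
    (ha₀ : a₀ ∈ grid A) (hrev : -A.ζ ≤ armRev A P ω a₀) {y : ℝ} (hy : 0 < y)
    (hR : RewardAccurate A P ω) (hC : CostNotHigh A P a₀.1 ω) (hC' : CostNotLow A P ω) :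
    ∑ k ∈ Finset.range (elimRounds A ω), (-armRev A P ω (elimArm A ω k) - A.ζ)
      ≤ (A.K + 1) * 1 + 3 * ((1 + A.ζ) * 2 * √(2 * saeLog A))
        * ((elimRounds A ω / y + (A.K + 1) * y) / 2) := by
  have hal := hP.exists_alive hζ hT ha₀ hrev hR hC
  refine sum_le_of_line_bound (A := A) (ω := ω) (by norm_num) (by positivity) hy _
    (fun k _ _ => ?_) (fun k hk hpos => ?_)
  · have h2 := (hP.expRev_mem (sellerPrice_mem_of_mem_grid (elimArm_mem_grid (A := A) (ω := ω) k))
      (buyerPrice A ω (elimArm A ω k).2)).1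
    unfold armRev
    linarith
  · obtain ⟨b, hb, -⟩ := hal k hk.le
    have h1 := cost_le_width (hC' hT) hk ⟨b, hb⟩ hpos
    rw [sqrt_lineCount_mul, hP.integral_cost (elimArm_mem_grid k)] at h1
    have h0 : 0 < 1 + A.ζ := by positivity
    have h2 := mul_le_mul_of_nonneg_left h1 h0.le
    have h3 : (1 + A.ζ) * (lineCount A ω k (elimArm A ω k).1 *
        (1 / (1 + A.ζ) * (-armRev A P ω (elimArm A ω k) - A.ζ)))
        = lineCount A ω k (elimArm A ω k).1 * (-armRev A P ω (elimArm A ω k) - A.ζ) := by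
      field_simp
    rw [h3] at h2
    linarith

end ElimMean

section RevenuePhase

set_option linter.unusedSectionVars false

variable {n : ℕ} {A : Params} {P : Measure (Val n)} [IsProbabilityMeasure P]

/-- Some mechanism of `F_K` with prices on the uniform grids, whose mean revenue `ρ` hence does
not depend on the sample path, has a revenue comparable to the baseline. -/
lemma UnitSupported.exists_revenue_arm (hP : UnitSupported P) (hK : 0 < A.K)
    (hJ : 1 ≤ ⌈Real.logb 2 A.T⌉₊) :
    ∃ a₀ ∈ fSet A, ∃ ρ ∈ Set.Icc (0 : ℝ) 1,
      (∀ ω : ℕ → Round n, ∫ v, fRev A ω a₀ v ∂P = ρ) ∧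
      opt P ≤ 2 * ⌈Real.logb 2 A.T⌉₊ * ρ + 2 * (2⁻¹ ^ ⌈Real.logb 2 A.T⌉₊ + 1 / A.K) := by
  classical
  set J := ⌈Real.logb 2 A.T⌉₊ with hJdef
  let ω₀ : ℕ → Round n := fun _ => 0
  have hconst1 : ∀ i j (ω : ℕ → Round n), ∫ v, fRev A ω (.inl (i, j)) v ∂P
      = ∫ v, rev ((i : ℝ) / A.K) ((i : ℝ) / A.K + 2⁻¹ ^ j) v ∂P := fun i j ω => rfl
  have hbp : ∀ i (ω : ℕ → Round n), buyerPrice A ω (A.K + 1 + i) = (i : ℝ) / A.K := by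
    intro i ω
    unfold buyerPrice
    rw [if_neg (by omega)]
    push_cast
    congr 1
    ring
  have hconst2 : ∀ i j (ω : ℕ → Round n), ∫ v, fRev A ω (.inr (A.K + 1 + i, j)) v ∂P
      = ∫ v, rev (max ((i : ℝ) / A.K) (secondBid v) - 2⁻¹ ^ j) ((i : ℝ) / A.K) v ∂P := by
    intro i j ω
    simp only [fRev, fPrices, hbp]
  let U := (fSet A).filter fun a => ∀ ω : ℕ → Round n,
    ∫ v, fRev A ω a v ∂P = ∫ v, fRev A ω₀ a v ∂P
  have hU1 : ∀ i ≤ A.K, ∀ j ∈ Finset.Icc 1 J, Sum.inl (i, j) ∈ U := by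
    intro i hi j hj
    refine Finset.mem_filter.2 ⟨?_, fun ω => by rw [hconst1, hconst1]⟩
    unfold fSet
    rw [Finset.inl_mem_disjSum, Finset.mem_product]
    exact ⟨Finset.mem_range.2 (Nat.lt_succ_of_le hi), hj⟩
  have hU2 : ∀ i ≤ A.K, ∀ j ∈ Finset.Icc 1 J, Sum.inr (A.K + 1 + i, j) ∈ U := by
    intro i hi j hj
    refine Finset.mem_filter.2 ⟨?_, fun ω => by rw [hconst2, hconst2]⟩
    unfold fSet
    rw [Finset.inr_mem_disjSum, Finset.mem_product]
    exact ⟨Finset.mem_range.2 (by change A.K + 1 + i < _; omega), hj⟩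
  obtain ⟨a₀, ha₀, hmax⟩ := U.exists_max_image (fun a => ∫ v, fRev A ω₀ a v ∂P)
    ⟨_, hU1 0 (Nat.zero_le _) 1 (Finset.mem_Icc.2 ⟨le_rfl, hJ⟩)⟩
  obtain ⟨hF, hc⟩ := Finset.mem_filter.1 ha₀
  refine ⟨a₀, hF, ∫ v, fRev A ω₀ a₀ v ∂P, ⟨?_, ?_⟩, hc, ?_⟩
  · exact integral_nonneg_of_ae (hP.valid.mono fun v hv => (fRev_mem hv a₀).1)
  · have h1 : ∫ v, fRev A ω₀ a₀ v ∂P ≤ ∫ _, (1 : ℝ) ∂P :=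
      integral_mono_of_nonneg (hP.valid.mono fun v hv => (fRev_mem hv a₀).1)
        (integrable_const _) (hP.valid.mono fun v hv => (fRev_mem hv a₀).2)
    simpa using h1
  · refine hP.opt_le_of_rev_le hK (fun i hi j hj => ?_) (fun i hi j hj => ?_)
    · exact hmax _ (hU1 i hi j hj)
    · rw [← hconst2 i j ω₀]
      exact hmax _ (hU2 i hi j hj)

/-- While the accumulated revenue is below the threshold, the baseline is small compared to the
number of rounds. -/
lemma opt_mul_le {ω : ℕ → Round n} (hω : ∀ t, Valid (ω t).1) {a₀ : FArm} (ha₀ : a₀ ∈ fSet A)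
    {ρ L y d : ℝ} (hρ : ρ ∈ Set.Icc (0 : ℝ) 1) {J k : ℕ} (hopt : opt P ≤ 2 * J * ρ + d)
    (hL : L = Real.log (2 * (fSet A).card * A.T / A.δ)) (hL0 : 0 ≤ L) (hy : 0 < y) (hd : 0 ≤ d)
    (hU : UCBOptimistic A a₀ ρ L ω) (hk : A.T0 + k ≤ A.T) (hrev : cumRev A ω k < A.β) :
    opt P * k ≤ 2 * J * (A.β + (fSet A).card
      + (A.T / y + (fSet A).card * (2 * L * y)) / 2) + d * A.T := by
  have h1 := le_cumRev hω hρ ha₀ hL hL0 hy (N := k) fun k' hk' => hU k' (by omega)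
  have hkT : (k : ℝ) ≤ A.T := by exact_mod_cast (by omega : k ≤ A.T)
  have h2 : (k : ℝ) / y ≤ A.T / y := by gcongr
  have h3 : opt P * k ≤ (2 * J * ρ + d) * k := by gcongr
  have h4 : d * k ≤ d * A.T := by gcongr
  have h5 : (2 * J : ℝ) * (ρ * k) ≤ 2 * J * (A.β + (fSet A).card
      + (A.T / y + (fSet A).card * (2 * L * y)) / 2) := by
    gcongr
    linarith
  linarith

end RevenuePhase

/-! ### The inputs of the algorithm and the resulting orders of magnitude -/

section Tuning

/-- The inputs in terms of `r = T ^ (1/3)` and `ℓ = 1 + log (T / δ)`. The shift `ζ` is the loss of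
revenue of the comparator: `(1 + |M|) / r` by rounding the seller price and `2 * ℓ / r` by rounding the
reserve price. The threshold `β` covers the revenue lost in the last two phases. -/
structure Tuned (A : Params) (M r ℓ : ℝ) : Prop where
  one_le_T : 1 ≤ A.T
  δ_pos : 0 < A.δ
  δ_lt : A.δ < 1
  one_le_r : 1 ≤ r
  r_pow : r ^ 3 = A.T
  ℓ_eq : ℓ = 1 + Real.log (A.T / A.δ)
  le_K : r ≤ A.K
  K_le : A.K ≤ 2 * r
  le_T0 : r ^ 2 ≤ A.T0
  T0_le : A.T0 ≤ 2 * r ^ 2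
  β_eq : A.β = 60 * (4 + |M|) * ℓ ^ 2 * r ^ 2
  ζ_eq : A.ζ = (1 + |M| + 2 * ℓ) / r

lemma rpow_two_thirds (T : ℕ) : (T : ℝ) ^ (2 / 3 : ℝ) = ((T : ℝ) ^ (1 / 3 : ℝ)) ^ 2 := by
  rw [← Real.rpow_natCast, ← Real.rpow_mul (Nat.cast_nonneg T)]
  norm_num

lemma tuned_of_eq (M : ℝ) {T : ℕ} {δ : ℝ} (hT : 1 ≤ T) (h0 : 0 < δ) (h1 : δ < 1) {β ζ : ℝ}
    (hβ : β = 60 * (4 + |M|) * (1 + Real.log (T / δ)) ^ 2 * ((T : ℝ) ^ (1 / 3 : ℝ)) ^ 2)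
    (hζ : ζ = (1 + |M| + 2 * (1 + Real.log (T / δ))) / (T : ℝ) ^ (1 / 3 : ℝ)) :
    Tuned { K := ⌈(T : ℝ) ^ (1 / 3 : ℝ)⌉₊, T0 := ⌈(T : ℝ) ^ (2 / 3 : ℝ)⌉₊, T := T, δ := δ,
            β := β, ζ := ζ } M ((T : ℝ) ^ (1 / 3 : ℝ)) (1 + Real.log (T / δ)) := by
  have hT' : (1 : ℝ) ≤ T := by exact_mod_cast hT
  have hr : (1 : ℝ) ≤ (T : ℝ) ^ (1 / 3 : ℝ) := Real.one_le_rpow hT' (by norm_num)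
  have hr2 : (1 : ℝ) ≤ (T : ℝ) ^ (2 / 3 : ℝ) := Real.one_le_rpow hT' (by norm_num)
  have hc1 := (Nat.ceil_lt_add_one (zero_le_one.trans hr)).le
  have hc2 := (Nat.ceil_lt_add_one (zero_le_one.trans hr2)).le
  refine ⟨hT, h0, h1, hr, ?_, rfl, Nat.le_ceil _, by change (⌈_⌉₊ : ℝ) ≤ _; linarith, ?_, ?_,
    hβ, hζ⟩
  · rw [← Real.rpow_natCast, ← Real.rpow_mul (Nat.cast_nonneg T)]
    norm_num
  · rw [← rpow_two_thirds]
    exact Nat.le_ceil _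
  · rw [← rpow_two_thirds]
    change (⌈_⌉₊ : ℝ) ≤ _
    linarith

namespace Tuned

variable {A : Params} {M r ℓ : ℝ}

lemma T_pos (h : Tuned A M r ℓ) : (1 : ℝ) ≤ A.T := by exact_mod_cast h.one_le_T

lemma r_pos (h : Tuned A M r ℓ) : 0 < r := by linarith [h.one_le_r]

lemma one_le_div (h : Tuned A M r ℓ) : 1 ≤ (A.T : ℝ) / A.δ := by
  rw [_root_.one_le_div h.δ_pos]
  linarith [h.T_pos, h.δ_lt]

lemma one_le_ℓ (h : Tuned A M r ℓ) : 1 ≤ ℓ := by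
  rw [h.ℓ_eq]
  linarith [Real.log_nonneg h.one_le_div]

lemma exp_neg_ℓ_le (h : Tuned A M r ℓ) : Real.exp (-ℓ) ≤ A.δ / A.T := by
  have h1 : Real.exp (-ℓ) ≤ Real.exp (-Real.log (A.T / A.δ)) :=
    Real.exp_le_exp.2 (by rw [h.ℓ_eq]; linarith)
  refine h1.trans (le_of_eq ?_)
  rw [Real.exp_neg, Real.exp_log (by linarith [h.one_le_div]), inv_div]

lemma K_pos (h : Tuned A M r ℓ) : 0 < A.K := by
  have : (0 : ℝ) < A.K := h.r_pos.trans_le h.le_K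
  exact_mod_cast this

lemma T0_pos (h : Tuned A M r ℓ) : 0 < A.T0 := by
  have : (0 : ℝ) < A.T0 := (pow_pos h.r_pos 2).trans_le h.le_T0
  exact_mod_cast this

lemma β_pos (h : Tuned A M r ℓ) : 0 < A.β := by
  have h1 := h.r_pos
  have h2 := h.one_le_ℓ
  rw [h.β_eq]
  positivity

lemma ζ_pos (h : Tuned A M r ℓ) : 0 < A.ζ := by
  have h1 := h.r_pos
  have h2 := h.one_le_ℓ
  rw [h.ζ_eq]
  positivity

lemma K_add_one_le (h : Tuned A M r ℓ) : (A.K : ℝ) + 1 ≤ 3 * r := by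
  linarith [h.K_le, h.one_le_r]

lemma log_T_le (h : Tuned A M r ℓ) : Real.log A.T ≤ ℓ - 1 := by
  have h1 : Real.log A.T ≤ Real.log (A.T / A.δ) := by
    refine Real.log_le_log (by linarith [h.T_pos]) ?_
    rw [le_div_iff₀ h.δ_pos]
    have := h.T_pos
    have := h.δ_lt
    nlinarith
  linarith [h.ℓ_eq]

lemma log_r_le (h : Tuned A M r ℓ) : 3 * Real.log r ≤ ℓ - 1 := by
  have h1 : Real.log (r ^ 3) = 3 * Real.log r := by rw [Real.log_pow]; norm_num
  rw [← h1, h.r_pow]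
  exact h.log_T_le

lemma card_grid (A : Params) : ((grid A).card : ℝ) = 2 * ((A.K : ℝ) + 1) ^ 2 := by
  unfold grid
  rw [Finset.card_product, Finset.card_range, Finset.card_range]
  push_cast
  ring

lemma le_card_grid (h : Tuned A M r ℓ) : 2 * r ^ 2 ≤ (grid A).card := by
  rw [card_grid]
  have h1 := h.le_K
  have h2 := h.r_pos
  gcongr
  linarith

lemma card_grid_le (h : Tuned A M r ℓ) : ((grid A).card : ℝ) ≤ 18 * r ^ 2 := by
  rw [card_grid]
  have h1 := h.K_add_one_le
  have h2 := h.r_pos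
  calc (2 : ℝ) * ((A.K : ℝ) + 1) ^ 2 ≤ 2 * (3 * r) ^ 2 := by gcongr
    _ = 18 * r ^ 2 := by ring

lemma card_grid_ge_two (h : Tuned A M r ℓ) : (2 : ℝ) ≤ (grid A).card := by
  nlinarith [h.le_card_grid, h.one_le_r]

lemma log_36_le : Real.log 36 ≤ 4 := by
  rw [Real.log_le_iff_le_exp (by norm_num)]
  have h1 := Real.exp_one_gt_d9
  have h2 : Real.exp 4 = Real.exp 1 ^ 4 := by rw [← Real.exp_nat_mul]; norm_num
  rw [h2]
  calc (36 : ℝ) ≤ 2.7 ^ 4 := by norm_num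
    _ ≤ Real.exp 1 ^ 4 := by gcongr; linarith

lemma saeLog_eq (h : Tuned A M r ℓ) :
    saeLog A = Real.log (2 * (grid A).card) + Real.log (A.T / A.δ) := by
  have := h.card_grid_ge_two
  have := h.one_le_div
  unfold saeLog
  rw [mul_div_assoc, Real.log_mul (by positivity) (by positivity)]

lemma saeLog_nonneg (h : Tuned A M r ℓ) : 0 ≤ saeLog A := by
  rw [h.saeLog_eq]
  exact add_nonneg (Real.log_nonneg (by linarith [h.card_grid_ge_two]))
    (Real.log_nonneg h.one_le_div)

lemma saeLog_le (h : Tuned A M r ℓ) : saeLog A ≤ 7 * ℓ := by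
  rw [h.saeLog_eq]
  have h2 := h.r_pos
  have h1 : Real.log (2 * (grid A).card) ≤ Real.log 36 + 2 * Real.log r := by
    have : Real.log (36 * r ^ 2) = Real.log 36 + 2 * Real.log r := by
      rw [Real.log_mul (by norm_num) (by positivity), Real.log_pow]; norm_num
    rw [← this]
    refine Real.log_le_log (by linarith [h.card_grid_ge_two]) ?_
    linarith [h.card_grid_le]
  linarith [log_36_le, h.log_r_le, h.ℓ_eq, h.one_le_ℓ]

lemma exp_neg_saeLog (h : Tuned A M r ℓ) :
    Real.exp (-saeLog A) = A.δ / (2 * (grid A).card * A.T) := by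
  have := h.card_grid_ge_two
  have := h.T_pos
  have := h.δ_pos
  unfold saeLog
  rw [Real.exp_neg, Real.exp_log (by positivity), inv_div]

lemma sqrt_saeLog_le (h : Tuned A M r ℓ) : √(2 * saeLog A) ≤ 4 * ℓ := by
  have h1 := h.saeLog_le
  have h2 := h.one_le_ℓ
  rw [Real.sqrt_le_left (by linarith)]
  nlinarith

lemma exploreLog_nonneg (h : Tuned A M r ℓ) : 0 ≤ Real.log ((grid A).card / A.δ) := by
  refine Real.log_nonneg ?_
  rw [_root_.one_le_div h.δ_pos]
  linarith [h.card_grid_ge_two, h.δ_lt]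

lemma exploreLog_le (h : Tuned A M r ℓ) : Real.log ((grid A).card / A.δ) ≤ 7 * ℓ := by
  refine le_trans ?_ h.saeLog_le
  unfold saeLog
  have h1 := h.card_grid_ge_two
  have h2 := h.T_pos
  have h3 := h.δ_pos
  refine Real.log_le_log (by positivity) ?_
  gcongr
  nlinarith

lemma exploreWidth_le (h : Tuned A M r ℓ) :
    4 * √(Real.log ((grid A).card / A.δ) / (2 * A.T0)) ≤ 8 * ℓ / r := by
  have h1 := h.exploreLog_le
  have h2 := h.one_le_ℓ
  have h3 := h.r_pos
  have h4 : √(Real.log ((grid A).card / A.δ) / (2 * A.T0)) ≤ 2 * ℓ / r := by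
    rw [Real.sqrt_le_left (by positivity)]
    calc Real.log ((grid A).card / A.δ) / (2 * A.T0) ≤ 7 * ℓ / (2 * r ^ 2) := by
          have := h.le_T0
          gcongr
      _ ≤ (2 * ℓ / r) ^ 2 := by
          rw [div_pow, div_le_div_iff₀ (by positivity) (by positivity)]
          have : 7 * ℓ ≤ 8 * ℓ ^ 2 := by nlinarith
          nlinarith [sq_nonneg r]
  calc _ ≤ 4 * (2 * ℓ / r) := by gcongr
    _ = _ := by ring

lemma one_le_dyadic (h2 : 2 ≤ A.T) : 1 ≤ ⌈Real.logb 2 A.T⌉₊ := by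
  rw [Nat.one_le_ceil_iff]
  exact Real.logb_pos (by norm_num) (by exact_mod_cast h2)

lemma dyadic_le (h : Tuned A M r ℓ) : (⌈Real.logb 2 A.T⌉₊ : ℝ) ≤ 2 * ℓ := by
  have h0 : 0 ≤ Real.logb 2 A.T := Real.logb_nonneg (by norm_num) h.T_pos
  have h1 := (Nat.ceil_lt_add_one h0).le
  have h2 : Real.logb 2 A.T ≤ 2 * (ℓ - 1) := by
    unfold Real.logb
    rw [div_le_iff₀ (Real.log_pos (by norm_num))]
    have := Real.log_two_gt_d9
    nlinarith [h.log_T_le, h.one_le_ℓ]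
  linarith [h.one_le_ℓ]

lemma inv_two_pow_dyadic_le (h : Tuned A M r ℓ) :
    (2⁻¹ : ℝ) ^ ⌈Real.logb 2 A.T⌉₊ ≤ 1 / A.T := by
  have hT := h.T_pos
  have h1 : (A.T : ℝ) ≤ 2 ^ ⌈Real.logb 2 A.T⌉₊ := by
    rw [← Real.rpow_natCast, ← Real.logb_le_iff_le_rpow (by norm_num) (by linarith)]
    exact Nat.le_ceil _
  rw [inv_pow, inv_eq_one_div]
  gcongr

lemma card_fSet (A : Params) :
    ((fSet A).card : ℝ) = 3 * ((A.K : ℝ) + 1) * ⌈Real.logb 2 A.T⌉₊ := by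
  unfold fSet
  rw [Finset.card_disjSum, Finset.card_product, Finset.card_product, Finset.card_range,
    Finset.card_range, Nat.card_Icc]
  push_cast
  ring

lemma card_fSet_le (h : Tuned A M r ℓ) : ((fSet A).card : ℝ) ≤ 18 * r * ℓ := by
  rw [card_fSet]
  have h1 := h.K_add_one_le
  have h2 := h.dyadic_le
  have h3 := h.r_pos
  calc 3 * ((A.K : ℝ) + 1) * ⌈Real.logb 2 A.T⌉₊ ≤ 3 * (3 * r) * (2 * ℓ) := by gcongr
    _ = _ := by ring

lemma one_le_card_fSet (h2 : 2 ≤ A.T) : (1 : ℝ) ≤ (fSet A).card := by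
  rw [card_fSet]
  have h1 : (1 : ℝ) ≤ ⌈Real.logb 2 A.T⌉₊ := by exact_mod_cast one_le_dyadic h2
  have h3 : (0 : ℝ) ≤ A.K := Nat.cast_nonneg _
  nlinarith

lemma ucbLog_eq (h : Tuned A M r ℓ) (h2 : 2 ≤ A.T) :
    Real.log (2 * (fSet A).card * A.T / A.δ)
      = Real.log (2 * (fSet A).card) + Real.log (A.T / A.δ) := by
  have := one_le_card_fSet h2
  have := h.one_le_div
  rw [mul_div_assoc, Real.log_mul (by positivity) (by positivity)]

lemma log_le_ucbLog (h : Tuned A M r ℓ) (h2 : 2 ≤ A.T) :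
    Real.log (A.T / A.δ) ≤ Real.log (2 * (fSet A).card * A.T / A.δ) := by
  rw [h.ucbLog_eq h2]
  linarith [Real.log_nonneg (by linarith [one_le_card_fSet h2] : (1 : ℝ) ≤ 2 * (fSet A).card)]

lemma ucbLog_le (h : Tuned A M r ℓ) (h2 : 2 ≤ A.T) :
    Real.log (2 * (fSet A).card * A.T / A.δ) ≤ 7 * ℓ := by
  rw [h.ucbLog_eq h2]
  have h3 := h.r_pos
  have h4 := h.one_le_ℓ
  have h1 : Real.log (2 * (fSet A).card) ≤ Real.log 36 + Real.log r + Real.log ℓ := by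
    rw [← Real.log_mul (by norm_num) (by positivity), ← Real.log_mul (by positivity)
      (by positivity)]
    refine Real.log_le_log (by linarith [one_le_card_fSet h2]) ?_
    linarith [h.card_fSet_le]
  linarith [log_36_le, h.log_r_le, h.ℓ_eq, Real.log_le_sub_one_of_pos (by linarith : 0 < ℓ)]

/-! ### Bounds on the failure probabilities -/

lemma exp_grid_le (h : Tuned A M r ℓ) :
    Real.exp (-2 * (A.T0 * ℓ / r) ^ 2 / A.T0) ≤ A.δ / A.T := by
  refine le_trans (Real.exp_le_exp.2 ?_) h.exp_neg_ℓ_le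
  have h1 := h.le_T0
  have h2 := h.one_le_ℓ
  have h3 := h.r_pos
  have h4 : (0 : ℝ) < A.T0 := by exact_mod_cast h.T0_pos
  have h5 : -2 * (A.T0 * ℓ / r) ^ 2 / A.T0 = -(2 * ℓ ^ 2 * (A.T0 / r ^ 2)) := by
    field_simp
  have h6 : 1 ≤ A.T0 / r ^ 2 := by rwa [_root_.one_le_div (by positivity)]
  rw [h5]
  have : ℓ * 1 ≤ (2 * ℓ ^ 2) * (A.T0 / r ^ 2) := by
    gcongr
    nlinarith
  linarith

lemma exp_ucb_le (h : Tuned A M r ℓ) (h2 : 2 ≤ A.T) :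
    A.T * Real.exp (-(4 * Real.log (2 * (fSet A).card * A.T / A.δ))) ≤ A.δ / A.T := by
  have h1 := h.log_le_ucbLog h2
  have h0 := Real.log_nonneg h.one_le_div
  have hT := h.T_pos
  have hδ := h.δ_pos
  have h3 : Real.exp (-(4 * Real.log (2 * (fSet A).card * A.T / A.δ)))
      ≤ Real.exp (-Real.log (A.T / A.δ)) * Real.exp (-Real.log (A.T / A.δ)) := by
    rw [← Real.exp_add]
    exact Real.exp_le_exp.2 (by linarith)
  rw [Real.exp_neg (Real.log _), Real.exp_log (by positivity), inv_div] at h3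
  calc A.T * Real.exp (-(4 * Real.log (2 * (fSet A).card * A.T / A.δ)))
      ≤ A.T * (A.δ / A.T * (A.δ / A.T)) := by gcongr
    _ = A.δ * (A.δ / A.T) := by field_simp
    _ ≤ 1 * (A.δ / A.T) := by
        have := h.δ_lt.le
        gcongr
    _ = _ := one_mul _

lemma exp_explore_le (h : Tuned A M r ℓ) :
    2 * (grid A).card * Real.exp (-(4 * Real.log ((grid A).card / A.δ))) ≤ A.δ / A.T := by
  have hB := h.card_grid_ge_two
  have hB' := h.le_card_grid
  have hT := h.T_pos
  have hδ := h.δ_pos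
  have hδ1 := h.δ_lt.le
  have hr := h.r_pos
  set B := ((grid A).card : ℝ)
  have h1 : Real.exp (-(4 * Real.log (B / A.δ))) = (A.δ / B) ^ 4 := by
    rw [← mul_neg, show (4 : ℝ) = ((4 : ℕ) : ℝ) by norm_num, Real.exp_nat_mul, Real.exp_neg,
      Real.exp_log (by positivity), inv_div]
  have hBT : 2 * (A.T : ℝ) ≤ B ^ 3 := by
    rw [← h.r_pow]
    have h5 : (2 * r ^ 2) ^ 3 ≤ B ^ 3 := by gcongr
    have h6 : 1 ≤ r ^ 3 := one_le_pow₀ h.one_le_r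
    nlinarith
  rw [h1]
  have h2 : 2 * B * (A.δ / B) ^ 4 = A.δ ^ 4 * (2 / B ^ 3) := by field_simp
  rw [h2]
  have h3 : A.δ ^ 4 ≤ A.δ := pow_le_of_le_one hδ.le hδ1 (by norm_num)
  have h4 : 2 / B ^ 3 ≤ 1 / A.T := by
    rw [div_le_div_iff₀ (by positivity) (by positivity)]
    linarith
  calc A.δ ^ 4 * (2 / B ^ 3) ≤ A.δ * (1 / A.T) := by gcongr
    _ = _ := by ring

lemma exp_reward_le (h : Tuned A M r ℓ) :
    2 * (grid A).card * A.T * Real.exp (-(4 * saeLog A)) ≤ A.δ / A.T := by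
  have hB := h.card_grid_ge_two
  have hT := h.T_pos
  have hδ := h.δ_pos
  have hδ1 := h.δ_lt.le
  have h1 : Real.exp (-(4 * saeLog A)) = (A.δ / (2 * (grid A).card * A.T)) ^ 4 := by
    rw [← mul_neg, show (4 : ℝ) = ((4 : ℕ) : ℝ) by norm_num, Real.exp_nat_mul,
      h.exp_neg_saeLog]
  rw [h1]
  set B := ((grid A).card : ℝ)
  have hx : A.δ / (2 * B * A.T) ≤ 1 / A.T := by
    rw [div_le_div_iff₀ (by positivity) (by positivity)]
    nlinarith
  have hx1 : A.δ / (2 * B * A.T) ≤ 1 := hx.trans (by rw [div_le_one (by linarith)]; exact hT)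
  have hx0 : 0 < A.δ / (2 * B * A.T) := by positivity
  calc 2 * B * A.T * (A.δ / (2 * B * A.T)) ^ 4
      = A.δ * (A.δ / (2 * B * A.T)) ^ 3 := by field_simp
    _ ≤ A.δ * (A.δ / (2 * B * A.T)) := by
        gcongr
        exact pow_le_of_le_one hx0.le hx1 (by norm_num)
    _ ≤ A.δ * (1 / A.T) := by gcongr
    _ = _ := by ring

lemma exp_costHigh_le (h : Tuned A M r ℓ) :
    (2 * A.K + 2) * A.T * Real.exp (-saeLog A) ≤ A.δ / (2 * r) := by
  have hT := h.T_pos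
  have hδ := h.δ_pos
  have hr := h.r_pos
  rw [h.exp_neg_saeLog, card_grid]
  have hK : (0 : ℝ) ≤ A.K := Nat.cast_nonneg _
  have h1 : (2 * (A.K : ℝ) + 2) * A.T * (A.δ / (2 * (2 * (A.K + 1) ^ 2) * A.T))
      = A.δ / (2 * (A.K + 1)) := by field_simp
  rw [h1]
  have := h.le_K
  gcongr
  linarith

lemma exp_costLow_le (h : Tuned A M r ℓ) :
    (grid A).card * A.T * Real.exp (-saeLog A) ≤ A.δ / 2 := by
  have hB := h.card_grid_ge_two
  have hT := h.T_pos
  rw [h.exp_neg_saeLog]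
  refine le_of_eq ?_
  field_simp

lemma exp_sum_le (h : Tuned A M r ℓ) :
    Real.exp (-2 * (2 * r ^ 2 * ℓ) ^ 2 / (A.T * 2 ^ 2)) ≤ A.δ / A.T := by
  refine le_trans (Real.exp_le_exp.2 ?_) h.exp_neg_ℓ_le
  have h2 := h.one_le_ℓ
  have h3 := h.r_pos
  rw [← h.r_pow]
  have h5 : -2 * (2 * r ^ 2 * ℓ) ^ 2 / (r ^ 3 * 2 ^ 2) = -(2 * r * ℓ ^ 2) := by
    field_simp
  rw [h5]
  have h6 := h.one_le_r
  have h7 : ℓ ≤ ℓ ^ 2 := by nlinarith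
  have h8 : ℓ ^ 2 ≤ r * ℓ ^ 2 := by nlinarith
  nlinarith

end Tuned

end Tuning

/-! ### Regret and revenue on a typical sample path -/

section Typical

variable {n : ℕ} {A : Params} {P : Measure (Val n)} [IsProbabilityMeasure P] {M r ℓ : ℝ}

/-- Fixed prices that nearly attain the baseline and whose seller price lies on the grid. -/
lemma UnitSupported.exists_comparator (hP : UnitSupported P)
    (hD : IndependentSides P ∨ BoundedDensity M P) (h : Tuned A M r ℓ) :
    ∃ i ≤ A.K, ∃ q ∈ Set.Icc (0 : ℝ) 1,
      opt P ≤ expGFT P (sellerPrice A i) q + (2 + |M|) / r ∧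
      -((1 + |M|) / r) ≤ expRev P (sellerPrice A i) q := by
  have hr := h.r_pos
  have hlt : opt P - 1 / r < opt P := by linarith [one_div_pos.2 hr]
  obtain ⟨g, ⟨p, hp, q, hq, hrev, rfl⟩, hg⟩ := exists_lt_of_lt_csSup hP.feasible_nonempty hlt
  obtain ⟨i, hi, h1, h2⟩ := hP.exists_seller_price hD h.K_pos hp hrev
  have h3 : (1 + |M|) / A.K ≤ (1 + |M|) / r := by
    have := h.le_K
    gcongr
  have h4 : (2 + |M|) / r = (1 + |M|) / r + 1 / r := by ring
  refine ⟨i, hi, q, hq, ?_, ?_⟩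
  · unfold sellerPrice; linarith
  · unfold sellerPrice; linarith

/-- Rounding the reserve price of the comparator gives an arm of the grid. -/
lemma UnitSupported.exists_grid_arm (hP : UnitSupported P) {ω : ℕ → Round n} {i : ℕ}
    (hi : i ≤ A.K) {q γ : ℝ} (hN : HasGridNeighbour A P q γ ω) :
    ∃ a₀ ∈ grid A, a₀.1 = i ∧ expGFT P (sellerPrice A i) q - γ ≤ armGFT A P ω a₀ ∧
      expRev P (sellerPrice A i) q - γ ≤ armRev A P ω a₀ := by
  obtain ⟨j, hj, hq, hγ⟩ := hN
  exact ⟨(i, j), mem_grid_iff.2 ⟨by change i < _; omega, hj⟩, rfl, hP.expGFT_reserve hq hγ,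
    hP.expRev_reserve (sellerPrice_mem A hi) hq hγ⟩

/-- The bound on the regret of the revenue phase in terms of `r` and `ℓ`. -/
lemma Tuned.revenue_phase_le (h : Tuned A M r ℓ) (h2 : 2 ≤ A.T) :
    2 * (⌈Real.logb 2 A.T⌉₊ : ℝ) * (A.β + (fSet A).card
      + (A.T / r + (fSet A).card
        * (2 * Real.log (2 * (fSet A).card * A.T / A.δ) * r)) / 2)
      + 2 * (2⁻¹ ^ ⌈Real.logb 2 A.T⌉₊ + 1 / A.K) * A.T ≤ 390 * (4 + |M|) * ℓ ^ 3 * r ^ 2 := by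
  have hr := h.r_pos
  have hr1 := h.one_le_r
  have hℓ := h.one_le_ℓ
  have hT := h.T_pos
  have hF := h.card_fSet_le
  have hL := h.ucbLog_le h2
  have hL0 := (Real.log_nonneg h.one_le_div).trans (h.log_le_ucbLog h2)
  have hJ := h.dyadic_le
  have hM := abs_nonneg M
  have hβ0 := h.β_pos
  set L := Real.log (2 * (fSet A).card * A.T / A.δ)
  have h1 : (fSet A).card * (2 * L * r) ≤ 252 * ℓ ^ 2 * r ^ 2 := by
    calc (fSet A).card * (2 * L * r) ≤ (18 * r * ℓ) * (2 * (7 * ℓ) * r) := by gcongr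
      _ = _ := by ring
  have h3 : (A.T : ℝ) / r = r ^ 2 := by rw [← h.r_pow]; field_simp
  have h4 : 18 * r * ℓ ≤ 18 * ℓ ^ 2 * r ^ 2 := by
    have : r * ℓ * 1 ≤ r * ℓ * (r * ℓ) := by gcongr; nlinarith
    nlinarith
  have h5 : r ^ 2 ≤ ℓ ^ 2 * r ^ 2 := le_mul_of_one_le_left (by positivity) (one_le_pow₀ hℓ)
  have h6 : A.β + (fSet A).card + (A.T / r + (fSet A).card * (2 * L * r)) / 2
      ≤ 60 * (4 + |M|) * ℓ ^ 2 * r ^ 2 + 145 * ℓ ^ 2 * r ^ 2 := by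
    rw [h3, h.β_eq]
    linarith
  have h7 : 2 * (2⁻¹ ^ ⌈Real.logb 2 A.T⌉₊ + 1 / A.K) * A.T ≤ 4 * r ^ 2 := by
    have e1 := h.inv_two_pow_dyadic_le
    have e2 : (1 : ℝ) / A.K ≤ 1 / r := by
      have := h.le_K
      gcongr
    have e3 : 2 * (2⁻¹ ^ ⌈Real.logb 2 A.T⌉₊ + 1 / A.K) * (A.T : ℝ)
        ≤ 2 * (1 / A.T + 1 / r) * A.T := by gcongr
    have e4 : 2 * (1 / (A.T : ℝ) + 1 / r) * A.T = 2 + 2 * (A.T / r) := by field_simp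
    rw [e4, h3] at e3
    nlinarith
  have h8 : r ^ 2 ≤ ℓ ^ 3 * r ^ 2 := le_mul_of_one_le_left (by positivity) (one_le_pow₀ hℓ)
  have h9 : 2 * (⌈Real.logb 2 A.T⌉₊ : ℝ) * (A.β + (fSet A).card
      + (A.T / r + (fSet A).card * (2 * L * r)) / 2)
      ≤ 2 * (2 * ℓ) * (60 * (4 + |M|) * ℓ ^ 2 * r ^ 2 + 145 * ℓ ^ 2 * r ^ 2) := by gcongr
  have h10 : 0 ≤ |M| * (ℓ ^ 3 * r ^ 2) := by positivity
  nlinarith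

/-- The confidence widths of the elimination phase sum to order `T ^ (2/3)`. -/
lemma Tuned.elim_width_le (h : Tuned A M r ℓ) (ω : ℕ → Round n) :
    (elimRounds A ω / r + (A.K + 1) * r) / 2 ≤ 2 * r ^ 2 := by
  have hr := h.r_pos
  have h1 : (elimRounds A ω : ℝ) ≤ A.T := by
    exact_mod_cast Nat.sub_le _ _
  have h2 : (elimRounds A ω : ℝ) / r ≤ r ^ 2 := by
    rw [div_le_iff₀ hr]
    calc _ ≤ _ := h1
      _ = r ^ 2 * r := by rw [← h.r_pow]; ring
  nlinarith [h.K_add_one_le]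

lemma Tuned.elimRounds_mul_le (h : Tuned A M r ℓ) (ω : ℕ → Round n) {x : ℝ} (hx : 0 ≤ x) :
    elimRounds A ω * (x / r) ≤ x * r ^ 2 := by
  have hr := h.r_pos
  have h1 : (elimRounds A ω : ℝ) ≤ A.T := by
    exact_mod_cast Nat.sub_le _ _
  calc elimRounds A ω * (x / r) ≤ A.T * (x / r) := by gcongr
    _ = x * r ^ 2 := by rw [← h.r_pow]; field_simp

/-- The deviation of the exploration estimate allowed on a typical sample path. -/
noncomputable def exploreWidth (A : Params) : ℝ :=
  4 * √(Real.log ((grid A).card / A.δ) / (2 * A.T0))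

/-- The regret on a typical sample path. The rounds up to the end of the revenue phase cost
`Tuned.revenue_phase_le`, the grid estimation and the exploration at most `O(T0)`, and the elimination
phase the sum of its gaps and of the errors of the comparator. -/
lemma UnitSupported.regret_le (hP : UnitSupported P) (h : Tuned A M r ℓ) (hT2 : 2 * A.T0 < A.T)
    {i : ℕ} (hi : i ≤ A.K) {q : ℝ} (hopt : opt P ≤ expGFT P (sellerPrice A i) q + (2 + |M|) / r)
    (hrev : -((1 + |M|) / r) ≤ expRev P (sellerPrice A i) q) {a₁ : FArm} (ha₁ : a₁ ∈ fSet A)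
    {ρ : ℝ} (hρ : ρ ∈ Set.Icc (0 : ℝ) 1)
    (hoptρ : opt P ≤ 2 * ⌈Real.logb 2 A.T⌉₊ * ρ + 2 * (2⁻¹ ^ ⌈Real.logb 2 A.T⌉₊ + 1 / A.K))
    {ω : ℕ → Round n} (hω : ∀ t, Valid (ω t).1 ∧ (ω t).2 ∈ Set.Icc (0 : ℝ) 1)
    (hN : HasGridNeighbour A P q (2 * ℓ / r) ω)
    (hU : UCBOptimistic A a₁ ρ (Real.log (2 * (fSet A).card * A.T / A.δ)) ω)
    (hE : ExploreAccurate A P (exploreWidth A) ω) (hR : RewardAccurate A P ω)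
    (hC : CostNotHigh A P i ω) (hG : GFTNotLow A P (2 * r ^ 2 * ℓ) ω) :
    A.T * opt P - totalGFT A ω ≤ 450 * (4 + |M|) * ℓ ^ 3 * r ^ 2 := by
  have hT0 := h.T0_pos
  have h2 : 2 ≤ A.T := by omega
  have hr := h.r_pos
  have hr1 := h.one_le_r
  have hℓ := h.one_le_ℓ
  have hM := abs_nonneg M
  have hL0 := (Real.log_nonneg h.one_le_div).trans (h.log_le_ucbLog h2)
  have ho0 := hP.opt_nonneg
  have ho1 := hP.opt_le_one
  have hT0le := h.T0_le
  obtain ⟨k, hk, hkβ, hterm, hnterm⟩ := exists_cumRev_lt (ω := ω) h.β_pos hT2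
  have hB := (opt_mul_le (fun t => (hω t).1) ha₁ hρ hoptρ rfl hL0 hr (by positivity) hU hk
    hkβ).trans (h.revenue_phase_le h2)
  have hp1 : 1 ≤ r ^ 2 := one_le_pow₀ hr1
  have hp2 : r ^ 2 ≤ ℓ ^ 3 * r ^ 2 := le_mul_of_one_le_left (by positivity) (one_le_pow₀ hℓ)
  have hp3 : ℓ * r ^ 2 ≤ ℓ ^ 3 * r ^ 2 := by
    gcongr
    exact le_self_pow₀ hℓ (by norm_num)
  have hp4 : |M| * r ^ 2 ≤ |M| * (ℓ ^ 3 * r ^ 2) := by gcongr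
  have hp5 : 0 ≤ |M| * (ℓ ^ 3 * r ^ 2) := by positivity
  by_cases hTerm : Terminates A ω
  · obtain ⟨a₀, ha₀, ha₀i, hG₀, hR₀⟩ := hP.exists_grid_arm hi hN
    have hζ : A.ζ = (1 + |M|) / r + 2 * ℓ / r := by rw [h.ζ_eq]; ring
    have hsum := hP.sum_gap_le h.ζ_pos.le hTerm ha₀ (by linarith)
      (by unfold exploreWidth; positivity) hr hE hR
      (ha₀i ▸ hC)
    have htot := (totals_ge_of_terminates hω hTerm).1
    have hGk := hG hTerm
    set N := elimRounds A ω with hNdef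
    have hsplit : (A.T : ℝ) = 2 * A.T0 + k + 1 + N := by
      have e1 := hterm hTerm
      have e2 := hTerm.stopTime_lt
      have e3 : A.T = 2 * A.T0 + k + 1 + N := by rw [hNdef]; unfold elimRounds; omega
      exact_mod_cast e3
    have hN1 : N * opt P ≤ N * (armGFT A P ω a₀ - exploreWidth A)
        + (2 + |M| + 2 * ℓ + 8 * ℓ) * r ^ 2 := by
      have e1 : opt P ≤ armGFT A P ω a₀ - exploreWidth A + (2 + |M| + 2 * ℓ + 8 * ℓ) / r := by
        have e2 : exploreWidth A ≤ 8 * ℓ / r := h.exploreWidth_le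
        have e3 : (2 + |M| + 2 * ℓ + 8 * ℓ) / r = (2 + |M|) / r + 2 * ℓ / r + 8 * ℓ / r := by
          ring
        linarith
      have e4 := mul_le_mul_of_nonneg_left e1 (Nat.cast_nonneg (α := ℝ) N)
      rw [mul_add] at e4
      linarith [h.elimRounds_mul_le ω (x := 2 + |M| + 2 * ℓ + 8 * ℓ) (by positivity)]
    have hwidth : 3 * (8 * √(2 * saeLog A)) * ((N / r + (A.K + 1) * r) / 2)
        ≤ 3 * (8 * (4 * ℓ)) * (2 * r ^ 2) := by
      have e1 := h.elim_width_le ω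
      have e2 := h.sqrt_saeLog_le
      gcongr
    rw [Finset.sum_sub_distrib, Finset.sum_const, Finset.card_range, nsmul_eq_mul] at hsum
    change ∑ k ∈ Finset.range N, armGFT A P ω (elimArm A ω k) - _ ≤ _ at hGk
    have hK := h.K_add_one_le
    have hrr : r ≤ r ^ 2 := le_self_pow₀ hr1 (by norm_num)
    have ho2 : (2 * A.T0 + 1) * opt P ≤ 2 * A.T0 + 1 := mul_le_of_le_one_right (by positivity) ho1
    rw [hsplit]
    nlinarith
  · have htot := (totals_nonneg_of_not_terminates (fun t => (hω t).1) hTerm).1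
    have hsplit : (A.T : ℝ) = 2 * A.T0 + 1 + k := by
      have e1 := hnterm hTerm
      have e3 : A.T = 2 * A.T0 + 1 + k := by omega
      exact_mod_cast e3
    have ho2 : (2 * A.T0 + 1) * opt P ≤ 2 * A.T0 + 1 := mul_le_of_le_one_right (by positivity) ho1
    rw [hsplit]
    nlinarith

/-- The threshold `β` exceeds the revenue that exploration and elimination lose on a typical sample
path. -/
lemma UnitSupported.totalRev_nonneg (hP : UnitSupported P) (h : Tuned A M r ℓ)
    {i : ℕ} (hi : i ≤ A.K) {q : ℝ}
    (hrev : -((1 + |M|) / r) ≤ expRev P (sellerPrice A i) q)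
    {ω : ℕ → Round n} (hω : ∀ t, Valid (ω t).1 ∧ (ω t).2 ∈ Set.Icc (0 : ℝ) 1)
    (hN : HasGridNeighbour A P q (2 * ℓ / r) ω) (hR : RewardAccurate A P ω)
    (hC : CostNotHigh A P i ω) (hC' : CostNotLow A P ω)
    (hV : RevNotLow A P (2 * r ^ 2 * ℓ) ω) : 0 ≤ totalRev A ω := by
  by_cases hTerm : Terminates A ω
  swap
  · exact (totals_nonneg_of_not_terminates (fun t => (hω t).1) hTerm).2
  have hr := h.r_pos
  have hr1 := h.one_le_r
  have hℓ := h.one_le_ℓ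
  have hM := abs_nonneg M
  obtain ⟨a₀, ha₀, ha₀i, -, hR₀⟩ := hP.exists_grid_arm hi hN
  have hζ : A.ζ = (1 + |M|) / r + 2 * ℓ / r := by rw [h.ζ_eq]; ring
  have hsum := hP.sum_neg_rev_le h.ζ_pos.le hTerm ha₀ (by linarith) hr hR (ha₀i ▸ hC) hC'
  have htot := (totals_ge_of_terminates hω hTerm).2
  have hVk := hV hTerm
  have hζN := h.elimRounds_mul_le ω (x := 1 + |M| + 2 * ℓ) (by positivity)
  rw [← h.ζ_eq] at hζN
  have hζ1 : A.ζ ≤ 1 + |M| + 2 * ℓ := by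
    rw [h.ζ_eq]
    exact div_le_self (by positivity) hr1
  set N := elimRounds A ω
  have hwidth : 3 * ((1 + A.ζ) * 2 * √(2 * saeLog A)) * ((N / r + (A.K + 1) * r) / 2)
      ≤ 3 * (((4 + |M|) * ℓ) * 2 * (4 * ℓ)) * (2 * r ^ 2) := by
    have e1 := h.elim_width_le ω
    have e2 := h.sqrt_saeLog_le
    have e3 : 1 + A.ζ ≤ (4 + |M|) * ℓ := by nlinarith
    have e4 := h.ζ_pos
    gcongr
  rw [Finset.sum_sub_distrib, Finset.sum_const, Finset.card_range, nsmul_eq_mul,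
    Finset.sum_neg_distrib] at hsum
  change ∑ k ∈ Finset.range N, armRev A P ω (elimArm A ω k) - _ ≤ _ at hVk
  have hK := h.K_add_one_le
  have hrr : r ≤ r ^ 2 := le_self_pow₀ hr1 (by norm_num)
  have hT0le := h.T0_le
  have hβ := h.β_eq
  have hp1 : r ^ 2 ≤ ℓ ^ 2 * r ^ 2 := le_mul_of_one_le_left (by positivity) (one_le_pow₀ hℓ)
  have hp2 : ℓ * r ^ 2 ≤ ℓ ^ 2 * r ^ 2 := by
    gcongr
    exact le_self_pow₀ hℓ (by norm_num)
  have hp3 : |M| * r ^ 2 ≤ |M| * (ℓ ^ 2 * r ^ 2) := by gcongr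
  have hp4 : 0 ≤ |M| * (ℓ ^ 2 * r ^ 2) := by positivity
  nlinarith

end Typical

/-! ### Probability of the typical sample paths -/

section Assembly

variable {n : ℕ} {A : Params} {P : Measure (Val n)} [IsProbabilityMeasure P] {M r ℓ : ℝ}

/-- Outside `E₁` the regret is small, outside `E₁ ∪ E₂` the revenue is nonnegative. Only the
probability of `E₁` enters the expected regret, and it is of order `T ^ (-1/3)` for every `δ`. -/
lemma UnitSupported.exists_failure_sets (hP : UnitSupported P)
    (hD : IndependentSides P ∨ BoundedDensity M P) (h : Tuned A M r ℓ) :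
    ∃ E₁ E₂ : Set (ℕ → Round n), (seqLaw P).real E₁ ≤ 6 / r ∧
      (seqLaw P).real E₁ + (seqLaw P).real E₂ ≤ 6 * A.δ ∧
      ∀ ω : ℕ → Round n, (∀ t, Valid (ω t).1 ∧ (ω t).2 ∈ Set.Icc (0 : ℝ) 1) → ω ∉ E₁ →
        A.T * opt P - totalGFT A ω ≤ 450 * (4 + |M|) * ℓ ^ 3 * r ^ 2 ∧
        (ω ∉ E₂ → 0 ≤ totalRev A ω) := by
  have hr := h.r_pos
  have hℓ := h.one_le_ℓ
  have hδ := h.δ_pos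
  have hM := abs_nonneg M
  rcases le_or_gt A.T (2 * A.T0) with hsmall | hT2
  · -- the horizon is too short for the elimination phase
    refine ⟨∅, ∅, by rw [measureReal_empty]; positivity, by
      rw [measureReal_empty]; linarith, fun ω hω _ => ?_⟩
    have hTerm : ¬ Terminates A ω := fun hT => by
      have := hT.stopTime_lt
      have := le_stopTime (A := A) (ω := ω)
      omega
    have htot := totals_nonneg_of_not_terminates (fun t => (hω t).1) hTerm
    refine ⟨?_, fun _ => htot.2⟩
    have h1 : (A.T : ℝ) ≤ 2 * A.T0 := by exact_mod_cast hsmall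
    have h2 : A.T * opt P ≤ A.T := mul_le_of_le_one_right (Nat.cast_nonneg _) hP.opt_le_one
    have h3 : r ^ 2 ≤ ℓ ^ 3 * r ^ 2 := le_mul_of_one_le_left (by positivity) (one_le_pow₀ hℓ)
    have h4 : 0 ≤ |M| * (ℓ ^ 3 * r ^ 2) := by positivity
    nlinarith [h.T0_le]
  have hT0 := h.T0_pos
  have h2 : 2 ≤ A.T := by omega
  obtain ⟨i, hi, q, hq, hopt, hrev⟩ := hP.exists_comparator hD h
  obtain ⟨a₁, ha₁, ρ, hρ, hconst, hoptρ⟩ := hP.exists_revenue_arm h.K_pos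
    (Tuned.one_le_dyadic h2)
  have hL0 := (Real.log_nonneg h.one_le_div).trans (h.log_le_ucbLog h2)
  have p1 := (prob_not_hasGridNeighbour (P := P) A hT0 h.K_pos hq (γ := 2 * ℓ / r)
    (ε := A.T0 * ℓ / r) (by positivity) (by positivity) (by
      have h1 : (A.T0 : ℝ) / A.K ≤ A.T0 / r := by have := h.le_K; gcongr
      have h3 : (A.T0 : ℝ) / r ≤ A.T0 * ℓ / r := by
        gcongr
        exact le_mul_of_one_le_right (Nat.cast_nonneg _) hℓ
      have h4 : (A.T0 : ℝ) * (2 * ℓ / r) = A.T0 * ℓ / r + A.T0 * ℓ / r := by ring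
      linarith)).trans h.exp_grid_le
  have p2 := (hP.prob_not_ucbOptimistic A ha₁ hconst hL0).trans (h.exp_ucb_le h2)
  have p3 := (prob_not_exploreAccurate (P := P) A hT0 h.exploreLog_nonneg).trans h.exp_explore_le
  have p4 := (hP.prob_not_rewardAccurate A h.saeLog_nonneg).trans h.exp_reward_le
  have p5 := (hP.prob_not_costNotHigh A h.saeLog_nonneg h.ζ_pos.le i).trans h.exp_costHigh_le
  have p6 := (hP.prob_not_gftNotLow A (by omega) (ε := 2 * r ^ 2 * ℓ) (by positivity)).trans
    h.exp_sum_le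
  have p7 := (hP.prob_not_costNotLow A h.saeLog_nonneg h.ζ_pos.le).trans h.exp_costLow_le
  have p8 := (hP.prob_not_revNotLow A (by omega) (ε := 2 * r ^ 2 * ℓ) (by positivity)).trans
    h.exp_sum_le
  set S1 : Set (ℕ → Round n) := {ω | ¬ HasGridNeighbour A P q (2 * ℓ / r) ω}
  set S2 : Set (ℕ → Round n) :=
    {ω | ¬ UCBOptimistic A a₁ ρ (Real.log (2 * (fSet A).card * A.T / A.δ)) ω}
  set S3 : Set (ℕ → Round n) := {ω | ¬ ExploreAccurate A P (exploreWidth A) ω}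
  set S4 : Set (ℕ → Round n) := {ω | ¬ RewardAccurate A P ω}
  set S5 : Set (ℕ → Round n) := {ω | ¬ CostNotHigh A P i ω}
  set S6 : Set (ℕ → Round n) := {ω | ¬ GFTNotLow A P (2 * r ^ 2 * ℓ) ω}
  set S7 : Set (ℕ → Round n) := {ω | ¬ CostNotLow A P ω}
  set S8 : Set (ℕ → Round n) := {ω | ¬ RevNotLow A P (2 * r ^ 2 * ℓ) ω}
  have hE₁ : (seqLaw P).real (S1 ∪ S2 ∪ S3 ∪ S4 ∪ S5 ∪ S6) ≤ 5 * (A.δ / A.T) + A.δ / (2 * r) := by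
    have e1 := measureReal_union_le (μ := seqLaw P) (S1 ∪ S2 ∪ S3 ∪ S4 ∪ S5) S6
    have e2 := measureReal_union_le (μ := seqLaw P) (S1 ∪ S2 ∪ S3 ∪ S4) S5
    have e3 := measureReal_union_le (μ := seqLaw P) (S1 ∪ S2 ∪ S3) S4
    have e4 := measureReal_union_le (μ := seqLaw P) (S1 ∪ S2) S3
    have e5 := measureReal_union_le (μ := seqLaw P) S1 S2
    have p3' : (seqLaw P).real S3 ≤ A.δ / A.T := p3
    linarith
  have hE₂ : (seqLaw P).real (S7 ∪ S8) ≤ A.δ / 2 + A.δ / A.T :=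
    (measureReal_union_le _ _).trans (add_le_add p7 p8)
  have hrT : r ≤ A.T := by
    rw [← h.r_pow]
    exact le_self_pow₀ h.one_le_r (by norm_num)
  refine ⟨S1 ∪ S2 ∪ S3 ∪ S4 ∪ S5 ∪ S6, S7 ∪ S8, hE₁.trans ?_, (add_le_add hE₁ hE₂).trans ?_,
    fun ω hω hω₁ => ?_⟩
  · have h1 : A.δ / A.T ≤ 1 / r := by
      have := h.δ_lt.le
      gcongr
    have h3 : A.δ / (2 * r) ≤ 1 / r := by
      have := h.δ_lt.le
      gcongr
      linarith
    have h4 : 6 / r = 5 * (1 / r) + 1 / r := by ring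
    linarith
  · have hT3 : (2 : ℝ) ≤ A.T := by exact_mod_cast h2
    have h1 : A.δ / A.T ≤ A.δ / 2 := by gcongr
    have h3 : A.δ / (2 * r) ≤ A.δ / 2 := by
      have := h.one_le_r
      gcongr
      linarith
    linarith
  · simp only [Set.mem_union, not_or, S1, S2, S3, S4, S5, S6, Set.mem_ofPred_eq, not_not] at hω₁
    obtain ⟨⟨⟨⟨⟨g1, g2⟩, g3⟩, g4⟩, g5⟩, g6⟩ := hω₁
    refine ⟨hP.regret_le h hT2 hi hopt hrev ha₁ hρ hoptρ hω g1 g2 g3 g4 g5 g6, fun hω₂ => ?_⟩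
    simp only [Set.mem_union, not_or, S7, S8, Set.mem_ofPred_eq, not_not] at hω₂
    exact hP.totalRev_nonneg h hi hrev hω g1 g4 g5 hω₂.1 hω₂.2

lemma UnitSupported.integrable_totalGFT (hP : UnitSupported P) (A : Params) :
    Integrable (fun ω : ℕ → Round n => totalGFT A ω) (seqLaw P) :=
  Integrable.of_bound (measurable_totalGFT A).aestronglyMeasurable A.T
    (hP.ae_valid.mono fun _ hω => abs_totalGFT_le fun t => (hω t).1)

/-- The failure set enters the expected regret with the trivial bound `2 T`. -/
lemma UnitSupported.expected_regret_le (hP : UnitSupported P) (h : Tuned A M r ℓ) {b : ℝ}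
    (hb : 0 ≤ b) {E : Set (ℕ → Round n)} (hE : (seqLaw P).real E ≤ 6 / r)
    (hreg : ∀ ω : ℕ → Round n, (∀ t, Valid (ω t).1 ∧ (ω t).2 ∈ Set.Icc (0 : ℝ) 1) → ω ∉ E →
        A.T * opt P - totalGFT A ω ≤ b) :
    A.T * opt P - ∫ ω, totalGFT A ω ∂(seqLaw P) ≤ b + 12 * r ^ 2 := by
  have hr := h.r_pos
  have hint := hP.integrable_totalGFT A
  -- `E` need not be measurable
  set E' := toMeasurable (seqLaw P) E with hE'
  have hE'm : MeasurableSet E' := measurableSet_toMeasurable _ _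
  have hE'r : (seqLaw P).real E' ≤ 6 / r := by
    rw [hE', measureReal_def, measure_toMeasurable]
    exact hE
  have h1 : ∫ ω, (A.T * opt P - totalGFT A ω) ∂(seqLaw P)
      ≤ ∫ ω, (b + E'.indicator (fun _ => 2 * (A.T : ℝ)) ω) ∂(seqLaw P) := by
    refine integral_mono_ae ((integrable_const _).sub hint)
      ((integrable_const _).add ((integrable_const _).indicator hE'm)) ?_
    filter_upwards [hP.ae_valid] with ω hω
    by_cases hωE : ω ∈ E'
    · rw [Set.indicator_of_mem hωE]
      have h2 := (abs_le.1 (abs_totalGFT_le (A := A) fun t => (hω t).1)).1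
      have h3 : A.T * opt P ≤ A.T := mul_le_of_le_one_right (Nat.cast_nonneg _) hP.opt_le_one
      linarith
    · rw [Set.indicator_of_notMem hωE, add_zero]
      exact hreg ω hω fun hω' => hωE (subset_toMeasurable _ _ hω')
  rw [integral_sub (integrable_const _) hint, integral_add (integrable_const _)
    ((integrable_const _).indicator hE'm), integral_indicator_const _ hE'm] at h1
  simp only [integral_const, probReal_univ, smul_eq_mul] at h1
  have h2 : (seqLaw P).real E' * (2 * A.T) ≤ 6 / r * (2 * A.T) := by gcongr
  have h3 : 6 / r * (2 * (A.T : ℝ)) = 12 * r ^ 2 := by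
    rw [← h.r_pow]; field_simp; ring
  linarith

/-- Stated for arbitrary events, as measurability of the events above is not needed. -/
lemma UnitSupported.one_sub_le_prob (hP : UnitSupported P) {E : Set (ℕ → Round n)} {x : ℝ}
    (hE : (seqLaw P).real E ≤ x) {Q : (ℕ → Round n) → Prop}
    (hQ : ∀ ω : ℕ → Round n, (∀ t, Valid (ω t).1 ∧ (ω t).2 ∈ Set.Icc (0 : ℝ) 1) → ω ∉ E → Q ω) :
    1 - x ≤ (seqLaw P).real {ω | Q ω} := by
  have h1 : (seqLaw P) Set.univ ≤ (seqLaw P) ({ω | Q ω} ∪ E) := by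
    refine measure_mono_ae (hP.ae_valid.mono fun ω hω _ => ?_)
    by_cases hωE : ω ∈ E
    · exact Or.inr hωE
    · exact Or.inl (hQ ω hω hωE)
  have h2 : (seqLaw P).real Set.univ ≤ (seqLaw P).real ({ω | Q ω} ∪ E) :=
    ENNReal.toReal_mono (measure_ne_top _ _) h1
  have h3 := measureReal_union_le (μ := seqLaw P) {ω | Q ω} E
  rw [probReal_univ] at h2
  linarith

end Assembly

end TwoSidedMarket

open TwoSidedMarket in
theorem mainTheorem2 (M : ℝ) :
    ∃ (C : ℝ) (c : ℕ) (β ζ : ℕ → ℝ → ℝ),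
      (∀ (T : ℕ) (δ : ℝ), 1 ≤ T → 0 < δ → δ < 1 →
        0 < β T δ ∧ β T δ ≤ C * (T : ℝ) ^ (2 / 3 : ℝ) * (1 + Real.log (T / δ)) ^ c ∧
        0 < ζ T δ ∧ ζ T δ ≤ C * (T : ℝ) ^ (-(1 / 3) : ℝ) * (1 + Real.log (T / δ)) ^ c) ∧
      ∀ (n : ℕ) (P : Measure (Val n)) [IsProbabilityMeasure P], 1 ≤ n → UnitSupported P →
        (IndependentSides P ∨ BoundedDensity M P) →
        ∀ (T : ℕ) (δ : ℝ), 1 ≤ T → 0 < δ → δ < 1 →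
          ∀ A : Params,
            A = { K := ⌈(T : ℝ) ^ (1 / 3 : ℝ)⌉₊, T0 := ⌈(T : ℝ) ^ (2 / 3 : ℝ)⌉₊, T := T,
                  δ := δ, β := β T δ, ζ := ζ T δ } →
            Integrable (fun ω : ℕ → Round n => totalGFT A ω) (seqLaw P) ∧
            T * opt P - ∫ ω, totalGFT A ω ∂(seqLaw P)
              ≤ C * (T : ℝ) ^ (2 / 3 : ℝ) * (1 + Real.log (T / δ)) ^ c ∧
            1 - 6 * δ ≤ (seqLaw P).real {ω : ℕ → Round n |
              T * opt P - totalGFT A ω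
                ≤ C * (T : ℝ) ^ (2 / 3 : ℝ) * (1 + Real.log (T / δ)) ^ c ∧
              0 ≤ totalRev A ω} := by
  refine ⟨500 * (4 + |M|), 3,
    fun T δ => 60 * (4 + |M|) * (1 + Real.log (T / δ)) ^ 2 * ((T : ℝ) ^ (1 / 3 : ℝ)) ^ 2,
    fun T δ => (1 + |M| + 2 * (1 + Real.log (T / δ))) / (T : ℝ) ^ (1 / 3 : ℝ), ?_, ?_⟩
  · intro T δ hT h0 h1
    have h := tuned_of_eq M hT h0 h1 rfl rfl
    have hℓ := h.one_le_ℓ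
    have hr := h.r_pos
    have hM := abs_nonneg M
    refine ⟨h.β_pos, ?_, h.ζ_pos, ?_⟩
    · beta_reduce
      rw [rpow_two_thirds]
      generalize (T : ℝ) ^ (1 / 3 : ℝ) = r at *
      generalize 1 + Real.log (T / δ) = ℓ at *
      have h2 : ℓ ^ 2 ≤ ℓ ^ 3 := pow_le_pow_right₀ hℓ (by norm_num)
      calc 60 * (4 + |M|) * ℓ ^ 2 * r ^ 2 ≤ 500 * (4 + |M|) * ℓ ^ 3 * r ^ 2 := by
            gcongr
            norm_num
        _ = _ := by ring
    · beta_reduce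
      rw [Real.rpow_neg (Nat.cast_nonneg T)]
      generalize (T : ℝ) ^ (1 / 3 : ℝ) = r at *
      generalize 1 + Real.log (T / δ) = ℓ at *
      have h2 : ℓ ≤ ℓ ^ 3 := le_self_pow₀ hℓ (by norm_num)
      have h3 : |M| ≤ |M| * ℓ ^ 3 := le_mul_of_one_le_right hM (one_le_pow₀ hℓ)
      rw [div_eq_mul_inv, mul_right_comm]
      gcongr
      nlinarith
  · intro n P _ _ hP hD T δ hT h0 h1 A hA
    have h : Tuned A M ((T : ℝ) ^ (1 / 3 : ℝ)) (1 + Real.log (T / δ)) :=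
      hA ▸ tuned_of_eq M hT h0 h1 rfl rfl
    obtain ⟨E₁, E₂, hE₁, hE, hgood⟩ := hP.exists_failure_sets hD h
    have hAT : A.T = T := by rw [hA]
    have hAδ : A.δ = δ := by rw [hA]
    rw [hAT] at hgood
    rw [hAδ] at hE
    have hℓ := h.one_le_ℓ
    have hr := h.r_pos
    have hM := abs_nonneg M
    have hexp := hP.expected_regret_le h
      (b := 450 * (4 + |M|) * (1 + Real.log (T / δ)) ^ 3 * ((T : ℝ) ^ (1 / 3 : ℝ)) ^ 2)
      (by positivity) hE₁
      (fun ω hω hω₁ => by rw [hAT]; exact (hgood ω hω hω₁).1)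
    rw [hAT] at hexp
    rw [rpow_two_thirds]
    generalize (T : ℝ) ^ (1 / 3 : ℝ) = r at *
    generalize 1 + Real.log (T / δ) = ℓ at *
    have h2 : r ^ 2 ≤ ℓ ^ 3 * r ^ 2 := le_mul_of_one_le_left (by positivity) (one_le_pow₀ hℓ)
    have h3 : 0 ≤ |M| * (ℓ ^ 3 * r ^ 2) := by positivity
    have hC : 450 * (4 + |M|) * ℓ ^ 3 * r ^ 2 + 12 * r ^ 2
        ≤ 500 * (4 + |M|) * r ^ 2 * ℓ ^ 3 := by nlinarith
    refine ⟨hP.integrable_totalGFT A, hexp.trans hC, ?_⟩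
    refine hP.one_sub_le_prob ((measureReal_union_le E₁ E₂).trans hE) fun ω hω hωE => ?_
    have hω₁ : ω ∉ E₁ := fun h => hωE (Or.inl h)
    have hω₂ : ω ∉ E₂ := fun h => hωE (Or.inr h)
    obtain ⟨g1, g2⟩ := hgood ω hω hω₁
    exact ⟨by linarith [sq_nonneg r], g2 hω₂⟩
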